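/- Let $\Omega\subset\mathbb C^n$ be open, let $N\subset\Omega$ be a complex submanifold with $0\in N$, and let $\rho\colon\Omega\to N$ be a holomorphic retraction, i.e. a holomorphic map with $\rho|_N=\mathrm{id}_N$. Let $S$ be a compact smooth manifold, possibly with boundary, and let $A\subset S$ be closed. Fix a regularity class: either $C^k$ with $k=0,1,2,\dots$, or the Sobolev class $W^{k,p}$ with $k=1,2,\dots$, $1\le p<\infty$, $kp>\dim S$ (whose elements are identified with their continuous representatives). For a set $M\subset\mathbb C^n$ containing $0$, let $M_{S,A}$ be the set of maps $x\colon(S,A)\to(M,0)$ of the given regularity that are homotopic, through continuous maps $(S,A)\to(M,0)$, to the constant map $0$; the space $\mathbb C^n_{S,A}$, which consists of all maps $(S,A)\to(\mathbb C^n,0)$ of the given regularity, carries the $C^k$, respectively $W^{k,p}$, norm computed in any finite atlas. A relatively closed subset $P$ of an open subset $Q$ of a complex Banach space is called a complex submanifold of $Q$ if every $x\in P$ has a neighborhood $\mathcal U\subset Q$ with a biholomorphic map $\Phi$ of $\mathcal U$ onto an open subset $\mathcal V$ of some complex Banach space $X$ such that $\Phi(P\cap\mathcal U)=Y\cap\mathcal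 V$ for a closed subspace $Y\subset X$; it is called direct if the subspaces $Y$ can be chosen to have closed complements in $X$. Then $\mathbb C^n_{S,A}$ is a Banach space, $\Omega_{S,A}\subset\mathbb C^n_{S,A}$ is open, $N_{S,A}\subset\Omega_{S,A}$ is a direct complex submanifold, and the map $\Omega_{S,A}\ni x\mapsto\rho\circ x\in N_{S,A}$ is a holomorphic retraction onto it. -/

import Mathlib

open Set MeasureTheory Topology
open scoped Manifold ContDiff NNReal

set_option linter.unusedSectionVars false

noncomputable section

universe u

/-! ### Weak derivatives and Sobolev functions on open subsets of `ℝᵈ` -/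

section WeakDerivatives

variable {d : ℕ} {F : Type*} [NormedAddCommGroup F] [NormedSpace ℂ F]

/-- The partial derivative `∂_{J 0} ⋯ ∂_{J (j-1)} φ` of a function `φ` on `ℝᵈ`. -/
def partialDeriv {j : ℕ} (J : Fin j → Fin d) (φ : EuclideanSpace ℝ (Fin d) → ℝ)
    (y : EuclideanSpace ℝ (Fin d)) : ℝ :=
  iteratedFDeriv ℝ j φ y (fun l => EuclideanSpace.single (J l) (1 : ℝ))

/-- `g` is a weak partial derivative `∂_{J 0} ⋯ ∂_{J (j-1)} u` on the open set `V ⊆ ℝᵈ`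
(values outside `V` are irrelevant). -/
def IsWeakDeriv (V : Set (EuclideanSpace ℝ (Fin d))) {j : ℕ} (J : Fin j → Fin d)
    (u g : EuclideanSpace ℝ (Fin d) → F) : Prop :=
  LocallyIntegrableOn u V ∧ LocallyIntegrableOn g V ∧
    ∀ φ : EuclideanSpace ℝ (Fin d) → ℝ, ContDiff ℝ ∞ φ → HasCompactSupport φ → tsupport φ ⊆ V →
      ∫ y, partialDeriv J φ y • u y = (-1 : ℝ) ^ j • ∫ y, φ y • g y

open Classical in
/-- The weak derivative `∂_J u` on `V` (unique up to null sets), if there is one. -/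
def weakDeriv (V : Set (EuclideanSpace ℝ (Fin d))) {j : ℕ} (J : Fin j → Fin d)
    (u : EuclideanSpace ℝ (Fin d) → F) : EuclideanSpace ℝ (Fin d) → F :=
  if h : ∃ g, IsWeakDeriv V J u g then h.choose else 0

/-- `u ∈ W^{k,p}(V)`: all weak partial derivatives of order `≤ k` exist and are in `L^p(V)`
(order `0` says that `u` itself is in `L^p(V)`). -/
def MemSobolevOn (V : Set (EuclideanSpace ℝ (Fin d))) (k : ℕ) (p : ℝ≥0)
    (u : EuclideanSpace ℝ (Fin d) → F) : Prop :=
  ∀ j ≤ k, ∀ J : Fin j → Fin d, ∃ g, IsWeakDeriv V J u g ∧ MemLp g p (volume.restrict V)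

/-- The `W^{k,p}(V)` norm: the sum of the `L^p(V)` norms of the weak derivatives of
order `≤ k`. -/
def sobolevNormOn (V : Set (EuclideanSpace ℝ (Fin d))) (k : ℕ) (p : ℝ≥0)
    (u : EuclideanSpace ℝ (Fin d) → F) : ℝ :=
  ∑ j ∈ Finset.range (k + 1), ∑ J : Fin j → Fin d,
    (eLpNorm (weakDeriv V J u) p (volume.restrict V)).toReal

lemma continuous_partialDeriv {j : ℕ} (J : Fin j → Fin d) {φ : EuclideanSpace ℝ (Fin d) → ℝ}
    (hφ : ContDiff ℝ ∞ φ) : Continuous (partialDeriv J φ) := by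
  have h : Continuous (iteratedFDeriv ℝ j φ) :=
    hφ.continuous_iteratedFDeriv (by exact_mod_cast le_top)
  unfold partialDeriv
  fun_prop

lemma tsupport_partialDeriv_subset {j : ℕ} (J : Fin j → Fin d)
    (φ : EuclideanSpace ℝ (Fin d) → ℝ) : tsupport (partialDeriv J φ) ⊆ tsupport φ := by
  refine (closure_mono ?_).trans (tsupport_iteratedFDeriv_subset (𝕜 := ℝ) (f := φ) j)
  intro y hy h0
  exact hy (by simp [partialDeriv, h0])

lemma integrable_test_smul {V : Set (EuclideanSpace ℝ (Fin d))}
    {ψ : EuclideanSpace ℝ (Fin d) → ℝ} {g : EuclideanSpace ℝ (Fin d) → F}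
    (hψ : Continuous ψ) (hc : HasCompactSupport ψ) (hV : tsupport ψ ⊆ V)
    (hg : LocallyIntegrableOn g V) : Integrable (fun y => ψ y • g y) := by
  have h1 : IntegrableOn g (tsupport ψ) := hg.integrableOn_compact_subset hV hc
  have h2 : IntegrableOn (fun y => ψ y • g y) (tsupport ψ) :=
    h1.continuousOn_smul hψ.continuousOn hc
  refine (integrableOn_iff_integrable_of_support_subset ?_).1 h2
  intro y hy
  refine subset_tsupport ψ ?_
  intro h0
  exact hy (by simp [h0])

lemma IsWeakDeriv.add {V : Set (EuclideanSpace ℝ (Fin d))} {j : ℕ} {J : Fin j → Fin d}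
    {u u' g g' : EuclideanSpace ℝ (Fin d) → F} (h : IsWeakDeriv V J u g)
    (h' : IsWeakDeriv V J u' g') : IsWeakDeriv V J (u + u') (g + g') := by
  refine ⟨h.1.add h'.1, h.2.1.add h'.2.1, fun φ hφ hc hV => ?_⟩
  have hc' : HasCompactSupport (partialDeriv J φ) :=
    hc.of_isClosed_subset (isClosed_tsupport _) (tsupport_partialDeriv_subset J φ)
  have hV' := (tsupport_partialDeriv_subset J φ).trans hV
  have hd := continuous_partialDeriv J hφ
  simp only [Pi.add_apply, smul_add]
  rw [integral_add (integrable_test_smul hd hc' hV' h.1) (integrable_test_smul hd hc' hV' h'.1),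
    integral_add (integrable_test_smul hφ.continuous hc hV h.2.1)
      (integrable_test_smul hφ.continuous hc hV h'.2.1), h.2.2 φ hφ hc hV, h'.2.2 φ hφ hc hV,
    smul_add]

lemma IsWeakDeriv.const_smul {V : Set (EuclideanSpace ℝ (Fin d))} {j : ℕ} {J : Fin j → Fin d}
    {u g : EuclideanSpace ℝ (Fin d) → F} (c : ℂ) (h : IsWeakDeriv V J u g) :
    IsWeakDeriv V J (c • u) (c • g) := by
  refine ⟨h.1.smul c, h.2.1.smul c, fun φ hφ hc hV => ?_⟩
  simp only [Pi.smul_apply, smul_comm _ c]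
  rw [integral_smul, integral_smul, h.2.2 φ hφ hc hV, smul_comm]

lemma IsWeakDeriv.ae_eq [CompleteSpace F] {V : Set (EuclideanSpace ℝ (Fin d))} (hVo : IsOpen V)
    {j : ℕ} {J : Fin j → Fin d} {u g g' : EuclideanSpace ℝ (Fin d) → F}
    (h : IsWeakDeriv V J u g) (h' : IsWeakDeriv V J u g') : g =ᵐ[volume.restrict V] g' := by
  have key : ∀ᵐ y, y ∈ V → (g - g') y = 0 := by
    refine hVo.ae_eq_zero_of_integral_contDiff_smul_eq_zero (h.2.1.sub h'.2.1) ?_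
    intro φ hφ hc hV
    have e := (h.2.2 φ hφ hc hV).symm.trans (h'.2.2 φ hφ hc hV)
    have e' : ∫ y, φ y • g y = ∫ y, φ y • g' y :=
      smul_right_injective F (pow_ne_zero j (by norm_num : (-1 : ℝ) ≠ 0)) e
    simp only [Pi.sub_apply, smul_sub]
    rw [integral_sub (integrable_test_smul hφ.continuous hc hV h.2.1)
      (integrable_test_smul hφ.continuous hc hV h'.2.1), e', sub_self]
  rw [Filter.EventuallyEq, ae_restrict_iff' hVo.measurableSet]
  filter_upwards [key] with y hy hyV
  exact sub_eq_zero.1 (hy hyV)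

lemma MemSobolevOn.isWeakDeriv {V : Set (EuclideanSpace ℝ (Fin d))} {k : ℕ} {p : ℝ≥0}
    {u : EuclideanSpace ℝ (Fin d) → F} (h : MemSobolevOn V k p u) {j : ℕ} (hj : j ≤ k)
    (J : Fin j → Fin d) : IsWeakDeriv V J u (weakDeriv V J u) := by
  have hex : ∃ g, IsWeakDeriv V J u g := (h j hj J).imp fun _ hg => hg.1
  rw [weakDeriv, dif_pos hex]
  exact hex.choose_spec

lemma MemSobolevOn.memLp [CompleteSpace F] {V : Set (EuclideanSpace ℝ (Fin d))} (hVo : IsOpen V)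
    {k : ℕ} {p : ℝ≥0} {u : EuclideanSpace ℝ (Fin d) → F} (h : MemSobolevOn V k p u) {j : ℕ}
    (hj : j ≤ k) (J : Fin j → Fin d) : MemLp (weakDeriv V J u) p (volume.restrict V) := by
  obtain ⟨g, hg, hg'⟩ := h j hj J
  exact hg'.ae_eq (hg.ae_eq hVo (h.isWeakDeriv hj J))

lemma MemSobolevOn.add {V : Set (EuclideanSpace ℝ (Fin d))} {k : ℕ} {p : ℝ≥0}
    {u u' : EuclideanSpace ℝ (Fin d) → F} (h : MemSobolevOn V k p u)
    (h' : MemSobolevOn V k p u') : MemSobolevOn V k p (u + u') := by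
  intro j hj J
  obtain ⟨g, hg, hgp⟩ := h j hj J
  obtain ⟨g', hg', hgp'⟩ := h' j hj J
  exact ⟨g + g', hg.add hg', hgp.add hgp'⟩

lemma MemSobolevOn.const_smul {V : Set (EuclideanSpace ℝ (Fin d))} {k : ℕ} {p : ℝ≥0}
    {u : EuclideanSpace ℝ (Fin d) → F} (c : ℂ) (h : MemSobolevOn V k p u) :
    MemSobolevOn V k p (c • u) := by
  intro j hj J
  obtain ⟨g, hg, hgp⟩ := h j hj J
  exact ⟨c • g, hg.const_smul c, hgp.const_smul c⟩

lemma memSobolevOn_zero (V : Set (EuclideanSpace ℝ (Fin d))) (k : ℕ) (p : ℝ≥0) :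
    MemSobolevOn V k p (0 : EuclideanSpace ℝ (Fin d) → F) := by
  intro j _ J
  refine ⟨0, ⟨?_, ?_, fun φ _ _ _ => by simp⟩, MemLp.zero⟩
  all_goals exact (locallyIntegrable_zero (X := EuclideanSpace ℝ (Fin d))).locallyIntegrableOn _

lemma sobolevNormOn_nonneg (V : Set (EuclideanSpace ℝ (Fin d))) (k : ℕ) (p : ℝ≥0)
    (u : EuclideanSpace ℝ (Fin d) → F) : 0 ≤ sobolevNormOn V k p u :=
  Finset.sum_nonneg fun _ _ => Finset.sum_nonneg fun _ _ => ENNReal.toReal_nonneg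

lemma sobolevNormOn_add_le [CompleteSpace F] {V : Set (EuclideanSpace ℝ (Fin d))} (hVo : IsOpen V)
    {k : ℕ} {p : ℝ≥0} (hp : 1 ≤ p) {u u' : EuclideanSpace ℝ (Fin d) → F}
    (h : MemSobolevOn V k p u) (h' : MemSobolevOn V k p u') :
    sobolevNormOn V k p (u + u') ≤ sobolevNormOn V k p u + sobolevNormOn V k p u' := by
  unfold sobolevNormOn
  rw [← Finset.sum_add_distrib]
  refine Finset.sum_le_sum fun j hj => ?_
  rw [← Finset.sum_add_distrib]
  refine Finset.sum_le_sum fun J _ => ?_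
  have hj : j ≤ k := Nat.lt_succ_iff.1 (Finset.mem_range.1 hj)
  have e := ((h.add h').isWeakDeriv hj J).ae_eq hVo ((h.isWeakDeriv hj J).add (h'.isWeakDeriv hj J))
  have m := h.memLp hVo hj J
  have m' := h'.memLp hVo hj J
  rw [eLpNorm_congr_ae e, ← ENNReal.toReal_add m.2.ne m'.2.ne]
  exact ENNReal.toReal_mono (ENNReal.add_ne_top.2 ⟨m.2.ne, m'.2.ne⟩)
    (eLpNorm_add_le m.1 m'.1 (by exact_mod_cast hp))

lemma sobolevNormOn_const_smul [CompleteSpace F] {V : Set (EuclideanSpace ℝ (Fin d))}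
    (hVo : IsOpen V) {k : ℕ} {p : ℝ≥0} (c : ℂ) {u : EuclideanSpace ℝ (Fin d) → F}
    (h : MemSobolevOn V k p u) : sobolevNormOn V k p (c • u) = ‖c‖ * sobolevNormOn V k p u := by
  unfold sobolevNormOn
  rw [Finset.mul_sum]
  refine Finset.sum_congr rfl fun j hj => ?_
  rw [Finset.mul_sum]
  refine Finset.sum_congr rfl fun J _ => ?_
  have hj : j ≤ k := Nat.lt_succ_iff.1 (Finset.mem_range.1 hj)
  have e := ((h.const_smul c).isWeakDeriv hj J).ae_eq hVo ((h.isWeakDeriv hj J).const_smul c)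
  rw [eLpNorm_congr_ae e, eLpNorm_const_smul, ENNReal.toReal_mul, toReal_enorm]

lemma isWeakDeriv_order_zero {V : Set (EuclideanSpace ℝ (Fin d))} (J : Fin 0 → Fin d)
    {u : EuclideanSpace ℝ (Fin d) → F} (h : LocallyIntegrableOn u V) : IsWeakDeriv V J u u :=
  ⟨h, h, fun φ _ _ _ => by simp [partialDeriv]⟩

lemma ae_eq_zero_of_sobolevNormOn_eq_zero [CompleteSpace F]
    {V : Set (EuclideanSpace ℝ (Fin d))} (hVo : IsOpen V)
    {k : ℕ} {p : ℝ≥0} (hp : 1 ≤ p) {u : EuclideanSpace ℝ (Fin d) → F}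
    (h : MemSobolevOn V k p u) (h0 : sobolevNormOn V k p u = 0) :
    u =ᵐ[volume.restrict V] 0 := by
  let J : Fin 0 → Fin d := Fin.elim0
  have hw := h.isWeakDeriv (Nat.zero_le k) J
  have hm := h.memLp hVo (Nat.zero_le k) J
  have e := (isWeakDeriv_order_zero J hw.1).ae_eq hVo hw
  have h1 := (Finset.sum_eq_zero_iff_of_nonneg fun _ _ =>
    Finset.sum_nonneg fun _ _ => ENNReal.toReal_nonneg).1 h0 0 (by simp)
  have h2 := (Finset.sum_eq_zero_iff_of_nonneg fun _ _ => ENNReal.toReal_nonneg).1 h1 J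
    (Finset.mem_univ _)
  have h3 : eLpNorm (weakDeriv V J u) p (volume.restrict V) = 0 :=
    (ENNReal.toReal_eq_zero_iff _).1 h2 |>.resolve_right hm.2.ne
  have hp0 : (p : ENNReal) ≠ 0 := by
    exact_mod_cast (zero_lt_one.trans_le hp).ne'
  exact e.trans ((eLpNorm_eq_zero_iff hm.1 hp0).1 h3)

end WeakDerivatives

/-! ### Function spaces on a compact manifold -/

section MappingSpaces

variable {d : ℕ} {H : Type*} [TopologicalSpace H]
  (I : ModelWithCorners ℝ (EuclideanSpace ℝ (Fin d)) H)
  (S : Type u) [TopologicalSpace S] [ChartedSpace H S]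
  {F : Type*} [NormedAddCommGroup F] [NormedSpace ℂ F]

/-- A finite atlas of smooth charts of the manifold `S`, together with open sets `dom i` that
cover `S` and whose closures are contained in the domains of the charts. Such atlases are only
used to write down norms and Sobolev regularity; the choice is immaterial. -/
structure FiniteAtlas where
  /-- the number of charts -/
  card : ℕ
  /-- the charts -/
  chart : Fin card → OpenPartialHomeomorph S H
  chart_mem : ∀ i, chart i ∈ IsManifold.maximalAtlas I ∞ S
  /-- the slightly smaller coordinate domains -/
  dom : Fin card → Set S
  isOpen_dom : ∀ i, IsOpen (dom i)
  closure_dom_subset : ∀ i, closure (dom i) ⊆ (chart i).source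
  iUnion_dom : ⋃ i, dom i = univ

/-- Compact Hausdorff manifolds have such atlases. -/
theorem FiniteAtlas.nonempty [CompactSpace S] [T2Space S] [IsManifold I ∞ S] :
    Nonempty (FiniteAtlas I S) := by
  have h1 : ∀ s : S, ∃ O : Set S, IsOpen O ∧ s ∈ O ∧ closure O ⊆ (chartAt H s).source := by
    intro s
    obtain ⟨O, hO, hsO, hcl⟩ := normal_exists_closure_subset (isClosed_singleton (x := s))
      (chartAt H s).open_source (singleton_subset_iff.2 (mem_chart_source H s))
    exact ⟨O, hO, singleton_subset_iff.1 hsO, hcl⟩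
  choose O hO hsO hcl using h1
  obtain ⟨t, ht⟩ := isCompact_univ.elim_finite_subcover O hO
    (fun s _ => mem_iUnion.2 ⟨s, hsO s⟩)
  refine ⟨⟨t.card, fun i => chartAt H (t.equivFin.symm i : S),
    fun i => IsManifold.chart_mem_maximalAtlas _, fun i => O (t.equivFin.symm i : S),
    fun i => hO _, fun i => hcl _, ?_⟩⟩
  refine eq_univ_of_forall fun s => ?_
  obtain ⟨a, ha, hsa⟩ := mem_iUnion₂.1 (ht (mem_univ s))
  exact mem_iUnion.2 ⟨t.equivFin ⟨a, ha⟩, by simpa using hsa⟩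

/-- The regularity classes `C^k`, `k = 0, 1, 2, …`, and `W^{k,p}`, `k = 1, 2, …`, `1 ≤ p < ∞`,
`k p > d`, on manifolds of dimension `d`. -/
inductive Regularity (d : ℕ) where
  | C (k : ℕ) : Regularity d
  | W (k : ℕ) (p : ℝ≥0) (one_le_k : 1 ≤ k) (one_le_p : 1 ≤ p) (dim_lt : (d : ℝ≥0) < k * p) :
      Regularity d

variable {I S}

namespace FiniteAtlas

variable (𝔄 : FiniteAtlas I S)

/-- The map `x` read in the `i`-th chart. -/
def read (i : Fin 𝔄.card) (x : S → F) : EuclideanSpace ℝ (Fin d) → F :=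
  x ∘ ((𝔄.chart i).extend I).symm

/-- The open subset of `ℝᵈ` that corresponds to `dom i` (minus boundary points of `S`). -/
def coordDom (i : Fin 𝔄.card) : Set (EuclideanSpace ℝ (Fin d)) :=
  interior ((𝔄.chart i).extend I '' 𝔄.dom i)

/-- The `C^k` norm: derivatives of order `≤ k` in the charts, up to and including the boundary. -/
def ckNorm (k : ℕ) (x : S → F) : ℝ :=
  ∑ i, ∑ j ∈ Finset.range (k + 1), ⨆ s : 𝔄.dom i,
    ‖iteratedFDerivWithin ℝ j (𝔄.read i x) ((𝔄.chart i).extend I).target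
      ((𝔄.chart i).extend I s)‖

end FiniteAtlas

namespace Regularity

/-- The continuous map `x` is of the given regularity class. (In the Sobolev case, `k p > d`, and
the elements of `W^{k,p}` are identified with their continuous representatives.) -/
def Mem (𝔄 : FiniteAtlas I S) (R : Regularity d) (x : C(S, F)) : Prop :=
  match R with
  | C k => ContMDiff I 𝓘(ℝ, F) k x
  | W k p _ _ _ => ∀ i, MemSobolevOn (𝔄.coordDom i) k p (𝔄.read i x)

/-- The `C^k`, respectively `W^{k,p}`, norm. -/
def normOn (𝔄 : FiniteAtlas I S) (R : Regularity d) (x : C(S, F)) : ℝ :=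
  match R with
  | C k => 𝔄.ckNorm k x
  | W k p _ _ _ => ∑ i, sobolevNormOn (𝔄.coordDom i) k p (𝔄.read i x)

end Regularity

section NormAxioms

lemma uniqueDiffOn_chartTarget {S : Type*} [TopologicalSpace S]
    (e : OpenPartialHomeomorph S H) : UniqueDiffOn ℝ (e.extend I).target := by
  rw [e.extend_target]
  exact I.uniqueDiffOn_preimage e.open_target

variable (𝔄 : FiniteAtlas I S)

lemma FiniteAtlas.extend_mem_target (i : Fin 𝔄.card) (s : 𝔄.dom i) :
    (𝔄.chart i).extend I s ∈ ((𝔄.chart i).extend I).target := by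
  refine ((𝔄.chart i).extend I).map_source ?_
  rw [OpenPartialHomeomorph.extend_source]
  exact 𝔄.closure_dom_subset i (subset_closure s.2)

lemma FiniteAtlas.ckNorm_nonneg (k : ℕ) (x : S → F) : 0 ≤ 𝔄.ckNorm k x :=
  Finset.sum_nonneg fun _ _ => Finset.sum_nonneg fun _ _ =>
    Real.iSup_nonneg fun _ => norm_nonneg _

lemma FiniteAtlas.read_extend (i : Fin 𝔄.card) (x : S → F) {s : S} (hi : s ∈ 𝔄.dom i) :
    𝔄.read i x ((𝔄.chart i).extend I s) = x s := by
  have hs : s ∈ ((𝔄.chart i).extend I).source := by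
    rw [OpenPartialHomeomorph.extend_source]
    exact 𝔄.closure_dom_subset i (subset_closure hi)
  simp only [FiniteAtlas.read, Function.comp_apply, ((𝔄.chart i).extend I).left_inv hs]

lemma FiniteAtlas.isOpen_coordDom (i : Fin 𝔄.card) : IsOpen (𝔄.coordDom i) := isOpen_interior

lemma FiniteAtlas.coordDom_subset (i : Fin 𝔄.card) :
    𝔄.coordDom i ⊆ ((𝔄.chart i).extend I).target := by
  refine interior_subset.trans ?_
  rintro _ ⟨s, hs, rfl⟩
  exact 𝔄.extend_mem_target i ⟨s, hs⟩

lemma FiniteAtlas.mem_closure_coordDom (i : Fin 𝔄.card) {s : S} (hs : s ∈ 𝔄.dom i) :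
    (𝔄.chart i).extend I s ∈ closure (𝔄.coordDom i) := by
  have hsrc : s ∈ (𝔄.chart i).source := 𝔄.closure_dom_subset i (subset_closure hs)
  have h1 : (𝔄.chart i).extend I '' 𝔄.dom i ∈ 𝓝[range I] ((𝔄.chart i).extend I s) := by
    rw [← (𝔄.chart i).map_extend_nhds hsrc]
    exact Filter.image_mem_map ((𝔄.isOpen_dom i).mem_nhds hs)
  obtain ⟨U, hU, hsU, hUsub⟩ := mem_nhdsWithin.1 h1
  have h2 : (𝔄.chart i).extend I s ∈ closure (interior (range I)) :=
    I.range_subset_closure_interior ⟨_, rfl⟩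
  rw [mem_closure_iff] at h2 ⊢
  intro O hO hsO
  obtain ⟨z, ⟨hzO, hzU⟩, hz⟩ := h2 (O ∩ U) (hO.inter hU) ⟨hsO, hsU⟩
  refine ⟨z, hzO, ?_⟩
  have : U ∩ interior (range I) ⊆ 𝔄.coordDom i :=
    interior_maximal (fun w hw => hUsub ⟨hw.1, interior_subset hw.2⟩) (hU.inter isOpen_interior)
  exact this ⟨hzU, hz⟩

lemma FiniteAtlas.continuousOn_read (i : Fin 𝔄.card) (x : C(S, F)) :
    ContinuousOn (𝔄.read i x) ((𝔄.chart i).extend I).target :=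
  x.continuous.comp_continuousOn ((𝔄.chart i).continuousOn_extend_symm)

lemma FiniteAtlas.eq_zero_of_ae {x : C(S, F)}
    (h : ∀ i, 𝔄.read i x =ᵐ[volume.restrict (𝔄.coordDom i)] 0) : x = 0 := by
  ext s
  obtain ⟨i, hi⟩ := mem_iUnion.1 (𝔄.iUnion_dom ▸ mem_univ s)
  have h1 : EqOn (𝔄.read i x) 0 (𝔄.coordDom i) :=
    Measure.eqOn_open_of_ae_eq (h i) (𝔄.isOpen_coordDom i)
      ((𝔄.continuousOn_read i x).mono (𝔄.coordDom_subset i)) continuousOn_const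
  have h2 : ContinuousWithinAt (𝔄.read i x) (𝔄.coordDom i) ((𝔄.chart i).extend I s) :=
    ((𝔄.continuousOn_read i x) _ (𝔄.extend_mem_target i ⟨s, hi⟩)).mono (𝔄.coordDom_subset i)
  have h3 := h2.mem_closure_image (𝔄.mem_closure_coordDom i hi)
  have h4 : 𝔄.read i x '' 𝔄.coordDom i ⊆ {0} := by
    rintro _ ⟨y, hy, rfl⟩
    exact h1 hy
  have h5 := closure_minimal h4 isClosed_singleton h3
  rw [𝔄.read_extend i x hi] at h5
  exact h5

namespace Regularity

variable (R : Regularity d)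

lemma mem_zero : R.Mem 𝔄 (0 : C(S, F)) := by
  cases R with
  | C k => exact contMDiff_const (c := (0 : F))
  | W k p _ _ _ => exact fun i => memSobolevOn_zero _ _ _

variable {R} in
lemma Mem.add {x y : C(S, F)} (hx : R.Mem 𝔄 x) (hy : R.Mem 𝔄 y) : R.Mem 𝔄 (x + y) := by
  cases R with
  | C k => exact ContMDiff.add (show ContMDiff I 𝓘(ℝ, F) k x from hx) hy
  | W k p _ _ _ => exact fun i => (hx i).add (hy i)

variable {R} in
lemma Mem.const_smul (c : ℂ) {x : C(S, F)} (hx : R.Mem 𝔄 x) : R.Mem 𝔄 (c • x) := by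
  cases R with
  | C k =>
    have hc : ContMDiff 𝓘(ℝ, F) 𝓘(ℝ, F) k (fun v : F => c • v) :=
      (contDiff_const_smul c).contMDiff
    exact hc.comp (show ContMDiff I 𝓘(ℝ, F) k x from hx)
  | W k p _ _ _ => exact fun i => (hx i).const_smul c

end Regularity

variable [IsManifold I ∞ S]

lemma FiniteAtlas.contDiffOn_read {k : ℕ} {x : S → F}
    (hx : ContMDiff I 𝓘(ℝ, F) k x) (i : Fin 𝔄.card) :
    ContDiffOn ℝ k (𝔄.read i x) ((𝔄.chart i).extend I).target := by
  have hk : (k : WithTop ℕ∞) ≤ ∞ := by exact_mod_cast le_top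
  have hm : 𝔄.chart i ∈ IsManifold.maximalAtlas I k S :=
    IsManifold.maximalAtlas_subset_of_le hk (𝔄.chart_mem i)
  have : IsManifold I k S := IsManifold.of_le hk
  rw [← contMDiffOn_iff_contDiffOn, OpenPartialHomeomorph.extend_target']
  exact hx.comp_contMDiffOn (contMDiffOn_extend_symm hm)

lemma FiniteAtlas.bddAbove_ck [CompactSpace S] {k j : ℕ} (hj : j ≤ k) {x : S → F}
    (hx : ContMDiff I 𝓘(ℝ, F) k x) (i : Fin 𝔄.card) :
    BddAbove (range fun s : 𝔄.dom i =>
      ‖iteratedFDerivWithin ℝ j (𝔄.read i x) ((𝔄.chart i).extend I).target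
        ((𝔄.chart i).extend I s)‖) := by
  have h1 : ContinuousOn
      (iteratedFDerivWithin ℝ j (𝔄.read i x) ((𝔄.chart i).extend I).target)
      ((𝔄.chart i).extend I).target :=
    (𝔄.contDiffOn_read hx i).continuousOn_iteratedFDerivWithin (by exact_mod_cast hj)
      (uniqueDiffOn_chartTarget _)
  have h2 : ContinuousOn (fun s => ‖iteratedFDerivWithin ℝ j (𝔄.read i x)
      ((𝔄.chart i).extend I).target ((𝔄.chart i).extend I s)‖) (closure (𝔄.dom i)) := by
    refine (h1.comp (((𝔄.chart i).continuousOn_extend).mono ?_) ?_).norm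
    · rw [OpenPartialHomeomorph.extend_source]
      exact 𝔄.closure_dom_subset i
    · intro s hs
      refine ((𝔄.chart i).extend I).map_source ?_
      rw [OpenPartialHomeomorph.extend_source]
      exact 𝔄.closure_dom_subset i hs
  refine (isClosed_closure.isCompact.bddAbove_image h2).mono ?_
  rintro _ ⟨s, rfl⟩
  exact ⟨s, subset_closure s.2, rfl⟩

lemma FiniteAtlas.ckNorm_add_le [CompactSpace S] {k : ℕ} {x y : S → F}
    (hx : ContMDiff I 𝓘(ℝ, F) k x) (hy : ContMDiff I 𝓘(ℝ, F) k y) :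
    𝔄.ckNorm k (x + y) ≤ 𝔄.ckNorm k x + 𝔄.ckNorm k y := by
  unfold FiniteAtlas.ckNorm
  rw [← Finset.sum_add_distrib]
  refine Finset.sum_le_sum fun i _ => ?_
  rw [← Finset.sum_add_distrib]
  refine Finset.sum_le_sum fun j hj => ?_
  have hj : j ≤ k := Nat.lt_succ_iff.1 (Finset.mem_range.1 hj)
  refine Real.iSup_le (fun s => ?_) (add_nonneg (Real.iSup_nonneg fun _ => norm_nonneg _)
    (Real.iSup_nonneg fun _ => norm_nonneg _))
  have hs := 𝔄.extend_mem_target i s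
  have hjk : (j : WithTop ℕ∞) ≤ k := by exact_mod_cast hj
  have e : 𝔄.read i (x + y) = 𝔄.read i x + 𝔄.read i y := rfl
  rw [e, iteratedFDerivWithin_add_apply (((𝔄.contDiffOn_read hx i) _ hs).of_le hjk)
    (((𝔄.contDiffOn_read hy i) _ hs).of_le hjk) (uniqueDiffOn_chartTarget _) hs]
  exact (norm_add_le _ _).trans (add_le_add (le_ciSup (𝔄.bddAbove_ck hj hx i) s)
    (le_ciSup (𝔄.bddAbove_ck hj hy i) s))

lemma FiniteAtlas.ckNorm_const_smul {k : ℕ} (c : ℂ) {x : S → F}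
    (hx : ContMDiff I 𝓘(ℝ, F) k x) : 𝔄.ckNorm k (c • x) = ‖c‖ * 𝔄.ckNorm k x := by
  unfold FiniteAtlas.ckNorm
  rw [Finset.mul_sum]
  refine Finset.sum_congr rfl fun i _ => ?_
  rw [Finset.mul_sum]
  refine Finset.sum_congr rfl fun j hj => ?_
  have hj : j ≤ k := Nat.lt_succ_iff.1 (Finset.mem_range.1 hj)
  rw [Real.mul_iSup_of_nonneg (norm_nonneg c)]
  congr 1
  funext s
  have hs := 𝔄.extend_mem_target i s
  have hjk : (j : WithTop ℕ∞) ≤ k := by exact_mod_cast hj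
  have e : 𝔄.read i (c • x) = c • 𝔄.read i x := rfl
  rw [e, iteratedFDerivWithin_const_smul_apply (((𝔄.contDiffOn_read hx i) _ hs).of_le hjk)
    (uniqueDiffOn_chartTarget _) hs, norm_smul]

lemma FiniteAtlas.eq_zero_of_ckNorm_eq_zero [CompactSpace S] {k : ℕ} {x : S → F}
    (hx : ContMDiff I 𝓘(ℝ, F) k x) (h0 : 𝔄.ckNorm k x = 0) : x = 0 := by
  funext s
  obtain ⟨i, hi⟩ := mem_iUnion.1 (𝔄.iUnion_dom ▸ mem_univ s)
  have h1 := (Finset.sum_eq_zero_iff_of_nonneg fun _ _ => Finset.sum_nonneg fun _ _ =>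
    Real.iSup_nonneg fun _ => norm_nonneg _).1 h0 i (Finset.mem_univ i)
  have h2 := (Finset.sum_eq_zero_iff_of_nonneg fun _ _ =>
    Real.iSup_nonneg fun _ => norm_nonneg _).1 h1 0 (by simp)
  have h3 := le_ciSup (𝔄.bddAbove_ck (Nat.zero_le k) hx i) ⟨s, hi⟩
  rw [h2, norm_iteratedFDerivWithin_zero] at h3
  rw [𝔄.read_extend i x hi] at h3
  exact norm_le_zero_iff.1 h3

end NormAxioms

/-- The vector space of maps `(S, A) → (F, 0)` of the given regularity. -/
def mapSubmodule (𝔄 : FiniteAtlas I S) (R : Regularity d) (A : Set S)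
    (F : Type*) [NormedAddCommGroup F] [NormedSpace ℂ F] : Submodule ℂ C(S, F) where
  carrier := {x | R.Mem 𝔄 x ∧ ∀ s ∈ A, x s = 0}
  add_mem' := fun hx hy => ⟨hx.1.add 𝔄 hy.1, fun s hs => by simp [hx.2 s hs, hy.2 s hs]⟩
  zero_mem' := ⟨R.mem_zero 𝔄, fun _ _ => rfl⟩
  smul_mem' := fun c x hx => ⟨hx.1.const_smul 𝔄 c, fun s hs => by simp [hx.2 s hs]⟩

/-- The space `F_{S,A}` of maps `(S, A) → (F, 0)` of the given regularity, with its `C^k`,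
respectively `W^{k,p}`, norm. (All such maps are homotopic to the constant map.) -/
def MapSpace (𝔄 : FiniteAtlas I S) (R : Regularity d) (A : Set S)
    (F : Type*) [NormedAddCommGroup F] [NormedSpace ℂ F] : Type _ :=
  ↥(mapSubmodule 𝔄 R A F)

namespace MapSpace

variable (𝔄 : FiniteAtlas I S) (R : Regularity d) (A : Set S)

instance : AddCommGroup (MapSpace 𝔄 R A F) := inferInstanceAs (AddCommGroup (mapSubmodule 𝔄 R A F))

instance : Module ℂ (MapSpace 𝔄 R A F) := inferInstanceAs (Module ℂ (mapSubmodule 𝔄 R A F))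

variable {𝔄 R A} in
/-- The underlying continuous map. -/
def toMap (x : MapSpace 𝔄 R A F) : C(S, F) := x.1

instance : Norm (MapSpace 𝔄 R A F) := ⟨fun x => R.normOn 𝔄 x.toMap⟩

lemma normedSpaceCore [IsManifold I ∞ S] [CompactSpace S] [CompleteSpace F] :
    NormedSpace.Core ℂ (MapSpace 𝔄 R A F) where
  norm_nonneg x := by
    cases R with
    | C k => exact 𝔄.ckNorm_nonneg k _
    | W k p _ _ _ =>
      change 0 ≤ (∑ i, sobolevNormOn (𝔄.coordDom i) k p (𝔄.read i (x).toMap))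
      exact Finset.sum_nonneg fun i _ => sobolevNormOn_nonneg _ _ _ _
  norm_smul c x := by
    cases R with
    | C k => exact 𝔄.ckNorm_const_smul c (show ContMDiff I 𝓘(ℝ, F) k x.toMap from x.2.1)
    | W k p _ _ _ =>
      change (∑ i, sobolevNormOn (𝔄.coordDom i) k p (𝔄.read i (c • x).toMap)) =
        ‖c‖ * (∑ i, sobolevNormOn (𝔄.coordDom i) k p (𝔄.read i (x).toMap))
      refine (Finset.sum_congr rfl fun i _ => ?_).trans (Finset.mul_sum _ _ _).symm
      exact sobolevNormOn_const_smul (𝔄.isOpen_coordDom i) c (x.2.1 i)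
  norm_triangle x y := by
    cases R with
    | C k =>
      exact 𝔄.ckNorm_add_le (show ContMDiff I 𝓘(ℝ, F) k x.toMap from x.2.1)
        (show ContMDiff I 𝓘(ℝ, F) k y.toMap from y.2.1)
    | W k p _ hp _ =>
      change (∑ i, sobolevNormOn (𝔄.coordDom i) k p (𝔄.read i (x + y).toMap)) ≤
        (∑ i, sobolevNormOn (𝔄.coordDom i) k p (𝔄.read i (x).toMap)) +
        (∑ i, sobolevNormOn (𝔄.coordDom i) k p (𝔄.read i (y).toMap))
      refine (Finset.sum_le_sum fun i _ => ?_).trans_eq Finset.sum_add_distrib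
      exact sobolevNormOn_add_le (𝔄.isOpen_coordDom i) hp (x.2.1 i) (y.2.1 i)
  norm_eq_zero_iff x := by
    constructor
    · intro h
      refine Subtype.ext ?_
      cases R with
      | C k =>
        exact DFunLike.coe_injective (𝔄.eq_zero_of_ckNorm_eq_zero
          (show ContMDiff I 𝓘(ℝ, F) k x.toMap from x.2.1) h)
      | W k p _ hp _ =>
        change (∑ i, sobolevNormOn (𝔄.coordDom i) k p (𝔄.read i (x).toMap)) = 0 at h
        have h' := (Finset.sum_eq_zero_iff_of_nonneg
          fun i _ => sobolevNormOn_nonneg _ _ _ _).1 h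
        exact 𝔄.eq_zero_of_ae fun i =>
          ae_eq_zero_of_sobolevNormOn_eq_zero (𝔄.isOpen_coordDom i) hp (x.2.1 i)
            (h' i (Finset.mem_univ i))
    · rintro rfl
      cases R with
      | C k =>
        have h := 𝔄.ckNorm_const_smul (0 : ℂ)
          (show ContMDiff I 𝓘(ℝ, F) k (0 : S → F) from contMDiff_const (c := (0 : F)))
        rw [zero_smul, norm_zero, zero_mul] at h
        exact h
      | W k p _ hp _ =>
        change (∑ i, sobolevNormOn (𝔄.coordDom i) k p (𝔄.read i ((0 : MapSpace 𝔄 _ A F)).toMap)) = 0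
        refine Finset.sum_eq_zero fun i _ => ?_
        have h := sobolevNormOn_const_smul (F := F) (𝔄.isOpen_coordDom i) (0 : ℂ)
          (memSobolevOn_zero (𝔄.coordDom i) k p)
        rw [zero_smul, norm_zero, zero_mul] at h
        exact h

instance [IsManifold I ∞ S] [CompactSpace S] [CompleteSpace F] : NormedAddCommGroup (MapSpace 𝔄 R A F) :=
  NormedAddCommGroup.ofCore (normedSpaceCore 𝔄 R A)

instance [IsManifold I ∞ S] [CompactSpace S] [CompleteSpace F] : NormedSpace ℂ (MapSpace 𝔄 R A F) :=
  NormedSpace.ofCore (normedSpaceCore 𝔄 R A)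

/-- The set `N_{S,A}` of maps `(S, A) → (N, 0)` of the given regularity that are homotopic, through
continuous maps `(S, A) → (N, 0)`, to the constant map `0`. -/
def into (N : Set F) : Set (MapSpace 𝔄 R A F) :=
  {x | ContinuousMap.HomotopicWith x.toMap (ContinuousMap.const S 0)
    fun y => (∀ s, y s ∈ N) ∧ ∀ s ∈ A, y s = 0}

end MapSpace

end MappingSpaces

/-! ### Complex submanifolds and holomorphic retractions -/

section Submanifolds

variable {W : Type u} [NormedAddCommGroup W] [NormedSpace ℂ W]

/-- `Φ`, an open partial homeomorphism from `W` to the Banach space `X`, is biholomorphic. -/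
def IsBiholomorphic {X : Type*} [NormedAddCommGroup X] [NormedSpace ℂ X]
    (Φ : OpenPartialHomeomorph W X) : Prop :=
  DifferentiableOn ℂ Φ Φ.source ∧ DifferentiableOn ℂ Φ.symm Φ.target

/-- A relatively closed subset `P` of an open subset `Q` of a Banach space is a complex
submanifold if near each of its points a biholomorphic map sends it to a closed subspace `Y` of
a Banach space `X`. -/
def IsComplexSubmanifold (Q P : Set W) : Prop :=
  P ⊆ Q ∧ (∃ C, IsClosed C ∧ P = Q ∩ C) ∧
    ∀ x ∈ P, ∃ (X : Type u) (_ : NormedAddCommGroup X) (_ : NormedSpace ℂ X) (_ : CompleteSpace X)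
      (Y : Submodule ℂ X) (Φ : OpenPartialHomeomorph W X),
      IsClosed (Y : Set X) ∧ x ∈ Φ.source ∧ Φ.source ⊆ Q ∧ IsBiholomorphic Φ ∧
        Φ '' (P ∩ Φ.source) = (Y : Set X) ∩ Φ.target

/-- A complex submanifold is direct if the subspaces `Y` can be chosen with a closed
complement in `X`. -/
def IsDirectComplexSubmanifold (Q P : Set W) : Prop :=
  P ⊆ Q ∧ (∃ C, IsClosed C ∧ P = Q ∩ C) ∧
    ∀ x ∈ P, ∃ (X : Type u) (_ : NormedAddCommGroup X) (_ : NormedSpace ℂ X) (_ : CompleteSpace X)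
      (Y Z : Submodule ℂ X) (Φ : OpenPartialHomeomorph W X),
      IsClosed (Y : Set X) ∧ IsClosed (Z : Set X) ∧ IsCompl Y Z ∧ x ∈ Φ.source ∧ Φ.source ⊆ Q ∧
        IsBiholomorphic Φ ∧ Φ '' (P ∩ Φ.source) = (Y : Set X) ∩ Φ.target

/-- `r` restricts to a holomorphic retraction of the open set `Q` onto `P ⊆ Q`. -/
def IsHolomorphicRetraction (Q P : Set W) (r : W → W) : Prop :=
  DifferentiableOn ℂ r Q ∧ MapsTo r Q P ∧ ∀ x ∈ P, r x = x

end Submanifolds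

end

noncomputable section

/-! ### Images of holomorphic retractions -/

/-! Everything rests on one analytic fact: `x ↦ ρ ∘ x` is complex `C^1` on `Ω_{S,A}`
(`MapSpace.exists_comp_contDiffOn`). Granting it, composing null-homotopies with `ρ` shows that this
map sends `Ω_{S,A}` to `N_{S,A}` and fixes the latter. The image of a `C^1` retraction `r` of an
open set of a Banach space is a direct submanifold: the derivative `L` of `r` at a fixed point is a
projection, and near that point a change of coordinates conjugates `r` to `L`.

The analytic fact is proved for all regularity classes at once, by means of Banach algebras. Put `P
= ∞` for `C^k` and `P = k p` for `W^{k,p}`. The norm of the class controls the `j`-th derivatives in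
`L^(P / j)` (`Regularity.dominatedOn_jetNorm`); in the Sobolev case this is the Sobolev embedding,
proved by writing a function as an average of integrals along a cone of inward directions and
estimating the resulting Riesz potential (`exists_eLpNorm_conePotential_le`). The Leibniz rule and
Hölder's inequality with exponents `P / l`, `P / (j - l)`, `P / j` then show that `‖f‖_∞ + ∑ ε^j /
j! ‖D^j f‖_{P / j}` is submultiplicative on `C^k` functions. These are dense in the class
(mollification along inward directions, `Regularity.exists_seq_tendsto`), so for each `ε > 0` the
completion is the scalar mapping space with an equivalent norm (`CkAlgebra.exists_equiv`). As `ε →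
0` the norms tend to the supremum norm.

A holomorphic function `f` of `n` variables is analytic, and its power series at a point `z` can be
evaluated at `n` elements of any commutative Banach algebra, on a ball whose radius does not depend
on the algebra (`exists_holomorphic_lift`). Given `x₀`, a partition of unity reduces `f ∘ x` to
pieces on which `x₀` is near a constant `z`. Cut off, `x₀ - z` is small in the supremum norm, hence
also in the algebra norm once `ε` is small enough, so the power series applies to all `x` near `x₀`.
Patching gives an analytic formula for `f ∘ x` near `x₀` (`exists_analyticAt_comp`).

Lastly, the maps that vanish on `A` embed through their coordinates as a closed subspace of a power
of the scalar space, and differentiability passes to closed subspaces (`contDiffOn_one_of_comp`). -/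

theorem isDirectComplexSubmanifold_of_retraction {W : Type u} [NormedAddCommGroup W]
    [NormedSpace ℂ W] [CompleteSpace W] {Q P : Set W} (hQ : IsOpen Q) (hPQ : P ⊆ Q)
    (hcl : ∃ C, IsClosed C ∧ P = Q ∩ C) {r : W → W} (hr : ContDiffOn ℂ 1 r Q)
    (hmaps : MapsTo r Q P) (hfix : ∀ x ∈ P, r x = x) : IsDirectComplexSubmanifold Q P := by
  refine ⟨hPQ, hcl, fun x hx => ?_⟩
  have hxQ := hPQ hx
  have hd : ∀ y ∈ Q, HasFDerivAt r (fderiv ℂ r y) y := fun y hy =>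
    ((hr.differentiableOn (by simp)).differentiableAt (hQ.mem_nhds hy)).hasFDerivAt
  set L := fderiv ℂ r x with hL
  -- Differentiate `r ∘ r = r` at the fixed point `x`.
  have hLL : L.comp L = L := by
    have h1 : HasFDerivAt (r ∘ r) (L.comp L) x := by
      refine HasFDerivAt.comp x ?_ (hd x hxQ)
      rw [hfix x hx]; exact hd x hxQ
    have h2 : r ∘ r =ᶠ[𝓝 x] r := by
      filter_upwards [hQ.mem_nhds hxQ] with y hy
      exact hfix _ (hmaps hy)
    exact h1.unique ((hd x hxQ).congr_of_eventuallyEq h2)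
  have hLLa : ∀ v, L (L v) = L v := fun v => by
    conv_rhs => rw [← hLL]
    rfl
  -- Both summands are chosen so that `Φ ∘ r = L ∘ Φ` on `Q`: the second vanishes at `r y` and is
  -- killed by `L`. The derivative at `x` is `L² + (1 - L)² = 1`.
  let Φ : W → W := fun y => L (r y - x) + ((y - r y) - L (y - r y))
  have hΦc : ContDiffOn ℂ 1 Φ Q := by
    have h1 : ContDiffOn ℂ 1 (fun y => y - r y) Q := contDiffOn_id.sub hr
    exact (L.contDiff.comp_contDiffOn (hr.sub contDiffOn_const)).add
      (h1.sub (L.contDiff.comp_contDiffOn h1))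
  have hΦx : HasFDerivAt Φ ((ContinuousLinearEquiv.refl ℂ W : W ≃L[ℂ] W) : W →L[ℂ] W) x := by
    have h0 := hd x hxQ
    have h1 : HasFDerivAt (fun y => y - r y) (ContinuousLinearMap.id ℂ W - L) x :=
      (hasFDerivAt_id x).sub h0
    have h2 := (L.hasFDerivAt.comp x (h0.sub_const x)).add (h1.sub (L.hasFDerivAt.comp x h1))
    rw [← hL] at h2
    convert! h2 using 1
    ext v
    simp [hLLa]
  have hΦr : ∀ y ∈ Q, Φ (r y) = L (Φ y) := by
    intro y hy
    simp only [Φ, hfix _ (hmaps hy), sub_self, add_zero, map_add, map_sub, hLLa]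
  have hca : ContDiffAt ℂ 1 Φ x := hΦc.contDiffAt (hQ.mem_nhds hxQ)
  let e0 := hca.toOpenPartialHomeomorph Φ hΦx one_ne_zero
  have he0 : ∀ y, e0 y = Φ y := fun y => rfl
  have hfc : ContinuousOn (fderiv ℂ Φ) Q := hΦc.continuousOn_fderiv_of_isOpen hQ le_rfl
  -- On this set the derivative of `Φ` is invertible, so the local inverse is differentiable at
  -- every point of the target and not only at `Φ x`.
  let Eq : Set W := Q ∩ fderiv ℂ Φ ⁻¹' range ((↑) : (W ≃L[ℂ] W) → W →L[ℂ] W)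
  have hEq : IsOpen Eq := hfc.isOpen_inter_preimage hQ ContinuousLinearEquiv.isOpen
  let V0 := e0.source ∩ Eq
  have hV0 : IsOpen V0 := e0.open_source.inter hEq
  have hV0Q : V0 ⊆ Q := fun y hy => hy.2.1
  -- Both `y` and `r y` have to lie where `Φ` is injective, since the two will be compared through
  -- their images.
  let V := V0 ∩ r ⁻¹' V0
  have hV : IsOpen V := (hr.continuousOn.mono hV0Q).isOpen_inter_preimage hV0 hV0
  have hxV0 : x ∈ V0 := ⟨hca.mem_toOpenPartialHomeomorph_source hΦx one_ne_zero, hxQ,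
    ⟨_, hΦx.fderiv.symm⟩⟩
  have hxV : x ∈ V := ⟨hxV0, by rw [mem_preimage, hfix x hx]; exact hxV0⟩
  let e := e0.restrOpen V hV
  have hes : e.source = V := by
    rw [OpenPartialHomeomorph.restrOpen_source]
    exact inter_eq_right.2 fun y hy => hy.1.1
  have he : ∀ y, e y = Φ y := fun y => rfl
  have hYmem : ∀ v, v ∈ LinearMap.ker ((ContinuousLinearMap.id ℂ W - L : W →L[ℂ] W) : W →ₗ[ℂ] W) ↔
      L v = v := by
    intro v
    rw [LinearMap.mem_ker]
    simp only [ContinuousLinearMap.coe_coe, sub_apply, ContinuousLinearMap.id_apply, sub_eq_zero]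
    exact eq_comm
  refine ⟨W, inferInstance, inferInstance, inferInstance,
    LinearMap.ker ((ContinuousLinearMap.id ℂ W - L : W →L[ℂ] W) : W →ₗ[ℂ] W),
    LinearMap.ker (L : W →ₗ[ℂ] W), e, ContinuousLinearMap.isClosed_ker _,
    ContinuousLinearMap.isClosed_ker L, ?_, hes ▸ hxV, hes ▸ fun y hy => hV0Q hy.1, ?_, ?_⟩
  · rw [isCompl_iff]
    constructor
    · rw [Submodule.disjoint_def]
      intro v hv hv'
      rw [hYmem] at hv
      rw [← hv]; exact hv'
    · rw [codisjoint_iff, eq_top_iff]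
      intro v _
      rw [Submodule.mem_sup]
      refine ⟨L v, (hYmem _).2 (hLLa v), v - L v, ?_, by abel⟩
      rw [LinearMap.mem_ker]
      simp [hLLa]
  · constructor
    · rw [hes]
      exact (hΦc.mono fun y hy => hV0Q hy.1).differentiableOn one_ne_zero
    · intro w hw
      have hs : e.symm w ∈ V := hes ▸ e.map_target hw
      obtain ⟨A, hA⟩ := hs.1.2.2
      have h1 : HasFDerivAt Φ (fderiv ℂ Φ (e.symm w)) (e.symm w) :=
        ((hΦc.differentiableOn one_ne_zero).differentiableAt
          (hQ.mem_nhds (hV0Q hs.1))).hasFDerivAt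
      rw [← hA] at h1
      exact (e.hasFDerivAt_symm hw h1).differentiableAt.differentiableWithinAt
  · ext w
    constructor
    · rintro ⟨y, ⟨hyP, hys⟩, rfl⟩
      refine ⟨?_, e.map_source hys⟩
      rw [SetLike.mem_coe, hYmem, he, ← hΦr y (hPQ hyP), hfix y hyP]
    · rintro ⟨hwY, hwt⟩
      rw [SetLike.mem_coe, hYmem] at hwY
      have hs : e.symm w ∈ V := hes ▸ e.map_target hwt
      have hw : Φ (e.symm w) = w := e.right_inv hwt
      refine ⟨e.symm w, ⟨?_, hes ▸ hs⟩, hw⟩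
      -- A point whose image is fixed by `L` has the same image as its retract; by injectivity it
      -- equals its retract and therefore lies in `P`.
      have h1 : Φ (r (e.symm w)) = Φ (e.symm w) := by rw [hΦr _ (hV0Q hs.1), hw, hwY]
      have h2 := e0.injOn hs.2.1 hs.1.1 h1
      rw [← h2]
      exact hmaps (hV0Q hs.1)

/-! ### Holomorphic functions of several variables are analytic -/

section SeveralVariables

variable {E : Type*} [NormedAddCommGroup E] [NormedSpace ℂ E]

/-- Cauchy's estimate on the complex lines through `x`, on discs that correspond to radii `s < δ`;
then `s → δ`. -/
lemma norm_fderiv_le_of_forall_ball_norm_le {G : Type*} [NormedAddCommGroup G] [NormedSpace ℂ G]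
    {f : E → G} {x : E} {δ M : ℝ} (hδ : 0 < δ) (hM : 0 ≤ M)
    (hf : DifferentiableOn ℂ f (Metric.ball x δ))
    (hb : ∀ y ∈ Metric.ball x δ, ‖f y‖ ≤ M) : ‖fderiv ℂ f x‖ ≤ M / δ := by
  refine ContinuousLinearMap.opNorm_le_bound _ (by positivity) fun h => ?_
  rcases eq_or_ne h 0 with rfl | hh
  · simp
  have hh' : 0 < ‖h‖ := norm_pos_iff.2 hh
  have key : ∀ s : ℝ, 0 < s → s < δ → ‖fderiv ℂ f x h‖ ≤ M * ‖h‖ / s := by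
    intro s hs hsδ
    have hline : ∀ z : ℂ, ‖z‖ ≤ s / ‖h‖ → x + z • h ∈ Metric.ball x δ := by
      intro z hz
      rw [mem_ball_iff_norm, add_sub_cancel_left, norm_smul]
      calc ‖z‖ * ‖h‖ ≤ s / ‖h‖ * ‖h‖ := by gcongr
        _ = s := by field_simp
        _ < δ := hsδ
    have hd : ∀ z : ℂ, ‖z‖ ≤ s / ‖h‖ →
        HasDerivAt (fun z : ℂ => f (x + z • h)) (fderiv ℂ f (x + z • h) h) z := by
      intro z hz
      have h1 := (hf.differentiableAt (Metric.isOpen_ball.mem_nhds (hline z hz))).hasFDerivAt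
      have h2 : HasDerivAt (fun z : ℂ => x + z • h) h z := by
        simpa using ((hasDerivAt_id z).smul_const h).const_add x
      exact h1.comp_hasDerivAt z h2
    have h3 := Complex.norm_deriv_le_of_forall_mem_sphere_norm_le (c := 0) (R := s / ‖h‖) (C := M)
      (f := fun z : ℂ => f (x + z • h)) (by positivity) ?_ ?_
    · rw [(hd 0 (by simp; positivity)).deriv] at h3
      simp only [zero_smul, add_zero] at h3
      convert h3 using 1
      field_simp
    · refine DifferentiableOn.diffContOnCl fun z hz => ?_
      rw [closure_ball _ (by positivity)] at hz
      exact (hd z (by simpa using hz)).differentiableAt.differentiableWithinAt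
    · intro z hz
      exact hb _ (hline z (by simpa using (mem_sphere_zero_iff_norm.1 hz).le))
  have hlim : Filter.Tendsto (fun s : ℝ => M * ‖h‖ / s) (𝓝[<] δ) (𝓝 (M * ‖h‖ / δ)) :=
    ((continuousAt_const.div continuousAt_id hδ.ne').tendsto).mono_left nhdsWithin_le_nhds
  rw [div_mul_eq_mul_div]
  refine ge_of_tendsto hlim ?_
  filter_upwards [self_mem_nhdsWithin, mem_nhdsWithin_of_mem_nhds (lt_mem_nhds hδ)] with s h1 h2
  exact key s h2 h1

variable [FiniteDimensional ℂ E]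

/-- Cauchy's formula on the line `y + z • h` writes the directional derivative as a circle integral
of values of `f`, and this can be differentiated in `y` under the integral sign because Cauchy's
estimate bounds the derivative of the integrand. -/
lemma differentiableOn_fderiv_apply {f : E → ℂ} {Ω : Set E} (hΩ : IsOpen Ω)
    (hf : DifferentiableOn ℂ f Ω) (h : E) : DifferentiableOn ℂ (fun y => fderiv ℂ f y h) Ω := by
  have : ProperSpace E := FiniteDimensional.proper ℂ E
  borelize E
  intro x hx
  obtain ⟨ε, hε, hball⟩ := Metric.isOpen_iff.1 hΩ x hx
  -- Points within `r` of `x` have their circles within `2 r`; the balls of radius `r` used for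
  -- Cauchy's estimate there stay within `3 r < ε`.
  obtain ⟨r, hr, hr4⟩ : ∃ r : ℝ, 0 < r ∧ 4 * r = ε := ⟨ε / 4, by positivity, by ring⟩
  have hsub : ∀ s < ε, Metric.closedBall x s ⊆ Ω := fun s hs =>
    (Metric.closedBall_subset_ball hs).trans hball
  obtain ⟨M, hM⟩ := (isCompact_closedBall x (3 * r)).exists_bound_of_continuousOn
    (hf.continuousOn.mono (hsub (3 * r) (by linarith)))
  have hM0 : 0 ≤ M := (norm_nonneg _).trans (hM x (Metric.mem_closedBall_self (by positivity)))
  have hbd : ∀ y ∈ Metric.ball x (2 * r), ‖fderiv ℂ f y‖ ≤ M / r := by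
    intro y hy
    have h1 : Metric.ball y r ⊆ Metric.closedBall x (3 * r) := fun z hz => by
      rw [Metric.mem_ball] at hy hz
      rw [Metric.mem_closedBall]
      linarith [dist_triangle z y x]
    exact norm_fderiv_le_of_forall_ball_norm_le hr hM0
      (hf.mono (h1.trans (hsub _ (by linarith)))) fun z hz => hM z (h1 hz)
  obtain ⟨R, hR, hRh⟩ : ∃ R : ℝ, 0 < R ∧ R * ‖h‖ < r := by
    refine ⟨r / (‖h‖ + 1), by positivity, ?_⟩
    rw [div_mul_eq_mul_div, div_lt_iff₀ (by positivity)]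
    nlinarith [norm_nonneg h]
  have hin : ∀ y ∈ Metric.ball x r, ∀ z : ℂ, ‖z‖ ≤ R → y + z • h ∈ Metric.ball x (2 * r) := by
    intro y hy z hz
    rw [mem_ball_iff_norm] at hy ⊢
    have : ‖z • h‖ ≤ R * ‖h‖ := by rw [norm_smul]; gcongr
    calc ‖y + z • h - x‖ = ‖(y - x) + z • h‖ := by congr 1; abel
      _ ≤ ‖y - x‖ + ‖z • h‖ := norm_add_le _ _
      _ < 2 * r := by linarith
  have hballΩ : Metric.ball x (2 * r) ⊆ Ω :=
    (Metric.ball_subset_ball (by linarith)).trans hball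
  have hdiff : ∀ y ∈ Metric.ball x (2 * r), HasFDerivAt f (fderiv ℂ f y) y := fun y hy =>
    (hf.differentiableAt (hΩ.mem_nhds (hballΩ hy))).hasFDerivAt
  -- The Cauchy kernel for a first derivative, in the angular parameter.
  let k : ℝ → ℂ := fun θ => deriv (circleMap 0 R) θ * ((circleMap 0 R θ - 0) ^ 2)⁻¹
  have hcm : ∀ θ, ‖circleMap 0 R θ‖ = R := fun θ => by simp [abs_of_pos hR]
  have hkc : Continuous k := by
    refine Continuous.mul ?_ (Continuous.inv₀ (by fun_prop) fun θ => ?_)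
    · rw [show deriv (circleMap 0 R) = fun θ => circleMap 0 R θ * Complex.I from
        funext fun θ => deriv_circleMap 0 R θ]
      fun_prop
    · have := hcm θ
      rw [sub_zero]
      refine pow_ne_zero 2 fun h0 => ?_
      rw [h0, norm_zero] at this
      exact hR.ne this
  have hform : ∀ y ∈ Metric.ball x r, fderiv ℂ f y h =
      (2 * Real.pi * Complex.I)⁻¹ * ∫ θ in (0 : ℝ)..2 * Real.pi, k θ * f (y + circleMap 0 R θ • h) := by
    intro y hy
    have hd : ∀ z : ℂ, ‖z‖ ≤ R →
        HasDerivAt (fun z : ℂ => f (y + z • h)) (fderiv ℂ f (y + z • h) h) z := by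
      intro z hz
      have h2 : HasDerivAt (fun z : ℂ => y + z • h) h z := by
        simpa using ((hasDerivAt_id z).smul_const h).const_add y
      exact (hdiff _ (hin y hy z hz)).comp_hasDerivAt z h2
    have hcl : DifferentiableOn ℂ (fun z : ℂ => f (y + z • h)) (Metric.closedBall 0 R) := fun z hz =>
      (hd z (by simpa using hz)).differentiableAt.differentiableWithinAt
    have h3 := hcl.deriv_eq_smul_circleIntegral hR
    rw [(hd 0 (by simpa using hR.le)).deriv] at h3
    simp only [zero_smul, add_zero] at h3
    rw [eq_inv_mul_iff_mul_eq₀ (by simp [Real.pi_ne_zero]), ← smul_eq_mul, ← h3]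
    simp only [circleIntegral, smul_eq_mul, k]
    refine intervalIntegral.integral_congr fun θ _ => ?_
    simp only [one_div, mul_assoc]
  have hint : HasFDerivAt (fun y => ∫ θ in Ioc (0 : ℝ) (2 * Real.pi),
      k θ * f (y + circleMap 0 R θ • h)) (∫ θ in Ioc (0 : ℝ) (2 * Real.pi),
      k θ • fderiv ℂ f (x + circleMap 0 R θ • h)) x := by
    have hcont : ∀ y ∈ Metric.ball x r, Continuous fun θ => k θ * f (y + circleMap 0 R θ • h) := by
      intro y hy
      refine hkc.mul (hf.continuousOn.comp_continuous (by fun_prop) fun θ =>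
        hballΩ (hin y hy _ (hcm θ).le))
    refine hasFDerivAt_integral_of_dominated_of_fderiv_le (s := Metric.ball x r)
      (F := fun y θ => k θ * f (y + circleMap 0 R θ • h))
      (F' := fun y θ => k θ • fderiv ℂ f (y + circleMap 0 R θ • h))
      (bound := fun θ => ‖k θ‖ * (M / r)) (Metric.ball_mem_nhds x hr) ?_ ?_ ?_ ?_ ?_ ?_
    · filter_upwards [Metric.ball_mem_nhds x hr] with y hy
      exact (hcont y hy).aestronglyMeasurable
    · exact ((hcont x (Metric.mem_ball_self hr)).integrableOn_Icc).mono_set Ioc_subset_Icc_self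
    · refine hkc.aestronglyMeasurable.smul ?_
      refine Measurable.aestronglyMeasurable ?_
      exact (measurable_fderiv ℂ f).comp (by fun_prop)
    · refine Filter.Eventually.of_forall fun θ y hy => ?_
      rw [norm_smul]
      gcongr
      exact hbd _ (hin y hy _ (hcm θ).le)
    · exact ((hkc.norm.mul continuous_const).integrableOn_Icc).mono_set Ioc_subset_Icc_self
    · refine Filter.Eventually.of_forall fun θ y hy => ?_
      have h1 := (hdiff _ (hin y hy _ (hcm θ).le)).comp y
        ((hasFDerivAt_id y).add_const (circleMap 0 R θ • h))
      simpa using h1.const_mul (k θ)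
  refine DifferentiableAt.differentiableWithinAt ?_
  have h4 := (hint.const_mul ((2 * Real.pi * Complex.I : ℂ)⁻¹)).differentiableAt
  refine h4.congr_of_eventuallyEq ?_
  filter_upwards [Metric.ball_mem_nhds x hr] with y hy
  rw [hform y hy, intervalIntegral.integral_of_le (by positivity)]

/-- Directional derivatives of holomorphic functions are again holomorphic, and in finite dimension
they decide whether the derivative is `C^n`. -/
lemma contDiffOn_nat_of_differentiableOn {Ω : Set E} (hΩ : IsOpen Ω) (n : ℕ) :
    ∀ {f : E → ℂ}, DifferentiableOn ℂ f Ω → ContDiffOn ℂ n f Ω := by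
  induction n with
  | zero => exact fun hf => contDiffOn_zero.2 hf.continuousOn
  | succ n ih =>
    intro f hf
    have := contDiffOn_succ_iff_fderiv_apply (𝕜 := ℂ) (n := n) (f := f) hΩ.uniqueDiffOn
    push_cast
    refine this.2 ⟨hf, fun h => by simp at h, fun y => ?_⟩
    refine (ih (differentiableOn_fderiv_apply hΩ hf y)).congr fun z hz => ?_
    rw [fderivWithin_of_isOpen hΩ hz]

/-- Iterated Cauchy estimates with `m` steps of length `R / (4 m)` bound the `m`-th derivative by `M
(4 m / R)^m`; since `m^m / m! ≤ e^m`, the Taylor series has radius at least `R / (4 e)`. Its sum is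
identified on complex lines through `x`, by the theorem in one variable. -/
theorem analyticOnNhd_of_differentiableOn {f : E → ℂ} {Ω : Set E} (hΩ : IsOpen Ω)
    (hf : DifferentiableOn ℂ f Ω) : AnalyticOnNhd ℂ f Ω := by
  have : ProperSpace E := FiniteDimensional.proper ℂ E
  intro x hx
  obtain ⟨R, hR, hball⟩ := Metric.isOpen_iff.1 hΩ x hx
  obtain ⟨M, hM⟩ := (isCompact_closedBall x (R / 2)).exists_bound_of_continuousOn
    (hf.continuousOn.mono ((Metric.closedBall_subset_ball (by linarith)).trans hball))
  have hM0 : 0 ≤ M := (norm_nonneg _).trans (hM x (Metric.mem_closedBall_self (by positivity)))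
  have hcd : ∀ (m : ℕ), ContDiffOn ℂ m f Ω := fun m => contDiffOn_nat_of_differentiableOn hΩ m hf
  have hsub : Metric.ball x (R / 2) ⊆ Ω := (Metric.ball_subset_ball (by linarith)).trans hball
  -- Each application of Cauchy's estimate costs a distance `δ`, so `m` derivatives need room `m *
  -- δ`.
  have hest : ∀ (δ : ℝ), 0 < δ → ∀ m : ℕ, ∀ y, dist y x + m * δ < R / 2 →
      ‖iteratedFDeriv ℂ m f y‖ ≤ M / δ ^ m := by
    intro δ hδ m
    induction m with
    | zero =>
      intro y hy
      simpa using hM y (by rw [Metric.mem_closedBall]; simpa using hy.le)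
    | succ m ih =>
      intro y hy
      push_cast at hy
      rw [← norm_fderiv_iteratedFDeriv, pow_succ, ← div_div]
      have hin : ∀ z ∈ Metric.ball y δ, dist z x + m * δ < R / 2 := fun z hz => by
        rw [Metric.mem_ball] at hz
        linarith [dist_triangle z y x]
      refine norm_fderiv_le_of_forall_ball_norm_le hδ (by positivity) (fun z hz => ?_)
        fun z hz => ih z (hin z hz)
      have hzΩ : z ∈ Ω := hsub (by
        rw [Metric.mem_ball]; linarith [hin z hz, mul_nonneg (Nat.cast_nonneg (α := ℝ) m) hδ.le])
      exact (((hcd (m + 1)).contDiffAt (hΩ.mem_nhds hzΩ)).differentiableAt_iteratedFDeriv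
        (by exact_mod_cast Nat.lt_succ_self m)).differentiableWithinAt
  let p : FormalMultilinearSeries ℂ E ℂ := fun m => ((m.factorial : ℂ)⁻¹) • iteratedFDeriv ℂ m f x
  let ρ : ℝ≥0 := ⟨R / 4 * Real.exp (-1), by positivity⟩
  have hρ0 : 0 < ρ := by
    have : (0 : ℝ) < R / 4 * Real.exp (-1) := by positivity
    exact this
  have hp : ∀ m, ‖p m‖ * (ρ : ℝ) ^ m ≤ M := by
    intro m
    have h1 : ‖p m‖ = (m.factorial : ℝ)⁻¹ * ‖iteratedFDeriv ℂ m f x‖ := by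
      simp [p, norm_smul]
    rcases Nat.eq_zero_or_pos m with rfl | hm
    · rw [h1]
      simpa using hM x (Metric.mem_closedBall_self (by positivity))
    have hm' : (0 : ℝ) < m := by exact_mod_cast hm
    have h2 := hest (R / 4 / m) (by positivity) m x (by
      rw [dist_self, mul_div_cancel₀ _ hm'.ne']; linarith)
    have h3 : (m : ℝ) ^ m / m.factorial ≤ Real.exp m := Real.pow_div_factorial_le_exp _ hm'.le m
    have h4 : (ρ : ℝ) ^ m = (R / 4) ^ m * (Real.exp m)⁻¹ := by
      change (R / 4 * Real.exp (-1)) ^ m = _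
      rw [mul_pow, ← Real.exp_nat_mul, ← Real.exp_neg]
      simp
    have hRm : (0 : ℝ) < (R / 4) ^ m := by positivity
    have hfac : (0 : ℝ) < m.factorial := by exact_mod_cast m.factorial_pos
    rw [h1, h4]
    calc (m.factorial : ℝ)⁻¹ * ‖iteratedFDeriv ℂ m f x‖ * ((R / 4) ^ m * (Real.exp m)⁻¹)
        ≤ (m.factorial : ℝ)⁻¹ * (M / (R / 4 / m) ^ m) * ((R / 4) ^ m * (Real.exp m)⁻¹) := by gcongr
      _ = M * ((m : ℝ) ^ m / m.factorial * (Real.exp m)⁻¹) := by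
        rw [div_pow]
        field_simp
      _ ≤ M * (Real.exp m * (Real.exp m)⁻¹) := by gcongr
      _ = M := by rw [mul_inv_cancel₀ (Real.exp_ne_zero _), mul_one]
  refine ⟨p, ρ, p.le_radius_of_bound M hp, by exact_mod_cast hρ0, ?_⟩
  intro y hy
  have hy' : ‖y‖ < R := by
    rw [Metric.mem_eball, edist_zero_right, enorm_lt_coe] at hy
    have h1 : ‖y‖ < R / 4 * Real.exp (-1) := hy
    have h2 : Real.exp (-1) ≤ 1 := Real.exp_le_one_iff.2 (by norm_num)
    nlinarith
  -- The denominator is the midpoint of `‖y‖` and `R`: it is positive even for `y = 0`, and the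
  -- radius exceeds `1`, so that `t = 1` is admissible.
  have hline : ∀ t ∈ Metric.ball (0 : ℂ) (R / (‖y‖ + (R - ‖y‖) / 2)), x + t • y ∈ Ω := by
    intro t ht
    refine hball ?_
    rw [mem_ball_zero_iff, lt_div_iff₀ (by linarith [norm_nonneg y])] at ht
    rw [mem_ball_iff_norm, add_sub_cancel_left, norm_smul]
    refine lt_of_le_of_lt ?_ ht
    gcongr
    linarith
  set B := Metric.ball (0 : ℂ) (R / (‖y‖ + (R - ‖y‖) / 2)) with hB
  have hpos : 0 < ‖y‖ + (R - ‖y‖) / 2 := by linarith [norm_nonneg y]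
  have hR' : 1 < R / (‖y‖ + (R - ‖y‖) / 2) := by rw [one_lt_div hpos]; linarith
  have hderiv : ∀ m : ℕ, ∀ t ∈ B, iteratedDeriv m (fun t : ℂ => f (x + t • y)) t =
      iteratedFDeriv ℂ m f (x + t • y) fun _ => y := by
    intro m
    induction m with
    | zero => intro t _; simp
    | succ m ih =>
      intro t ht
      rw [iteratedDeriv_succ]
      have h1 : iteratedDeriv m (fun t : ℂ => f (x + t • y)) =ᶠ[𝓝 t]
          fun t => iteratedFDeriv ℂ m f (x + t • y) fun _ => y := by
        filter_upwards [Metric.isOpen_ball.mem_nhds ht] with s hs using ih s hs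
      rw [h1.deriv_eq]
      have h2 : HasDerivAt (fun z : ℂ => x + z • y) y t := by
        simpa using ((hasDerivAt_id t).smul_const y).const_add x
      have h3 := (((hcd (m + 1)).contDiffAt (hΩ.mem_nhds (hline t ht))).differentiableAt_iteratedFDeriv
        (by exact_mod_cast Nat.lt_succ_self m)).hasFDerivAt.comp_hasDerivAt t h2
      have h4 := (ContinuousMultilinearMap.apply ℂ (fun _ : Fin m => E) ℂ
        (fun _ => y)).hasFDerivAt.comp_hasDerivAt t h3
      refine h4.deriv.trans ?_
      rw [iteratedFDeriv_succ_apply_left]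
      rfl
  have hdg : DifferentiableOn ℂ (fun t : ℂ => f (x + t • y)) B := by
    refine hf.comp (by fun_prop) hline
  have h1B : (1 : ℂ) ∈ B := by rw [hB, mem_ball_zero_iff]; simpa using hR'
  have hsum := Complex.hasSum_taylorSeries_on_ball hdg h1B
  simp only [sub_zero, one_pow, one_smul, smul_eq_mul] at hsum
  convert hsum using 2 with m
  rw [hderiv m 0 (by rw [hB]; exact Metric.mem_ball_self (by positivity))]
  simp [p]

end SeveralVariables

/-! ### Holomorphic functions of elements of a Banach algebra -/

section FunctionalCalculus

variable {n : ℕ}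

/-- The lift of a power series in `n` complex variables to a commutative Banach algebra. -/
def liftSeries (B : Type*) [NormedCommRing B] [NormedAlgebra ℂ B]
    (p : FormalMultilinearSeries ℂ (EuclideanSpace ℂ (Fin n)) ℂ) :
    FormalMultilinearSeries ℂ (Fin n → B) B := fun m =>
  ∑ l : Fin m → Fin n, p m (fun i => EuclideanSpace.single (l i) (1 : ℂ)) •
    (ContinuousMultilinearMap.mkPiAlgebra ℂ (Fin m) B).compContinuousLinearMap
      fun i => ContinuousLinearMap.proj (R := ℂ) (φ := fun _ : Fin n => B) (l i)

/-- There are `n ^ m` words of length `m`, each contributing at most `‖p m‖`. Degree zero is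
excluded because the empty product is the unit of `B`, whose norm may exceed `1`. -/
lemma norm_liftSeries_le (B : Type*) [NormedCommRing B] [NormedAlgebra ℂ B]
    (p : FormalMultilinearSeries ℂ (EuclideanSpace ℂ (Fin n)) ℂ) {m : ℕ} (hm : m ≠ 0) :
    ‖liftSeries B p m‖ ≤ (n : ℝ) ^ m * ‖p m‖ := by
  have : Nonempty (Fin m) := ⟨⟨0, Nat.pos_of_ne_zero hm⟩⟩
  have h : ∀ l : Fin m → Fin n, ‖p m (fun i => EuclideanSpace.single (l i) (1 : ℂ)) •
      (ContinuousMultilinearMap.mkPiAlgebra ℂ (Fin m) B).compContinuousLinearMap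
        fun i => ContinuousLinearMap.proj (R := ℂ) (φ := fun _ : Fin n => B) (l i)‖ ≤ ‖p m‖ := by
    intro l
    rw [norm_smul]
    have h1 : ‖p m (fun i => EuclideanSpace.single (l i) (1 : ℂ))‖ ≤ ‖p m‖ := by
      refine ((p m).le_opNorm _).trans ?_
      simp
    have h2 : ‖(ContinuousMultilinearMap.mkPiAlgebra ℂ (Fin m) B).compContinuousLinearMap
        fun i => ContinuousLinearMap.proj (R := ℂ) (φ := fun _ : Fin n => B) (l i)‖ ≤ 1 := by
      refine (ContinuousMultilinearMap.norm_compContinuousLinearMap_le _ _).trans ?_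
      refine mul_le_one₀ ContinuousMultilinearMap.norm_mkPiAlgebra_le
        (Finset.prod_nonneg fun _ _ => norm_nonneg _) ?_
      refine Finset.prod_le_one (fun _ _ => norm_nonneg _) fun i _ => ?_
      refine ContinuousLinearMap.opNorm_le_bound _ zero_le_one fun v => ?_
      simpa using norm_le_pi_norm v (l i)
    calc _ ≤ ‖p m‖ * 1 := by gcongr
      _ = ‖p m‖ := mul_one _
  refine (norm_sum_le _ _).trans ((Finset.sum_le_sum fun l _ => h l).trans ?_)
  simp

/-- Near each point, a holomorphic function of `n` variables can be applied to `n` elements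
of a commutative Banach algebra; the radius does not depend on the algebra. -/
theorem exists_holomorphic_lift {f : EuclideanSpace ℂ (Fin n) → ℂ} {z : EuclideanSpace ℂ (Fin n)}
    (hf : AnalyticAt ℂ f z) : ∃ ρ : ℝ, 0 < ρ ∧ ∀ (B : Type*) [NormedCommRing B] [NormedAlgebra ℂ B]
      [CompleteSpace B], ∃ F : (Fin n → B) → B, AnalyticOnNhd ℂ F (Metric.ball 0 ρ) ∧
        ∀ χ : B →ₐ[ℂ] ℂ, (∀ b, ‖χ b‖ ≤ ‖b‖) → ∀ Y ∈ Metric.ball (0 : Fin n → B) ρ,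
          χ (F Y) = f (z + ∑ j, EuclideanSpace.single j (χ (Y j))) := by
  obtain ⟨p, r, hp⟩ := hf
  obtain ⟨a, ha0, har⟩ := ENNReal.lt_iff_exists_nnreal_btwn.1 hp.r_pos
  have ha0' : 0 < a := by exact_mod_cast ha0
  obtain ⟨C, hC, hpC⟩ := p.norm_mul_pow_le_of_lt_radius (har.trans_le hp.r_le)
  -- The factor `n ^ m` is compensated by `n * ρ ≤ a`; `n + 1` instead of `n` allows `n = 0`. Only
  -- `n` and the scalar series enter, hence the independence of `B`.
  refine ⟨a / (n + 1), by positivity, fun B _ _ _ => ?_⟩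
  set P := liftSeries B p with hP
  let ρ : ℝ≥0 := a / (n + 1)
  have hρ : (ρ : ℝ) = a / (n + 1) := by simp [ρ]
  have hρ0 : 0 < ρ := by positivity
  have hrad : (ρ : ENNReal) ≤ P.radius := by
    refine P.le_radius_of_bound (max C ‖P 0‖) fun m => ?_
    rcases eq_or_ne m 0 with rfl | hm
    · simp
    · refine le_trans ?_ (le_max_left _ _)
      refine le_trans ?_ (hpC m)
      calc ‖P m‖ * (ρ : ℝ) ^ m ≤ ((n : ℝ) ^ m * ‖p m‖) * (ρ : ℝ) ^ m := by
            gcongr; exact norm_liftSeries_le B p hm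
        _ = ‖p m‖ * (n * ρ) ^ m := by rw [mul_pow]; ring
        _ ≤ ‖p m‖ * a ^ m := by
          gcongr
          rw [hρ, mul_div_assoc', div_le_iff₀ (by positivity)]
          nlinarith [a.2]
  have hPb := P.hasFPowerSeriesOnBall (lt_of_lt_of_le (by exact_mod_cast hρ0) hrad)
  have hin : ∀ Y ∈ Metric.ball (0 : Fin n → B) (a / (n + 1)),
      Y ∈ Metric.eball (0 : Fin n → B) P.radius := by
    intro Y hY
    rw [Metric.mem_eball, edist_zero_right]
    refine lt_of_lt_of_le ?_ hrad
    rw [enorm_lt_coe, ← NNReal.coe_lt_coe, hρ]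
    simpa using hY
  refine ⟨P.sum, fun Y hY => hPb.analyticOnNhd Y (hin Y hY), fun χ hχ Y hY => ?_⟩
  let χ' : B →L[ℂ] ℂ := LinearMap.mkContinuous χ.toLinearMap 1 fun b => by simpa using hχ b
  have h1 : HasSum (fun m => P m fun _ => Y) (P.sum Y) := by
    simpa using hPb.hasSum (hin Y hY)
  have h2 : HasSum (fun m => χ (P m fun _ => Y)) (χ (P.sum Y)) := χ'.hasSum h1
  set w : EuclideanSpace ℂ (Fin n) := ∑ j, EuclideanSpace.single j (χ (Y j)) with hw
  have hwn : w ∈ Metric.eball (0 : EuclideanSpace ℂ (Fin n)) r := by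
    rw [Metric.mem_eball, edist_zero_right]
    refine lt_trans ?_ har
    rw [enorm_lt_coe, ← NNReal.coe_lt_coe]
    have hY' : ‖Y‖ < a / (n + 1) := by simpa using hY
    calc ‖w‖ ≤ ∑ j, ‖EuclideanSpace.single j (χ (Y j))‖ := norm_sum_le _ _
      _ ≤ ∑ j : Fin n, ‖Y‖ := by
        refine Finset.sum_le_sum fun j _ => ?_
        rw [PiLp.norm_single]
        exact (hχ _).trans (norm_le_pi_norm Y j)
      _ = n * ‖Y‖ := by simp
      _ ≤ (n + 1) * ‖Y‖ := by nlinarith [norm_nonneg Y]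
      _ < (n + 1) * (a / (n + 1)) := by gcongr
      _ = a := by field_simp
  have h3 := hp.hasSum hwn
  suffices hkey : (fun m => χ (P m fun _ => Y)) = fun m => p m fun _ => w by
    rw [hkey] at h2
    exact h2.unique h3
  funext m
  -- Expanding `w` in the standard basis, multilinearity produces the same sum over words as
  -- `liftSeries`, because `χ` is multiplicative.
  have hw' : (fun _ : Fin m => w) =
      fun _ => ∑ j, (χ (Y j)) • (EuclideanSpace.single j (1 : ℂ) : EuclideanSpace ℂ (Fin n)) := by
    funext _
    rw [hw]
    refine Finset.sum_congr rfl fun j _ => ?_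
    ext i
    simp
  rw [hw']
  have h4 := (p m).toMultilinearMap.map_sum
    (fun (_ : Fin m) (j : Fin n) =>
      (χ (Y j)) • (EuclideanSpace.single j (1 : ℂ) : EuclideanSpace ℂ (Fin n)))
  refine Eq.trans ?_ h4.symm
  rw [hP, liftSeries, _root_.sum_apply, map_sum]
  refine Finset.sum_congr rfl fun l _ => ?_
  have h5 := (p m).toMultilinearMap.map_smul_univ (fun i => χ (Y (l i)))
    (fun i => (EuclideanSpace.single (l i) (1 : ℂ) : EuclideanSpace ℂ (Fin n)))
  refine Eq.trans ?_ h5.symm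
  simp [mul_comm]

/-- The composition operator `x ↦ f ∘ x` on a space `M` of functions on `S` is analytic, provided
that `M` is a Banach algebra of functions for norms that come arbitrarily close to the supremum
norm, and has partitions of unity. -/
theorem exists_analyticAt_comp {S M : Type*} [TopologicalSpace S] [CompactSpace S]
    [NormedAddCommGroup M] [NormedSpace ℂ M] (ev : S → M →L[ℂ] ℂ)
    (hev : ∀ x, Continuous fun s => ev s x)
    (B : ℕ → Type*) [∀ l, NormedCommRing (B l)] [∀ l, NormedAlgebra ℂ (B l)]
    [∀ l, CompleteSpace (B l)] (J : ∀ l, B l ≃L[ℂ] M)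
    (χ : ∀ l, S → (B l →ₐ[ℂ] ℂ)) (hχ : ∀ l s b, χ l s b = ev s (J l b))
    (hχn : ∀ l s b, ‖χ l s b‖ ≤ ‖b‖)
    (hsep : ∀ x y : M, (∀ s, ev s x = ev s y) → x = y)
    (hnorm : ∀ (y : M) (c c' : ℝ), c < c' → (∀ s, ‖ev s y‖ ≤ c) →
      ∀ᶠ l in Filter.atTop, ‖(J l).symm y‖ < c')
    (hpart : ∀ (t : Finset S) (U : S → Set S), (∀ a, IsOpen (U a)) → (⋃ a ∈ t, U a) = univ →
      ∃ φ ψ : S → M, (∀ s, ∑ a ∈ t, ev s (φ a) = 1) ∧ ∀ a ∈ t, ∀ s, ‖ev s (ψ a)‖ ≤ 1 ∧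
        (s ∉ U a → ev s (ψ a) = 0) ∧ (ev s (φ a) ≠ 0 → ev s (ψ a) = 1))
    {Ω : Set (EuclideanSpace ℂ (Fin n))} {f : EuclideanSpace ℂ (Fin n) → ℂ}
    (hf : AnalyticOnNhd ℂ f Ω) (x₀ : Fin n → M)
    (hx₀ : ∀ s, WithLp.toLp 2 (fun j => ev s (x₀ j)) ∈ Ω) :
    ∃ G : (Fin n → M) → M, AnalyticAt ℂ G x₀ ∧
      ∀ᶠ x in 𝓝 x₀, ∀ s, ev s (G x) = f (WithLp.toLp 2 fun j => ev s (x j)) := by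
  let z : S → EuclideanSpace ℂ (Fin n) := fun s => WithLp.toLp 2 (fun j => ev s (x₀ j))
  choose ρ hρ0 hρ using fun s => exists_holomorphic_lift (hf (z s) (hx₀ s))
  -- The slack between `ρ a / 2` and `ρ a` is what turns a bound on the supremum norm into a bound
  -- on an algebra norm.
  let U : S → Set S := fun a => {s | ∀ j, ‖ev s (x₀ j) - z a j‖ < ρ a / 2}
  have hU : ∀ a, IsOpen (U a) := fun a => by
    simp only [U, ofPred_forall]
    exact isOpen_iInter_of_finite fun j => isOpen_lt (((hev _).sub continuous_const).norm)
      continuous_const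
  obtain ⟨t, ht⟩ := isCompact_univ.elim_finite_subcover U hU fun s _ => mem_iUnion.2
    ⟨s, fun j => by simpa [z] using half_pos (hρ0 s)⟩
  obtain ⟨φ, ψ, hφ, hψ⟩ := hpart t U hU (univ_subset_iff.1 ht)
  -- `x₀ - z a` is small only on `U a`; multiplication by the cutoff `ψ a` makes it small on all of
  -- `S` and changes nothing where `φ a ≠ 0`.
  let Y : ∀ (l : ℕ) (a : S), (Fin n → M) → Fin n → B l := fun l a x j =>
    (J l).symm (ψ a) * ((J l).symm (x j) - algebraMap ℂ (B l) (z a j))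
  have hYev : ∀ l a x j s, χ l s (Y l a x j) = ev s (ψ a) * (ev s (x j) - z a j) := by
    intro l a x j s
    simp only [Y, map_mul, map_sub, AlgHom.commutes]
    rw [hχ, hχ]
    simp
  have hYa : ∀ l a, AnalyticAt ℂ (Y l a) x₀ := by
    intro l a
    rw [analyticAt_pi_iff]
    intro j
    refine analyticAt_const.mul (AnalyticAt.sub ?_ analyticAt_const)
    exact (((J l).symm : M →L[ℂ] B l).comp (ContinuousLinearMap.proj j)).analyticAt x₀
  have hsmall : ∀ a ∈ t, ∀ᶠ l in Filter.atTop, ∀ j, ‖Y l a x₀ j‖ < ρ a := by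
    intro a ha
    rw [Filter.eventually_all]
    intro j
    have h1 := hnorm (J 0 (Y 0 a x₀ j)) (ρ a / 2) (ρ a) (by linarith [hρ0 a]) fun s => by
      rw [← hχ, hYev, norm_mul]
      by_cases hs : s ∈ U a
      · calc _ ≤ 1 * (ρ a / 2) := by
              gcongr
              · exact (hψ a ha s).1
              · exact (hs j).le
          _ = _ := one_mul _
      · rw [(hψ a ha s).2.1 hs, norm_zero, zero_mul]
        linarith [hρ0 a]
    filter_upwards [h1] with l hl
    -- For all `l` these represent the same function on `S`, and functions are determined by their
    -- values.
    have h2 : (J l).symm (J 0 (Y 0 a x₀ j)) = Y l a x₀ j := by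
      rw [ContinuousLinearEquiv.symm_apply_eq]
      refine hsep _ _ fun s => ?_
      rw [← hχ, ← hχ, hYev, hYev]
    rwa [h2] at hl
  obtain ⟨l, hl⟩ := (t.eventually_all.2 hsmall).exists
  choose F hFa hF using fun a => hρ a (B l)
  -- Where `φ a ≠ 0` the cutoff is `1`, so the `a`-th term has the value `φ a * f(z a + (x - z a)) =
  -- φ a * f(x)`; the `φ a` add up to `1`.
  refine ⟨fun x => ∑ a ∈ t, J l ((J l).symm (φ a) * F a (Y l a x)), ?_, ?_⟩
  · refine Finset.analyticAt_fun_sum _ fun a ha => ?_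
    refine ((J l : B l →L[ℂ] M).analyticAt _).fun_comp (analyticAt_const.mul ?_)
    refine (hFa a (Y l a x₀) ?_).comp (hYa l a)
    rw [mem_ball_zero_iff, pi_norm_lt_iff (hρ0 a)]
    exact hl a ha
  · have h1 : ∀ a ∈ t, ∀ᶠ x in 𝓝 x₀, Y l a x ∈ Metric.ball 0 (ρ a) := by
      intro a ha
      refine (hYa l a).continuousAt.eventually_mem (Metric.isOpen_ball.mem_nhds ?_)
      rw [mem_ball_zero_iff, pi_norm_lt_iff (hρ0 a)]
      exact hl a ha
    filter_upwards [t.eventually_all.2 h1] with x hx s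
    rw [map_sum]
    have h2 : ∀ a ∈ t, ev s (J l ((J l).symm (φ a) * F a (Y l a x))) =
        ev s (φ a) * f (WithLp.toLp 2 fun j => ev s (x j)) := by
      intro a ha
      rw [← hχ, map_mul, hF a (χ l s) (hχn l s) _ (hx a ha), hχ, ContinuousLinearEquiv.apply_symm_apply]
      by_cases h0 : ev s (φ a) = 0
      · rw [h0, zero_mul, zero_mul]
      · congr 2
        ext i
        simp [hYev, (hψ a ha s).2.2 h0]
    rw [Finset.sum_congr rfl h2, ← Finset.sum_mul, hφ, one_mul]

end FunctionalCalculus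

/-! ### Derivatives in charts and change of charts -/

section ChartJet

variable {d : ℕ} {H : Type*} [TopologicalSpace H]
  (I : ModelWithCorners ℝ (EuclideanSpace ℝ (Fin d)) H)
  {S : Type*} [TopologicalSpace S] [ChartedSpace H S] [IsManifold I ∞ S]
  {F : Type*} [NormedAddCommGroup F] [NormedSpace ℂ F]

/-- The `j`-th derivative of `f` read in the chart `e`. -/
def chartJet (e : OpenPartialHomeomorph S H) (j : ℕ) (f : S → F) (y : EuclideanSpace ℝ (Fin d)) :
    ContinuousMultilinearMap ℝ (fun _ : Fin j => EuclideanSpace ℝ (Fin d)) F :=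
  iteratedFDerivWithin ℝ j (f ∘ (e.extend I).symm) (e.extend I).target y

variable {I}

lemma contDiffOn_comp_extend_symm {e : OpenPartialHomeomorph S H}
    (he : e ∈ IsManifold.maximalAtlas I ∞ S) {k : ℕ} {f : S → F}
    (hf : ContMDiff I 𝓘(ℝ, F) k f) :
    ContDiffOn ℝ k (f ∘ (e.extend I).symm) (e.extend I).target := by
  have hk : (k : WithTop ℕ∞) ≤ ∞ := by exact_mod_cast le_top
  have hm : e ∈ IsManifold.maximalAtlas I k S := IsManifold.maximalAtlas_subset_of_le hk he
  have : IsManifold I k S := IsManifold.of_le hk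
  rw [← contMDiffOn_iff_contDiffOn, OpenPartialHomeomorph.extend_target']
  exact hf.comp_contMDiffOn (contMDiffOn_extend_symm hm)

lemma continuousOn_chartJet {e : OpenPartialHomeomorph S H}
    (he : e ∈ IsManifold.maximalAtlas I ∞ S) {k j : ℕ} (hj : j ≤ k) {f : S → F}
    (hf : ContMDiff I 𝓘(ℝ, F) k f) :
    ContinuousOn (chartJet I e j f) (e.extend I).target :=
  (contDiffOn_comp_extend_symm he hf).continuousOn_iteratedFDerivWithin (by exact_mod_cast hj)
    (uniqueDiffOn_chartTarget _)

lemma image_extend_subset_target (e : OpenPartialHomeomorph S H) {K : Set S} (hK : K ⊆ e.source) :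
    e.extend I '' K ⊆ (e.extend I).target := by
  rintro _ ⟨s, hs, rfl⟩
  exact (e.extend I).map_source (by rw [e.extend_source]; exact hK hs)

lemma isCompact_image_extend (e : OpenPartialHomeomorph S H) {K : Set S} (hK : IsCompact K)
    (hKe : K ⊆ e.source) : IsCompact (e.extend I '' K) :=
  hK.image_of_continuousOn (e.continuousOn_extend.mono (by rwa [e.extend_source]))

lemma aestronglyMeasurable_chartJet {e : OpenPartialHomeomorph S H}
    (he : e ∈ IsManifold.maximalAtlas I ∞ S) {k j : ℕ} (hj : j ≤ k) {f : S → F}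
    (hf : ContMDiff I 𝓘(ℝ, F) k f) {K : Set S} (hK : IsCompact K) (hKe : K ⊆ e.source) :
    AEStronglyMeasurable (chartJet I e j f) (volume.restrict (e.extend I '' K)) :=
  ((continuousOn_chartJet he hj hf).mono (image_extend_subset_target e hKe))
    |>.aestronglyMeasurable_of_isCompact (isCompact_image_extend e hK hKe)
      (isCompact_image_extend e hK hKe).measurableSet

/-- The Jacobian of the inverse coordinate change is bounded on the compact image of `K`. The
constant is taken at least `1` so that `c ^ (1 / q) ≤ c` for every `q ≥ 1`. -/
lemma exists_map_extendCoordChange_le {e e' : OpenPartialHomeomorph S H}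
    (he : e ∈ IsManifold.maximalAtlas I ∞ S) (he' : e' ∈ IsManifold.maximalAtlas I ∞ S)
    {K : Set S} (hK : IsCompact K) (hKe : K ⊆ e.source) (hKe' : K ⊆ e'.source) :
    ∃ c : ℝ≥0, 1 ≤ c ∧ AEMeasurable (I.extendCoordChange e e') (volume.restrict (e.extend I '' K)) ∧
      Measure.map (I.extendCoordChange e e') (volume.restrict (e.extend I '' K)) ≤
        (c : ENNReal) • volume.restrict (e'.extend I '' K) := by
  set τ := I.extendCoordChange e e' with hτ
  set σ := I.extendCoordChange e' e with hσ
  set L := e.extend I '' K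
  set L' := e'.extend I '' K
  have hL : IsCompact L := isCompact_image_extend e hK hKe
  have hL' : IsCompact L' := isCompact_image_extend e' hK hKe'
  have hLs : L ⊆ τ.source := by
    rw [hτ, ← OpenPartialHomeomorph.extend_image_source_inter]
    exact image_mono fun s hs => ⟨hKe hs, hKe' hs⟩
  have hLs' : L' ⊆ σ.source := by
    rw [hσ, ← OpenPartialHomeomorph.extend_image_source_inter]
    exact image_mono fun s hs => ⟨hKe' hs, hKe hs⟩
  have hτc : ContDiffOn ℝ ∞ τ τ.source := I.contDiffOn_extendCoordChange he he'
  have hσc : ContDiffOn ℝ ∞ σ σ.source := I.contDiffOn_extendCoordChange he' he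
  have hmeas : AEMeasurable τ (volume.restrict L) :=
    (hτc.continuousOn.mono hLs).aemeasurable hL.measurableSet
  have hu : UniqueDiffOn ℝ σ.source := I.uniqueDiffOn_extendCoordChange_source
  have hdet : ContinuousOn (fun y => |(fderivWithin ℝ σ σ.source y).det|) L' :=
    (ContinuousLinearMap.continuous_det.comp_continuousOn
      ((hσc.continuousOn_fderivWithin hu (by simp)).mono hLs')).abs
  obtain ⟨c0, hc0⟩ := hL'.bddAbove_image hdet
  have hc : ∀ y ∈ L', |(fderivWithin ℝ σ σ.source y).det| ≤ max c0 1 := fun y hy =>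
    (hc0 ⟨y, hy, rfl⟩).trans (le_max_left _ _)
  refine ⟨⟨max c0 1, by positivity⟩, ?_, hmeas, ?_⟩
  · exact le_max_right c0 1
  refine Measure.le_iff.2 fun B hB => ?_
  have hTL : ∀ s ∈ K, τ (e.extend I s) = e'.extend I s := fun s hs => by
    rw [hτ]
    simp only [PartialEquiv.coe_trans, Function.comp_apply]
    rw [e.extend_left_inv (hKe hs)]
  have hSL : ∀ s ∈ K, σ (e'.extend I s) = e.extend I s := fun s hs => by
    rw [hσ]
    simp only [PartialEquiv.coe_trans, Function.comp_apply]
    rw [e'.extend_left_inv (hKe' hs)]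
  rw [Measure.map_apply_of_aemeasurable hmeas hB, Measure.restrict_apply' hL.measurableSet,
    Measure.smul_apply, Measure.restrict_apply hB, smul_eq_mul]
  -- Viewing the preimage under `τ` as an image under its inverse `σ` makes the estimate for volumes
  -- of images available.
  have hsub : τ ⁻¹' B ∩ L ⊆ σ '' (B ∩ L') := by
    rintro _ ⟨hyB, s, hs, rfl⟩
    rw [mem_preimage, hTL s hs] at hyB
    exact ⟨e'.extend I s, ⟨hyB, s, hs, rfl⟩, hSL s hs⟩
  have hBL : MeasurableSet (B ∩ L') := hB.inter hL'.measurableSet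
  calc volume (τ ⁻¹' B ∩ L) ≤ volume (σ '' (B ∩ L')) := measure_mono hsub
    _ ≤ ∫⁻ y in B ∩ L', ENNReal.ofReal |(fderivWithin ℝ σ σ.source y).det| := by
      refine addHaar_image_le_lintegral_abs_det_fderiv volume hBL fun y hy => ?_
      exact ((hσc.differentiableOn (by simp) y (hLs' hy.2)).hasFDerivWithinAt).mono
        (inter_subset_right.trans hLs')
    _ ≤ ∫⁻ _ in B ∩ L', ENNReal.ofReal (max c0 1) := by
      refine setLIntegral_mono' hBL fun y hy => ENNReal.ofReal_le_ofReal (hc y hy.2)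
    _ = _ := by
      rw [setLIntegral_const]
      congr 1
      exact ENNReal.ofReal_eq_coe_nnreal _

/-- The chain rule for higher derivatives, together with bounds on the derivatives of the coordinate
change on a compact set. -/
lemma exists_norm_chartJet_le {e e' : OpenPartialHomeomorph S H}
    (he : e ∈ IsManifold.maximalAtlas I ∞ S) (he' : e' ∈ IsManifold.maximalAtlas I ∞ S)
    {K : Set S} (hK : IsCompact K) (hKe : K ⊆ e.source) (hKe' : K ⊆ e'.source) (k : ℕ) :
    ∃ C : ℝ, 0 ≤ C ∧ ∀ f : S → F, ContMDiff I 𝓘(ℝ, F) k f → ∀ j ≤ k, ∀ y ∈ e.extend I '' K,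
      ‖chartJet I e j f y‖ ≤ C * ∑ l ∈ Finset.range (j + 1),
        ‖chartJet I e' l f (I.extendCoordChange e e' y)‖ := by
  set τ := I.extendCoordChange e e' with hτ
  set L := e.extend I '' K
  have hL : IsCompact L := isCompact_image_extend e hK hKe
  have hLs : L ⊆ τ.source := by
    rw [hτ, ← OpenPartialHomeomorph.extend_image_source_inter]
    exact image_mono fun s hs => ⟨hKe hs, hKe' hs⟩
  have hτc : ContDiffOn ℝ ∞ τ τ.source := I.contDiffOn_extendCoordChange he he'
  have hu : UniqueDiffOn ℝ τ.source := I.uniqueDiffOn_extendCoordChange_source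
  have hb : ∀ l : ℕ, ∃ D : ℝ, ∀ y ∈ L, ‖iteratedFDerivWithin ℝ l τ τ.source y‖ ≤ D := fun l =>
    hL.exists_bound_of_continuousOn
      ((hτc.continuousOn_iteratedFDerivWithin (by exact_mod_cast le_top) hu).mono hLs)
  choose D hD using hb
  -- The bound for compositions wants the `i`-th derivative of `τ` to be at most `D' ^ i`; for `i ≥
  -- 1` this follows from `D' ≥ 1`.
  let D' : ℝ := 1 + ∑ l ∈ Finset.range (k + 1), |D l|
  have hD1 : 1 ≤ D' := le_add_of_nonneg_right (Finset.sum_nonneg fun _ _ => abs_nonneg _)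
  have hDD : ∀ l ≤ k, D l ≤ D' := fun l hl => by
    have := Finset.single_le_sum (f := fun l => |D l|) (fun _ _ => abs_nonneg _)
      (Finset.mem_range.2 (Nat.lt_succ_of_le hl))
    have h2 := le_abs_self (D l)
    simp only [D']
    linarith
  refine ⟨k.factorial * D' ^ k, by positivity, fun f hf j hj y hy => ?_⟩
  have hys := hLs hy
  -- Near `y` both sets agree with `range I`, so derivatives within either of them coincide, also at
  -- boundary points.
  have hset : τ.source =ᶠ[𝓝 y] (e.extend I).target := by
    rw [← nhdsWithin_eq_iff_eventuallyEq]
    have hsub : τ.source ⊆ (e.extend I).target := by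
      rw [hτ, ModelWithCorners.extendCoordChange, PartialEquiv.trans_source]
      exact inter_subset_left
    refine le_antisymm (nhdsWithin_mono _ hsub) ?_
    rw [nhdsWithin_le_iff]
    exact nhdsWithin_mono _ (e.extend_target_subset_range)
      (ModelWithCorners.extendCoordChange_source_mem_nhdsWithin hys)
  have hmaps : MapsTo τ τ.source (e'.extend I).target := fun z hz => by
    have := τ.map_source hz
    rw [hτ, ModelWithCorners.extendCoordChange, PartialEquiv.trans_target] at this
    exact this.1
  have hcongr : EqOn (f ∘ (e.extend I).symm) ((f ∘ (e'.extend I).symm) ∘ τ) τ.source := by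
    intro z hz
    have hz' : (e.extend I).symm z ∈ e'.source := by
      rw [hτ, ModelWithCorners.extendCoordChange, PartialEquiv.trans_source,
        e'.extend_source] at hz
      exact hz.2
    simp only [hτ, PartialEquiv.coe_trans, Function.comp_apply]
    rw [e'.extend_left_inv hz']
  have h1 : chartJet I e j f y = iteratedFDerivWithin ℝ j ((f ∘ (e'.extend I).symm) ∘ τ) τ.source y := by
    rw [chartJet, ← iteratedFDerivWithin_congr_set hset, iteratedFDerivWithin_congr hcongr hys]
  rw [h1]
  have h2 := norm_iteratedFDerivWithin_comp_le (n := j) (N := (k : ℕ∞ω))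
    (C := ∑ l ∈ Finset.range (j + 1), ‖chartJet I e' l f (τ y)‖) (D := D')
    (contDiffOn_comp_extend_symm he' hf) (hτc.of_le (by exact_mod_cast le_top))
    (by exact_mod_cast hj) (uniqueDiffOn_chartTarget _) hu hmaps hys
    (fun i hi => Finset.single_le_sum (f := fun l => ‖chartJet I e' l f (τ y)‖)
      (fun _ _ => norm_nonneg _) (Finset.mem_range.2 (Nat.lt_succ_of_le hi)))
    (fun i hi1 hi => ((hD i y hy).trans (hDD i (hi.trans hj))).trans
      (le_self_pow₀ hD1 (by omega)))
  refine h2.trans ?_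
  have h3 : 0 ≤ ∑ l ∈ Finset.range (j + 1), ‖chartJet I e' l f (τ y)‖ :=
    Finset.sum_nonneg fun _ _ => norm_nonneg _
  have h4 : (j.factorial : ℝ) ≤ k.factorial := by exact_mod_cast Nat.factorial_le hj
  have h5 : D' ^ j ≤ D' ^ k := pow_le_pow_right₀ hD1 hj
  calc _ = (j.factorial * D' ^ j) * ∑ l ∈ Finset.range (j + 1), ‖chartJet I e' l f (τ y)‖ := by ring
    _ ≤ _ := by gcongr

/-- Change of charts for `L^q` norms of derivatives. -/
theorem exists_eLpNorm_chartJet_le {e e' : OpenPartialHomeomorph S H}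
    (he : e ∈ IsManifold.maximalAtlas I ∞ S) (he' : e' ∈ IsManifold.maximalAtlas I ∞ S)
    {K : Set S} (hK : IsCompact K) (hKe : K ⊆ e.source) (hKe' : K ⊆ e'.source) (k : ℕ) :
    ∃ C : ℝ≥0, ∀ f : S → F, ContMDiff I 𝓘(ℝ, F) k f → ∀ j ≤ k, ∀ q : ENNReal, 1 ≤ q →
      eLpNorm (chartJet I e j f) q (volume.restrict (e.extend I '' K)) ≤
        C * ∑ l ∈ Finset.range (j + 1),
          eLpNorm (chartJet I e' l f) q (volume.restrict (e'.extend I '' K)) := by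
  obtain ⟨c, hc1, hm, hle⟩ := exists_map_extendCoordChange_le he he' hK hKe hKe'
  obtain ⟨C, hC0, hC⟩ := exists_norm_chartJet_le (F := F) he he' hK hKe hKe' k
  refine ⟨C.toNNReal * c, fun f hf j hj q hq => ?_⟩
  set τ := I.extendCoordChange e e' with hτ
  set L := e.extend I '' K
  set L' := e'.extend I '' K
  have hL : IsCompact L := isCompact_image_extend e hK hKe
  have hsm : ∀ l ≤ k, AEStronglyMeasurable (chartJet I e' l f) (Measure.map τ (volume.restrict L)) :=
    fun l hl => (aestronglyMeasurable_chartJet he' hl hf hK hKe').mono_ac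
      (Measure.absolutelyContinuous_of_le_smul hle)
  have h1 : ∀ l ≤ k, eLpNorm (fun y => ‖chartJet I e' l f (τ y)‖) q (volume.restrict L) ≤
      c * eLpNorm (chartJet I e' l f) q (volume.restrict L') := by
    intro l hl
    have h2 : eLpNorm (chartJet I e' l f ∘ τ) q (volume.restrict L) =
        eLpNorm (chartJet I e' l f) q (Measure.map τ (volume.restrict L)) :=
      (eLpNorm_map_measure (hsm l hl) hm).symm
    rw [eLpNorm_norm (fun y => chartJet I e' l f (τ y))]
    refine h2.le.trans ((eLpNorm_le_of_measure_le_smul hle).trans ?_)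
    rw [smul_eq_mul]
    gcongr
    have hq' : (1 / q).toReal ≤ 1 := by
      rw [one_div]
      exact ENNReal.toReal_mono ENNReal.one_ne_top (ENNReal.inv_le_one.2 hq)
    calc (c : ENNReal) ^ (1 / q).toReal ≤ (c : ENNReal) ^ (1 : ℝ) :=
          ENNReal.rpow_le_rpow_of_exponent_le (by exact_mod_cast hc1) hq'
      _ = c := ENNReal.rpow_one _
  have h3 : eLpNorm (chartJet I e j f) q (volume.restrict L) ≤ ENNReal.ofReal C *
      eLpNorm (∑ l ∈ Finset.range (j + 1), fun y => ‖chartJet I e' l f (τ y)‖) q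
        (volume.restrict L) := by
    refine eLpNorm_le_mul_eLpNorm_of_ae_le_mul ?_ q
    refine (ae_restrict_iff' hL.measurableSet).2 (Filter.Eventually.of_forall fun y hy => ?_)
    refine (hC f hf j hj y hy).trans_eq ?_
    rw [Finset.sum_apply, Real.norm_of_nonneg (Finset.sum_nonneg fun _ _ => norm_nonneg _)]
  refine h3.trans ?_
  rw [ENNReal.ofReal, ENNReal.coe_mul, mul_assoc]
  gcongr
  refine (eLpNorm_sum_le (fun l hl => ?_) hq).trans ?_
  · exact ((hsm l (by have := Finset.mem_range.1 hl; omega)).comp_aemeasurable hm).norm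
  · rw [Finset.mul_sum]
    exact Finset.sum_le_sum fun l hl => h1 l (by have := Finset.mem_range.1 hl; omega)

end ChartJet

/-! ### A Riesz potential estimate -/

section Potential

open ENNReal

/-- Jensen's inequality, unnormalized. It serves for averages over `D`, for a weighted measure in
`t`, and for mollifiers. -/
lemma ENNReal.lintegral_rpow_le_of_one_le {α : Type*} [MeasurableSpace α] {μ : Measure α}
    {f : α → ℝ≥0∞} (hf : AEMeasurable f μ) {b : ℝ} (hb : 1 ≤ b) :
    (∫⁻ x, f x ∂μ) ^ b ≤ μ univ ^ (b - 1) * ∫⁻ x, f x ^ b ∂μ := by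
  have hb0 : 0 < b := by linarith
  have h := eLpNorm'_le_eLpNorm'_mul_rpow_measure_univ (μ := μ) (f := f) zero_lt_one hb
    hf.aestronglyMeasurable
  simp only [eLpNorm', enorm_eq_self, rpow_one, div_one] at h
  calc (∫⁻ x, f x ∂μ) ^ b ≤ ((∫⁻ x, f x ^ b ∂μ) ^ (1 / b) * μ univ ^ (1 - 1 / b)) ^ b := by
        gcongr
    _ = μ univ ^ (b - 1) * ∫⁻ x, f x ^ b ∂μ := by
      rw [mul_rpow_of_nonneg _ _ hb0.le, ← rpow_mul, ← rpow_mul, one_div, inv_mul_cancel₀ hb0.ne',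
        rpow_one, mul_comm, sub_mul, inv_mul_cancel₀ hb0.ne', one_mul]

variable {d : ℕ}


lemma lintegral_comp_add_smul (w : (EuclideanSpace ℝ (Fin d)) → ℝ≥0∞) (hw : Measurable w) (y : (EuclideanSpace ℝ (Fin d))) {t : ℝ} (ht : 0 < t) :
    ∫⁻ v, w (y + t • v) = ENNReal.ofReal (t ^ (-(d : ℝ))) * ∫⁻ v, w v := by
  have h1 : ∫⁻ v, w (y + t • v) = ∫⁻ u, w (y + u) ∂(Measure.map (t • ·) (volume : Measure (EuclideanSpace ℝ (Fin d)))) := by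
    rw [lintegral_map (by fun_prop) (by fun_prop)]
  rw [h1, Measure.map_addHaar_smul _ ht.ne', lintegral_smul_measure, lintegral_add_left_eq_self,
    finrank_euclideanSpace_fin, abs_of_pos (by positivity), Real.rpow_neg ht.le, Real.rpow_natCast]
  rfl

/-- The average of `w` over `y + t • D` (not normalized). -/
def dilationAverage (D : Set (EuclideanSpace ℝ (Fin d))) (w : (EuclideanSpace ℝ (Fin d)) → ℝ≥0∞) (t : ℝ) (y : (EuclideanSpace ℝ (Fin d))) : ℝ≥0∞ :=
  ∫⁻ v in D, w (y + t • v)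

/-- A Riesz potential, truncated to the cone over `D`. -/
def conePotential (D : Set (EuclideanSpace ℝ (Fin d))) (T : ℝ) (w : (EuclideanSpace ℝ (Fin d)) → ℝ≥0∞) (y : (EuclideanSpace ℝ (Fin d))) : ℝ≥0∞ :=
  ∫⁻ t in Ioc 0 T, dilationAverage D w t y

variable {D : Set (EuclideanSpace ℝ (Fin d))} {w : (EuclideanSpace ℝ (Fin d)) → ℝ≥0∞}

lemma measurable_dilationAverage (hw : Measurable w) :
    Measurable (Function.uncurry (dilationAverage D w)) := by
  refine Measurable.lintegral_prod_right' (ν := volume.restrict D)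
    (f := fun p : (ℝ × (EuclideanSpace ℝ (Fin d))) × (EuclideanSpace ℝ (Fin d)) => w (p.1.2 + p.1.1 • p.2)) ?_
  exact hw.comp (by fun_prop)

lemma measurable_conePotential (hw : Measurable w) (T : ℝ) : Measurable (conePotential D T w) := by
  refine Measurable.lintegral_prod_right' (ν := volume.restrict (Ioc 0 T))
    (f := fun p : (EuclideanSpace ℝ (Fin d)) × ℝ => dilationAverage D w p.2 p.1) ?_
  exact (measurable_dilationAverage hw).comp measurable_swap

lemma dilationAverage_rpow_le (hw : Measurable w) {a : ℝ} (ha : 1 ≤ a) (t : ℝ) (y : (EuclideanSpace ℝ (Fin d))) :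
    dilationAverage D w t y ^ a ≤ volume D ^ (a - 1) * dilationAverage D (fun x => w x ^ a) t y := by
  have := ENNReal.lintegral_rpow_le_of_one_le (μ := volume.restrict D)
    (f := fun v => w (y + t • v)) (hw.comp (by fun_prop)).aemeasurable ha
  rwa [Measure.restrict_apply_univ] at this

/-- The pointwise bound: it holds for every `y` but costs the factor `t^(-d)` from the dilation. -/
lemma dilationAverage_rpow_le' (hw : Measurable w) {a : ℝ} (ha : 1 ≤ a) {t : ℝ} (ht : 0 < t) (y : (EuclideanSpace ℝ (Fin d))) :
    dilationAverage D w t y ^ a ≤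
      volume D ^ (a - 1) * (ENNReal.ofReal (t ^ (-(d : ℝ))) * ∫⁻ x, w x ^ a) := by
  refine (dilationAverage_rpow_le hw ha t y).trans ?_
  gcongr
  rw [← lintegral_comp_add_smul _ (by fun_prop) y ht]
  exact setLIntegral_le_lintegral _ _

/-- The integrated bound: by Tonelli and translation invariance there is no loss in `t`. -/
lemma lintegral_dilationAverage_rpow_le (hw : Measurable w) {a : ℝ} (ha : 1 ≤ a) (t : ℝ) :
    ∫⁻ y, dilationAverage D w t y ^ a ≤ volume D ^ (a - 1) * (volume D * ∫⁻ x, w x ^ a) := by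
  have hm : Measurable (Function.uncurry fun (y v : (EuclideanSpace ℝ (Fin d))) => w (y + t • v) ^ a) :=
    (hw.comp (by fun_prop : Measurable fun p : (EuclideanSpace ℝ (Fin d)) × (EuclideanSpace ℝ (Fin d)) => p.1 + t • p.2)).pow_const a
  calc ∫⁻ y, dilationAverage D w t y ^ a
      ≤ ∫⁻ y, volume D ^ (a - 1) * dilationAverage D (fun x => w x ^ a) t y :=
        lintegral_mono fun y => dilationAverage_rpow_le hw ha t y
    _ = volume D ^ (a - 1) * ∫⁻ y, dilationAverage D (fun x => w x ^ a) t y := by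
        rw [lintegral_const_mul]
        exact (measurable_dilationAverage (hw.pow_const a)).comp (by fun_prop : Measurable fun y => (t, y))
    _ = volume D ^ (a - 1) * (volume D * ∫⁻ x, w x ^ a) := by
        congr 1
        simp only [dilationAverage]
        rw [lintegral_lintegral_swap hm.aemeasurable]
        simp_rw [lintegral_add_right_eq_self (fun x => w x ^ a)]
        rw [lintegral_const, Measure.restrict_apply_univ, mul_comm]

/-- Interpolation of the two previous bounds: in `u^b = (u^a)^(b/a - 1) * u^a` the first factor is
bounded pointwise and the second is integrated. After taking `b`-th roots the loss is `t^(-d (1/a -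
1/b))`. -/
lemma lintegral_dilationAverage_rpow_le' (hw : Measurable w) {a b : ℝ} (ha : 1 ≤ a) (hab : a ≤ b)
    {t : ℝ} (ht : 0 < t) :
    ∫⁻ y, dilationAverage D w t y ^ b ≤
      ((volume D ^ (a - 1)) ^ (b / a - 1) * (volume D ^ (a - 1) * volume D)) *
        ENNReal.ofReal (t ^ (-(d : ℝ))) ^ (b / a - 1) * (∫⁻ x, w x ^ a) ^ (b / a) := by
  have ha0 : 0 < a := by linarith
  have hs : 0 ≤ b / a - 1 := by rw [sub_nonneg, one_le_div ha0]; exact hab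
  set W := ∫⁻ x, w x ^ a
  set V := volume D
  set τ := ENNReal.ofReal (t ^ (-(d : ℝ)))
  have h1 : ∀ y, dilationAverage D w t y ^ b ≤
      (V ^ (a - 1) * (τ * W)) ^ (b / a - 1) * dilationAverage D w t y ^ a := by
    intro y
    have : dilationAverage D w t y ^ b =
        (dilationAverage D w t y ^ a) ^ (b / a - 1) * dilationAverage D w t y ^ a := by
      rw [← rpow_mul, ← rpow_add_of_nonneg _ _ (by positivity) ha0.le]
      congr 1
      field_simp
      ring
    rw [this]
    gcongr
    exact dilationAverage_rpow_le' hw ha ht y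
  calc ∫⁻ y, dilationAverage D w t y ^ b
      ≤ ∫⁻ y, (V ^ (a - 1) * (τ * W)) ^ (b / a - 1) * dilationAverage D w t y ^ a :=
        lintegral_mono h1
    _ = (V ^ (a - 1) * (τ * W)) ^ (b / a - 1) * ∫⁻ y, dilationAverage D w t y ^ a := by
        rw [lintegral_const_mul]
        exact ((measurable_dilationAverage hw).comp
          (by fun_prop : Measurable fun y => (t, y))).pow_const a
    _ ≤ (V ^ (a - 1) * (τ * W)) ^ (b / a - 1) * (V ^ (a - 1) * (V * W)) := by
        gcongr
        exact lintegral_dilationAverage_rpow_le hw ha t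
    _ = ((V ^ (a - 1)) ^ (b / a - 1) * (V ^ (a - 1) * V)) * τ ^ (b / a - 1) *
        (W ^ (b / a - 1) * W ^ (1 : ℝ)) := by
        rw [mul_rpow_of_nonneg _ _ hs, mul_rpow_of_nonneg _ _ hs, rpow_one]
        ring
    _ = _ := by
        rw [← rpow_add_of_nonneg _ _ hs zero_le_one, sub_add_cancel]

lemma lintegral_Ioc_rpow_lt_top {θ : ℝ} (hθ : θ < 1) (T : ℝ) :
    ∫⁻ t in Ioc 0 T, ENNReal.ofReal (t ^ (-θ)) < ⊤ := by
  rcases le_or_gt T 0 with hT | hT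
  · simp [Ioc_eq_empty_of_le hT]
  have h := (intervalIntegral.intervalIntegrable_rpow' (a := 0) (b := T)
    (by linarith : -1 < -θ))
  rw [intervalIntegrable_iff_integrableOn_Ioc_of_le hT.le] at h
  exact h.lintegral_lt_top

/-- The endpoint `b = ∞`: the pointwise bound costs `t^(-d/P)`, which is integrable near `0` as `d <
P`. -/
lemma exists_conePotential_le_const (hD : volume D ≠ ⊤) {P : ℝ} (hP : 1 ≤ P) (hdP : (d : ℝ) < P)
    (T : ℝ) : ∃ C : ℝ≥0, ∀ w : (EuclideanSpace ℝ (Fin d)) → ℝ≥0∞, Measurable w → ∀ y,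
      conePotential D T w y ≤ C * (∫⁻ x, w x ^ P) ^ (1 / P) := by
  have hP0 : 0 < P := by linarith
  set M := ∫⁻ t in Ioc 0 T, ENNReal.ofReal (t ^ (-(d / P)))
  have hM : M < ⊤ := lintegral_Ioc_rpow_lt_top (by rwa [div_lt_one hP0]) T
  have hK : (volume D ^ (P - 1)) ^ (1 / P) * M < ⊤ := by
    refine mul_lt_top ?_ hM
    exact (rpow_lt_top_of_nonneg (by positivity) (rpow_ne_top_of_nonneg (by linarith) hD))
  refine ⟨((volume D ^ (P - 1)) ^ (1 / P) * M).toNNReal, fun w hw y => ?_⟩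
  rw [coe_toNNReal hK.ne]
  calc conePotential D T w y
      ≤ ∫⁻ t in Ioc 0 T, ((volume D ^ (P - 1)) ^ (1 / P) * (∫⁻ x, w x ^ P) ^ (1 / P)) *
        ENNReal.ofReal (t ^ (-(d / P))) := by
        refine setLIntegral_mono' measurableSet_Ioc fun t ht => ?_
        have h1 := rpow_le_rpow (dilationAverage_rpow_le' (D := D) hw hP ht.1 y)
          (by positivity : 0 ≤ 1 / P)
        rw [← rpow_mul, mul_one_div_cancel hP0.ne', rpow_one,
          mul_rpow_of_nonneg _ _ (by positivity), mul_rpow_of_nonneg _ _ (by positivity),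
          ENNReal.ofReal_rpow_of_pos (Real.rpow_pos_of_pos ht.1 _), ← Real.rpow_mul ht.1.le] at h1
        refine h1.trans_eq ?_
        rw [show -(d : ℝ) * (1 / P) = -(d / P) by ring]
        ring
    _ = _ := by
      rw [lintegral_const_mul]
      · ring
      · fun_prop

/-- With `κ = t^(-θ)`, `θ = d (1/a - 1/b) < 1`, write the potential as the integral of `κ⁻¹ *
dilationAverage` against the finite measure `κ dt`. The weight cancels exactly the growth of the
`L^b` norm of the averages, and Jensen's inequality replaces Minkowski's. -/
lemma exists_lintegral_conePotential_rpow_le (hD : volume D ≠ ⊤) {a b : ℝ} (ha : 1 ≤ a) (hab : a ≤ b)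
    (hd : (d : ℝ) * (1 / a - 1 / b) < 1) (T : ℝ) : ∃ C : ℝ≥0, ∀ w : (EuclideanSpace ℝ (Fin d)) → ℝ≥0∞, Measurable w →
      ∫⁻ y, conePotential D T w y ^ b ≤ C * (∫⁻ x, w x ^ a) ^ (b / a) := by
  have ha0 : 0 < a := by linarith
  have hb0 : 0 < b := by linarith
  set θ : ℝ := d * (1 / a - 1 / b) with hθ
  let κ : ℝ → ℝ≥0∞ := fun t => ENNReal.ofReal (t ^ (-θ))
  have hκm : Measurable κ := by fun_prop
  set M := ∫⁻ t in Ioc 0 T, κ t with hMdef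
  have hM : M < ⊤ := lintegral_Ioc_rpow_lt_top hd T
  set K := (volume D ^ (a - 1)) ^ (b / a - 1) * (volume D ^ (a - 1) * volume D) with hKdef
  have hK : K < ⊤ := by
    have h1 : volume D ^ (a - 1) < ⊤ := rpow_lt_top_of_nonneg (by linarith) hD
    have h2 : 0 ≤ b / a - 1 := by rw [sub_nonneg, one_le_div ha0]; exact hab
    exact mul_lt_top (rpow_lt_top_of_nonneg h2 h1.ne) (mul_lt_top h1 hD.lt_top)
  have hMK : M ^ (b - 1) * (M * K) < ⊤ :=
    mul_lt_top (rpow_lt_top_of_nonneg (by linarith) hM.ne) (mul_lt_top hM hK)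
  refine ⟨(M ^ (b - 1) * (M * K)).toNNReal, fun w hw => ?_⟩
  rw [coe_toNNReal hMK.ne]
  set W := ∫⁻ x, w x ^ a
  have hA := measurable_dilationAverage (D := D) hw
  have hκ0 : ∀ t ∈ Ioc 0 T, κ t ≠ 0 := fun t ht => by
    simp only [κ, ne_eq, ENNReal.ofReal_eq_zero, not_le]
    exact Real.rpow_pos_of_pos ht.1 _
  have hκt : ∀ t, κ t ≠ ⊤ := fun t => ENNReal.ofReal_ne_top
  let μ : Measure ℝ := (volume.restrict (Ioc 0 T)).withDensity κ
  have hμ : ∀ f : ℝ → ℝ≥0∞, Measurable f → ∫⁻ t, f t ∂μ = ∫⁻ t in Ioc 0 T, κ t * f t := fun f hf => by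
    rw [lintegral_withDensity_eq_lintegral_mul _ hκm hf]
    rfl
  have hμu : μ univ = M := by
    rw [withDensity_apply _ MeasurableSet.univ, Measure.restrict_univ]
  have h1 : ∀ y, conePotential D T w y ^ b ≤
      M ^ (b - 1) * ∫⁻ t in Ioc 0 T, κ t * ((κ t)⁻¹ * dilationAverage D w t y) ^ b := by
    intro y
    have hmy : Measurable fun t => (κ t)⁻¹ * dilationAverage D w t y :=
      hκm.inv.mul (hA.comp (by fun_prop : Measurable fun t : ℝ => (t, y)))
    have h2 := ENNReal.lintegral_rpow_le_of_one_le (μ := μ) hmy.aemeasurable (ha.trans hab)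
    rw [hμ _ hmy, hμ _ (hmy.pow_const b), hμu] at h2
    refine le_trans (le_of_eq ?_) h2
    congr 1
    refine setLIntegral_congr_fun measurableSet_Ioc fun t ht => ?_
    rw [← mul_assoc, ENNReal.mul_inv_cancel (hκ0 t ht) (hκt t), one_mul]
  have hjm : Measurable (Function.uncurry fun (y : (EuclideanSpace ℝ (Fin d))) (t : ℝ) =>
      κ t * ((κ t)⁻¹ * dilationAverage D w t y) ^ b) := by
    have h2 : Measurable fun p : (EuclideanSpace ℝ (Fin d)) × ℝ => dilationAverage D w p.2 p.1 := hA.comp measurable_swap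
    exact (hκm.comp measurable_snd).mul
      ((((hκm.comp measurable_snd).inv).mul h2).pow_const b)
  calc ∫⁻ y, conePotential D T w y ^ b
      ≤ ∫⁻ y, M ^ (b - 1) * ∫⁻ t in Ioc 0 T, κ t * ((κ t)⁻¹ * dilationAverage D w t y) ^ b :=
        lintegral_mono h1
    _ = M ^ (b - 1) * ∫⁻ y, ∫⁻ t in Ioc 0 T, κ t * ((κ t)⁻¹ * dilationAverage D w t y) ^ b := by
        exact lintegral_const_mul _ hjm.lintegral_prod_right'
    _ = M ^ (b - 1) * ∫⁻ t in Ioc 0 T, ∫⁻ y, κ t * ((κ t)⁻¹ * dilationAverage D w t y) ^ b := by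
        rw [lintegral_lintegral_swap hjm.aemeasurable]
    _ ≤ M ^ (b - 1) * ∫⁻ t in Ioc 0 T, κ t * (K * W ^ (b / a)) := by
        refine mul_le_mul_right ?_ _
        refine setLIntegral_mono' measurableSet_Ioc fun t ht => ?_
        have hmt : Measurable fun y => dilationAverage D w t y :=
          hA.comp (by fun_prop : Measurable fun y : (EuclideanSpace ℝ (Fin d)) => (t, y))
        simp_rw [mul_rpow_of_nonneg _ _ hb0.le]
        rw [lintegral_const_mul _ (by fun_prop), lintegral_const_mul _ (by fun_prop)]
        refine mul_le_mul_right ?_ _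
        have h3 := lintegral_dilationAverage_rpow_le' (D := D) hw ha hab ht.1
        have h4 : ENNReal.ofReal (t ^ (-(d : ℝ))) ^ (b / a - 1) = κ t ^ b := by
          simp only [κ]
          rw [ENNReal.ofReal_rpow_of_pos (Real.rpow_pos_of_pos ht.1 _),
            ENNReal.ofReal_rpow_of_pos (Real.rpow_pos_of_pos ht.1 _), ← Real.rpow_mul ht.1.le,
            ← Real.rpow_mul ht.1.le, hθ]
          congr 2
          field_simp
        rw [h4, ← hKdef] at h3
        calc (κ t)⁻¹ ^ b * ∫⁻ y, dilationAverage D w t y ^ b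
            ≤ (κ t)⁻¹ ^ b * (K * κ t ^ b * W ^ (b / a)) := by gcongr
          _ = ((κ t)⁻¹ * κ t) ^ b * (K * W ^ (b / a)) := by
            rw [mul_rpow_of_nonneg _ _ hb0.le]; ring
          _ = K * W ^ (b / a) := by
            rw [ENNReal.inv_mul_cancel (hκ0 t ht) (hκt t), one_rpow, one_mul]
    _ = M ^ (b - 1) * (M * K) * W ^ (b / a) := by
        rw [lintegral_mul_const _ hκm]
        ring

/-- Subcritical Sobolev estimate for truncated Riesz potentials. -/
theorem exists_eLpNorm_conePotential_le (hD : volume D ≠ ⊤) {P : ℝ≥0} (hdP : (d : ℝ≥0) < P) (j : ℕ)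
    (hj : (j : ℝ≥0) + 1 ≤ P) (T : ℝ) : ∃ C : ℝ≥0, ∀ w : (EuclideanSpace ℝ (Fin d)) → ℝ≥0∞, Measurable w →
      eLpNorm (conePotential D T w) (P / j) volume ≤ C * eLpNorm w (P / (j + 1)) volume := by
  have hP0 : 0 < P := lt_of_le_of_lt zero_le hdP
  have hj' : (j : ℝ) + 1 ≤ P := by exact_mod_cast hj
  have hdP' : (d : ℝ) < P := by exact_mod_cast hdP
  have hP0' : (0 : ℝ) < P := hP0
  have hA0 : (P / (j + 1) : ℝ≥0∞) ≠ 0 := by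
    rw [ne_eq, ENNReal.div_eq_zero_iff]
    push Not
    exact ⟨by exact_mod_cast hP0.ne', by finiteness⟩
  have hAt : (P / (j + 1) : ℝ≥0∞) ≠ ⊤ := by
    refine ENNReal.div_ne_top (by finiteness) (by positivity)
  have hAr : (P / (j + 1) : ℝ≥0∞).toReal = P / (j + 1) := by
    rw [ENNReal.toReal_div, ENNReal.toReal_add (by finiteness) (by finiteness)]
    simp
  -- For `j = 0` the target exponent `P / 0` is `⊤`.
  rcases Nat.eq_zero_or_pos j with rfl | hj0
  · obtain ⟨C, hC⟩ := exists_conePotential_le_const hD (by simpa using hj' : (1 : ℝ) ≤ P) hdP' T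
    refine ⟨C, fun w hw => ?_⟩
    rw [eLpNorm_eq_lintegral_rpow_enorm_toReal hA0 hAt, hAr]
    have : (P / ((0 : ℕ) : ℝ≥0∞)) = ⊤ := by
      rw [Nat.cast_zero, ENNReal.div_zero]
      exact_mod_cast hP0.ne'
    rw [this, eLpNorm_exponent_top]
    refine eLpNormEssSup_le_of_ae_enorm_bound (Filter.Eventually.of_forall fun y => ?_)
    simpa using hC w hw y
  · have hj0' : (0 : ℝ) < j := by exact_mod_cast hj0
    have h1 : (1 : ℝ) ≤ P / (j + 1) := by rw [one_le_div (by positivity)]; exact hj'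
    have h2 : (P : ℝ) / (j + 1) ≤ P / j := by gcongr; linarith
    have hb0 : (0 : ℝ) < P / j := by positivity
    -- The condition on the exponents reads `d * ((j + 1) / P - j / P) = d / P < 1`, the same for
    -- all `j`.
    obtain ⟨C, hC⟩ := exists_lintegral_conePotential_rpow_le hD h1 h2 (by
      rw [one_div_div, one_div_div, ← sub_div, add_sub_cancel_left, mul_one_div, div_lt_one hP0']
      exact hdP') T
    have hB0 : (P / j : ℝ≥0∞) ≠ 0 := by
      rw [ne_eq, ENNReal.div_eq_zero_iff]
      push Not
      exact ⟨by exact_mod_cast hP0.ne', by finiteness⟩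
    have hBt : (P / j : ℝ≥0∞) ≠ ⊤ := by
      refine ENNReal.div_ne_top (by finiteness) (by exact_mod_cast hj0.ne')
    have hBr : (P / j : ℝ≥0∞).toReal = P / j := by
      rw [ENNReal.toReal_div]
      simp
    refine ⟨C ^ (1 / ((P : ℝ) / j)), fun w hw => ?_⟩
    rw [eLpNorm_eq_lintegral_rpow_enorm_toReal hA0 hAt, eLpNorm_eq_lintegral_rpow_enorm_toReal hB0 hBt,
      hAr, hBr]
    simp only [enorm_eq_self]
    refine (rpow_le_rpow (hC w hw) (by positivity)).trans_eq ?_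
    rw [mul_rpow_of_nonneg _ _ (by positivity), ← rpow_mul,
      ENNReal.coe_rpow_of_nonneg _ (by positivity)]
    congr 2
    field_simp

end Potential

/-! ### Local Sobolev estimates in charts -/

section LocalSobolev

variable {d : ℕ}

/-- The fundamental theorem of calculus along `y + t • v`. Differentiability is required only for `0
< t < T`, so that `y` may be a boundary point. -/
lemma enorm_le_of_hasFDerivAt_segment {G : Type*} [NormedAddCommGroup G] [NormedSpace ℝ G]
    [CompleteSpace G] {L' : Set (EuclideanSpace ℝ (Fin d))} {h : EuclideanSpace ℝ (Fin d) → G}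
    {h' : EuclideanSpace ℝ (Fin d) → EuclideanSpace ℝ (Fin d) →L[ℝ] G}
    (hh : ContinuousOn h L') (hh' : ContinuousOn h' L') {y v : EuclideanSpace ℝ (Fin d)} {T R : ℝ}
    (hT : 0 ≤ T) (hR : ‖v‖ ≤ R) (hin : ∀ t ∈ Icc 0 T, y + t • v ∈ L')
    (hd : ∀ t ∈ Ioo 0 T, HasFDerivAt h (h' (y + t • v)) (y + t • v)) :
    ‖h y‖ₑ ≤ ‖h (y + T • v)‖ₑ + ENNReal.ofReal R * ∫⁻ t in Ioc 0 T, ‖h' (y + t • v)‖ₑ := by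
  have hc : ContinuousOn (fun t : ℝ => y + t • v) (Icc 0 T) := by fun_prop
  have hcont : ContinuousOn (fun t : ℝ => h (y + t • v)) (Icc 0 T) := hh.comp hc hin
  have hcont' : ContinuousOn (fun t : ℝ => h' (y + t • v) v) (Icc 0 T) :=
    (hh'.comp hc hin).clm_apply continuousOn_const
  have hftc := intervalIntegral.integral_eq_sub_of_hasDerivAt_of_le hT hcont (fun t ht => by
    have h2 : HasDerivAt (fun t : ℝ => y + t • v) v t := by
      simpa using ((hasDerivAt_id t).smul_const v).const_add y
    exact (hd t ht).comp_hasDerivAt t h2) (hcont'.intervalIntegrable_of_Icc hT)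
  simp only [zero_smul, add_zero] at hftc
  rw [intervalIntegral.integral_of_le hT] at hftc
  have h1 : h y = h (y + T • v) - ∫ t in Ioc 0 T, h' (y + t • v) v := by rw [hftc]; abel
  rw [h1]
  refine (enorm_sub_le (E := G)).trans ?_
  gcongr
  refine (enorm_integral_le_lintegral_enorm _).trans ?_
  rw [← lintegral_const_mul' _ _ ENNReal.ofReal_ne_top]
  refine lintegral_mono fun t => ?_
  refine (ContinuousLinearMap.le_opENorm _ _).trans ?_
  rw [mul_comm]
  gcongr
  rw [← ofReal_norm]
  exact ENNReal.ofReal_le_ofReal hR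

lemma ContinuousOn.measurable_indicator_enorm {G : Type*} [NormedAddCommGroup G]
    {L : Set (EuclideanSpace ℝ (Fin d))} (hL : MeasurableSet L) {h : EuclideanSpace ℝ (Fin d) → G}
    (hh : ContinuousOn h L) : Measurable (L.indicator fun y => ‖h y‖ₑ) := by
  classical
  exact ContinuousOn.measurable_piecewise hh.enorm continuousOn_const hL

lemma eLpNorm_indicator_enorm {G : Type*} [NormedAddCommGroup G]
    {L : Set (EuclideanSpace ℝ (Fin d))} (hL : MeasurableSet L) (h : EuclideanSpace ℝ (Fin d) → G)
    (q : ENNReal) :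
    eLpNorm (L.indicator fun y => ‖h y‖ₑ) q volume = eLpNorm h q (volume.restrict L) := by
  rw [← eLpNorm_indicator_eq_eLpNorm_restrict hL]
  refine eLpNorm_congr_enorm_ae (Filter.Eventually.of_forall fun y => ?_)
  by_cases hy : y ∈ L <;> simp [hy]

/-- A function of which the derivative is in `L^(P / (j + 1))`, `P > d`, is in `L^(P / j)` on
smaller sets. -/
theorem exists_eLpNorm_le_of_cone (G : Type*) [NormedAddCommGroup G] [NormedSpace ℝ G]
    [CompleteSpace G] {D L L' : Set (EuclideanSpace ℝ (Fin d))} (hDm : MeasurableSet D)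
    (hD0 : volume D ≠ 0) (hDt : volume D ≠ ⊤) {R : ℝ} (hR : ∀ v ∈ D, ‖v‖ ≤ R)
    (hLm : MeasurableSet L) (hLt : volume L ≠ ⊤) (hLm' : MeasurableSet L') {T : ℝ} (hT : 0 < T)
    (hin : ∀ y ∈ L, ∀ v ∈ D, ∀ t ∈ Icc 0 T, y + t • v ∈ L')
    {P : ℝ≥0} (hdP : (d : ℝ≥0) < P) (j : ℕ) (hj : (j : ℝ≥0) + 1 ≤ P) :
    ∃ C : ℝ≥0, ∀ (h : EuclideanSpace ℝ (Fin d) → G)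
      (h' : EuclideanSpace ℝ (Fin d) → EuclideanSpace ℝ (Fin d) →L[ℝ] G),
      ContinuousOn h L' → ContinuousOn h' L' →
      (∀ y ∈ L, ∀ v ∈ D, ∀ t ∈ Ioo 0 T, HasFDerivAt h (h' (y + t • v)) (y + t • v)) →
      eLpNorm h (P / j) (volume.restrict L) ≤ C * (eLpNorm h 1 (volume.restrict L') +
        eLpNorm h' (P / (j + 1)) (volume.restrict L')) := by
  obtain ⟨C, hC⟩ := exists_eLpNorm_conePotential_le hDt hdP j hj T
  set b : ENNReal := P / j with hb
  have hb1 : 1 ≤ b := by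
    rw [hb]
    rcases Nat.eq_zero_or_pos j with rfl | hj0
    · rw [Nat.cast_zero, ENNReal.div_zero]
      · exact le_top
      · exact_mod_cast (lt_of_le_of_lt zero_le hdP).ne'
    · rw [ENNReal.le_div_iff_mul_le (Or.inl (by exact_mod_cast hj0.ne')) (Or.inl (by finiteness)),
        one_mul]
      exact_mod_cast (le_add_of_nonneg_right zero_le_one).trans hj
  set τ := ENNReal.ofReal (T ^ (-(d : ℝ)))
  set κ : ENNReal := volume L ^ (1 / b.toReal)
  have hκ : κ ≠ ⊤ := ENNReal.rpow_ne_top_of_nonneg (by positivity) hLt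
  set V := (volume D)⁻¹
  have hV : V ≠ ⊤ := ENNReal.inv_ne_top.2 hD0
  have hK : V * (τ * κ + ENNReal.ofReal R * C) ≠ ⊤ := by finiteness
  refine ⟨(V * (τ * κ + ENNReal.ofReal R * C)).toNNReal, fun h h' hh hh' hd => ?_⟩
  rw [ENNReal.coe_toNNReal hK]
  set u : EuclideanSpace ℝ (Fin d) → ENNReal := L'.indicator fun y => ‖h y‖ₑ with hu
  set w : EuclideanSpace ℝ (Fin d) → ENNReal := L'.indicator fun y => ‖h' y‖ₑ with hw
  have hum : Measurable u := hh.measurable_indicator_enorm hLm'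
  have hwm : Measurable w := hh'.measurable_indicator_enorm hLm'
  -- Average the segment estimate over the directions `v ∈ D`: the end points contribute a multiple
  -- of the `L^1` norm of `h`, the integrals a cone potential of `h'`.
  have hpt : ∀ y ∈ L, ‖h y‖ₑ ≤
      V * (τ * eLpNorm h 1 (volume.restrict L') + ENNReal.ofReal R * conePotential D T w y) := by
    intro y hy
    have h1 : ∀ v ∈ D, ‖h y‖ₑ ≤ u (y + T • v) +
        ENNReal.ofReal R * ∫⁻ t in Ioc 0 T, w (y + t • v) := by
      intro v hv
      have h2 := enorm_le_of_hasFDerivAt_segment hh hh' hT.le (hR v hv) (hin y hy v hv) (hd y hy v hv)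
      refine h2.trans_eq ?_
      rw [hu, indicator_of_mem (hin y hy v hv T ⟨hT.le, le_rfl⟩)]
      congr 2
      refine setLIntegral_congr_fun measurableSet_Ioc fun t ht => ?_
      simp only [hw]
      rw [indicator_of_mem (hin y hy v hv t ⟨ht.1.le, ht.2⟩)]
    have hjm : Measurable (Function.uncurry fun (v : EuclideanSpace ℝ (Fin d)) (t : ℝ) =>
        w (y + t • v)) := hwm.comp (by fun_prop :
          Measurable fun p : EuclideanSpace ℝ (Fin d) × ℝ => y + p.2 • p.1)
    have h3 : volume D * ‖h y‖ₑ ≤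
        τ * eLpNorm h 1 (volume.restrict L') + ENNReal.ofReal R * conePotential D T w y := by
      calc volume D * ‖h y‖ₑ = ∫⁻ _ in D, ‖h y‖ₑ := by rw [setLIntegral_const, mul_comm]
        _ ≤ ∫⁻ v in D, (u (y + T • v) + ENNReal.ofReal R * ∫⁻ t in Ioc 0 T, w (y + t • v)) :=
          setLIntegral_mono' hDm h1
        _ = (∫⁻ v in D, u (y + T • v)) +
            ENNReal.ofReal R * ∫⁻ v in D, ∫⁻ t in Ioc 0 T, w (y + t • v) := by
          have hm1 : Measurable fun v => u (y + T • v) := hum.comp (by fun_prop)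
          rw [lintegral_add_left hm1, lintegral_const_mul' _ _ ENNReal.ofReal_ne_top]
        _ ≤ _ := by
          gcongr ?_ + _ * ?_
          · refine (setLIntegral_le_lintegral _ _).trans ?_
            rw [lintegral_comp_add_smul u hum y hT, hu, lintegral_indicator hLm',
              eLpNorm_one_eq_lintegral_enorm]
          · rw [lintegral_lintegral_swap hjm.aemeasurable]
            rfl
    calc ‖h y‖ₑ = V * (volume D * ‖h y‖ₑ) := by
          rw [← mul_assoc, ENNReal.inv_mul_cancel hD0 hDt, one_mul]
      _ ≤ _ := by gcongr
  set N := eLpNorm h 1 (volume.restrict L')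
  set N' := eLpNorm h' (P / (j + 1)) (volume.restrict L')
  have hwN : eLpNorm w (P / (j + 1)) volume = N' :=
    eLpNorm_indicator_enorm hLm' h' _
  have hcm := measurable_conePotential (D := D) hwm T
  have h4 : eLpNorm h b (volume.restrict L) ≤
      eLpNorm ((fun _ => V * (τ * N)) + fun y => V * ENNReal.ofReal R * conePotential D T w y) b
        (volume.restrict L) := by
    refine eLpNorm_mono_enorm_ae ((ae_restrict_iff' hLm).2 (Filter.Eventually.of_forall fun y hy => ?_))
    refine (hpt y hy).trans_eq ?_
    simp only [Pi.add_apply, enorm_eq_self]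
    ring
  refine h4.trans ((eLpNorm_add_le (by fun_prop)
    (hcm.const_mul _).aestronglyMeasurable hb1).trans ?_)
  have h5 : eLpNorm (fun _ : EuclideanSpace ℝ (Fin d) => V * (τ * N)) b (volume.restrict L) ≤
      V * (τ * N) * κ := by
    rcases eq_or_ne (volume.restrict L) 0 with h0 | h0
    · rw [h0]; simp
    · rw [eLpNorm_const _ (by positivity) h0, enorm_eq_self, Measure.restrict_apply_univ]
  have h6 : eLpNorm (fun y => V * ENNReal.ofReal R * conePotential D T w y) b (volume.restrict L) ≤
      V * ENNReal.ofReal R * (C * N') := by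
    refine (eLpNorm_le_mul_eLpNorm_of_ae_le_mul'' (c := V * ENNReal.ofReal R) (g := conePotential D T w)
      b (by fun_prop) (Filter.Eventually.of_forall fun y => ?_)).trans ?_
    · simp
    · refine mul_le_mul_right ?_ _
      refine (eLpNorm_mono_measure _ Measure.restrict_le_self).trans ?_
      rw [← hwN]
      exact hC w hwm
  refine (add_le_add h5 h6).trans ?_
  calc V * (τ * N) * κ + V * ENNReal.ofReal R * (C * N')
      = V * (τ * κ) * N + V * (ENNReal.ofReal R * C) * N' := by ring
    _ ≤ V * (τ * κ + ENNReal.ofReal R * C) * N + V * (τ * κ + ENNReal.ofReal R * C) * N' := by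
      gcongr
      · exact le_self_add
      · exact le_add_self
    _ = _ := by ring

/-! ### Cones of inward directions and the Sobolev embedding in a chart. -/

variable {H : Type*} [TopologicalSpace H] {I : ModelWithCorners ℝ (EuclideanSpace ℝ (Fin d)) H}

/-- A ball of directions that point from the boundary of `range I` into its interior. -/
lemma exists_ball_inward (hI : range I = univ ∨
      ∃ l : EuclideanSpace ℝ (Fin d) →L[ℝ] ℝ, l ≠ 0 ∧ range I = {v | 0 ≤ l v}) :
    ∃ (v₀ : EuclideanSpace ℝ (Fin d)) (r : ℝ), 0 < r ∧ ∀ y ∈ range I,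
      ∀ v ∈ Metric.closedBall v₀ r, ∀ t : ℝ, 0 < t → y + t • v ∈ interior (range I) := by
  rcases hI with hI | ⟨l, hl, hI⟩
  · exact ⟨0, 1, one_pos, fun y _ v _ t _ => by simp [hI]⟩
  · obtain ⟨x, hx⟩ : ∃ x, l x ≠ 0 := by
      by_contra! h
      exact hl (ContinuousLinearMap.ext h)
    -- Scaling `x` by `l x` fixes the sign: the value is `(l x)²`.
    have hpos : 0 < l (l x • x) := by
      rw [map_smul, smul_eq_mul]
      exact mul_self_pos.2 hx
    have hopen : IsOpen {v | 0 < l v} := isOpen_lt continuous_const l.continuous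
    obtain ⟨r, hr, hsub⟩ := Metric.nhds_basis_closedBall.mem_iff.1 (hopen.mem_nhds hpos)
    refine ⟨l x • x, r, hr, fun y hy v hv t ht => ?_⟩
    have h1 : {v | 0 < l v} ⊆ interior (range I) :=
      interior_maximal (fun v hv => by rw [hI]; exact (show 0 < l v from hv).le) hopen
    refine h1 ?_
    rw [hI] at hy
    have hy' : 0 ≤ l y := hy
    have hv' : 0 < l v := hsub hv
    change 0 < l (y + t • v)
    rw [map_add, map_smul, smul_eq_mul]
    positivity

variable {S : Type*} [TopologicalSpace S] [ChartedSpace H S] [IsManifold I ∞ S]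

lemma exists_image_extend_eq (e : OpenPartialHomeomorph S H) {U : Set S} (hU : IsOpen U)
    (hUe : U ⊆ e.source) : ∃ O : Set (EuclideanSpace ℝ (Fin d)), IsOpen O ∧
      e.extend I '' U = O ∩ range I := by
  refine ⟨I.symm ⁻¹' (e '' U), I.continuous_symm.isOpen_preimage _
    (e.isOpen_image_of_subset_source hU hUe), ?_⟩
  rw [OpenPartialHomeomorph.extend_coe, image_comp, I.image_eq]

/-- The image of `K` has positive distance from the complement of an open set that cuts out `U` in
the half-space; its closed `δ`-thickening, intersected with `range I`, contains all short inward
segments. -/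
lemma exists_compact_cone (e : OpenPartialHomeomorph S H) {U : Set S} (hU : IsOpen U)
    (hUe : U ⊆ e.source) {K : Set S} (hK : IsCompact K) (hKU : K ⊆ U)
    {v₀ : EuclideanSpace ℝ (Fin d)} {r : ℝ}
    (hin : ∀ y ∈ range I, ∀ v ∈ Metric.closedBall v₀ r, ∀ t : ℝ, 0 < t →
      y + t • v ∈ interior (range I)) :
    ∃ K', IsCompact K' ∧ K ⊆ K' ∧ K' ⊆ U ∧ ∃ T : ℝ, 0 < T ∧ ∀ y ∈ e.extend I '' K,
      ∀ v ∈ Metric.closedBall v₀ r, ∀ t ∈ Icc 0 T, y + t • v ∈ e.extend I '' K' := by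
  obtain ⟨O, hO, hOU⟩ := exists_image_extend_eq (I := I) e hU hUe
  have hL : IsCompact (e.extend I '' K) := isCompact_image_extend e hK (hKU.trans hUe)
  have hLO : e.extend I '' K ⊆ O := (image_mono hKU).trans (hOU ▸ inter_subset_left)
  obtain ⟨δ, hδ, hsub⟩ := hL.exists_cthickening_subset_open hO hLO
  set L' := Metric.cthickening δ (e.extend I '' K) ∩ range I
  have hL' : IsCompact L' := by
    refine (hL.cthickening).inter_right ?_
    exact I.isClosed_range
  have hL'U : L' ⊆ e.extend I '' U := hOU ▸ inter_subset_inter_left _ hsub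
  have hL't : L' ⊆ (e.extend I).target := hL'U.trans (image_extend_subset_target e hUe)
  have himg : e.extend I '' ((e.extend I).symm '' L') = L' := by
    rw [image_image]
    refine (image_congr fun y hy => (e.extend I).right_inv (hL't hy)).trans ?_
    simp
  refine ⟨(e.extend I).symm '' L', hL'.image_of_continuousOn
    ((e.continuousOn_extend_symm).mono hL't), ?_, ?_, ?_⟩
  · intro s hs
    exact ⟨e.extend I s, ⟨Metric.self_subset_cthickening _ ⟨s, hs, rfl⟩, by simp⟩,
      e.extend_left_inv (hUe (hKU hs))⟩
  · rintro _ ⟨y, hy, rfl⟩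
    obtain ⟨s, hs, rfl⟩ := hL'U hy
    rwa [e.extend_left_inv (hUe hs)]
  · refine ⟨δ / (‖v₀‖ + |r| + 1), by positivity, fun y hy v hv t ht => ?_⟩
    rw [himg]
    have hyr : y ∈ range I := by
      obtain ⟨s, -, rfl⟩ := hy
      simp
    refine ⟨Metric.mem_cthickening_of_dist_le _ y _ _ hy ?_, ?_⟩
    · rw [dist_eq_norm, add_sub_cancel_left, norm_smul, Real.norm_of_nonneg ht.1]
      have h1 : ‖v‖ ≤ ‖v₀‖ + |r| + 1 := by
        have h2 : ‖v - v₀‖ ≤ r := mem_closedBall_iff_norm.1 hv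
        have h3 := norm_le_norm_add_norm_sub v₀ v
        have h4 := norm_sub_rev v v₀
        have := le_abs_self r
        linarith
      calc t * ‖v‖ ≤ δ / (‖v₀‖ + |r| + 1) * (‖v₀‖ + |r| + 1) := by
            gcongr
            exact ht.2
        _ = δ := by field_simp
    · rcases ht.1.eq_or_lt with h0 | h0
      · rw [← h0]; simpa using hyr
      · exact interior_subset (hin y hyr v hv t h0)

variable (F : Type*) [NormedAddCommGroup F] [NormedSpace ℂ F] [CompleteSpace F]

lemma extend_target_mem_nhds (e : OpenPartialHomeomorph S H) {y : EuclideanSpace ℝ (Fin d)}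
    (hy : y ∈ (e.extend I).target) (hy' : y ∈ interior (range I)) : (e.extend I).target ∈ 𝓝 y := by
  rw [e.extend_target] at hy ⊢
  exact Filter.inter_mem ((e.open_target.preimage I.continuous_symm).mem_nhds hy.1)
    (mem_interior_iff_mem_nhds.1 hy')

/-- One step of the Sobolev embedding: the cone estimate for the `j`-th jet, whose derivative is the
`(j + 1)`-st jet up to currying. -/
theorem exists_eLpNorm_chartJet_le_succ (hI : range I = univ ∨
      ∃ l : EuclideanSpace ℝ (Fin d) →L[ℝ] ℝ, l ≠ 0 ∧ range I = {v | 0 ≤ l v})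
    {e : OpenPartialHomeomorph S H} (he : e ∈ IsManifold.maximalAtlas I ∞ S) {U : Set S}
    (hU : IsOpen U) (hUe : U ⊆ e.source) {K : Set S} (hK : IsCompact K) (hKU : K ⊆ U)
    {P : ℝ≥0} (hdP : (d : ℝ≥0) < P) (k j : ℕ) (hjP : (j : ℝ≥0) + 1 ≤ P) (hjk : j + 1 ≤ k) :
    ∃ K', IsCompact K' ∧ K ⊆ K' ∧ K' ⊆ U ∧ ∃ C : ℝ≥0, ∀ f : S → F, ContMDiff I 𝓘(ℝ, F) k f →
      eLpNorm (chartJet I e j f) (P / j) (volume.restrict (e.extend I '' K)) ≤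
        C * (eLpNorm (chartJet I e j f) 1 (volume.restrict (e.extend I '' K')) +
          eLpNorm (chartJet I e (j + 1) f) (P / (j + 1)) (volume.restrict (e.extend I '' K'))) := by
  obtain ⟨v₀, r, hr, hin⟩ := exists_ball_inward hI
  obtain ⟨K', hK', hKK', hK'U, T, hT, hcone⟩ := exists_compact_cone e hU hUe hK hKU hin
  have hL := isCompact_image_extend (I := I) e hK (hKU.trans hUe)
  have hL' := isCompact_image_extend (I := I) e hK' (hK'U.trans hUe)
  have hDR : ∀ v ∈ Metric.closedBall v₀ r, ‖v‖ ≤ ‖v₀‖ + r := fun v hv => by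
    have h2 : ‖v - v₀‖ ≤ r := mem_closedBall_iff_norm.1 hv
    have h3 := norm_le_norm_add_norm_sub v₀ v
    have h4 := norm_sub_rev v v₀
    linarith
  obtain ⟨C, hC⟩ := exists_eLpNorm_le_of_cone
    (ContinuousMultilinearMap ℝ (fun _ : Fin j => EuclideanSpace ℝ (Fin d)) F)
    Metric.isClosed_closedBall.measurableSet
    (Metric.measure_closedBall_pos volume v₀ hr).ne' measure_closedBall_lt_top.ne hDR
    hL.measurableSet hL.measure_lt_top.ne hL'.measurableSet hT hcone hdP j hjP
  refine ⟨K', hK', hKK', hK'U, C, fun f hf => ?_⟩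
  have hsub : e.extend I '' K' ⊆ (e.extend I).target :=
    image_extend_subset_target e (hK'U.trans hUe)
  have hcd := contDiffOn_comp_extend_symm he hf
  have hu : UniqueDiffOn ℝ (e.extend I).target := uniqueDiffOn_chartTarget e
  have hdiff : DifferentiableOn ℝ (chartJet I e j f) (e.extend I).target :=
    hcd.differentiableOn_iteratedFDerivWithin (by exact_mod_cast hjk) hu
  have hnorm : ∀ y, ‖fderivWithin ℝ (chartJet I e j f) (e.extend I).target y‖ =
      ‖chartJet I e (j + 1) f y‖ := fun y => norm_fderivWithin_iteratedFDerivWithin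
  have hfc : ContinuousOn (fderivWithin ℝ (chartJet I e j f) (e.extend I).target)
      (e.extend I).target := by
    have h1 := continuousOn_chartJet he hjk hf
    have h2 : fderivWithin ℝ (chartJet I e j f) (e.extend I).target =
        (continuousMultilinearCurryLeftEquiv ℝ (fun _ : Fin (j + 1) => EuclideanSpace ℝ (Fin d)) F) ∘
          chartJet I e (j + 1) f := by
      funext y
      simp only [Function.comp_apply, chartJet]
      rw [iteratedFDerivWithin_succ_eq_comp_left, Function.comp_apply,
        LinearIsometryEquiv.apply_symm_apply]
      rfl
    rw [h2]
    exact (LinearIsometryEquiv.continuous _).comp_continuousOn h1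
  have h := hC (chartJet I e j f) (fderivWithin ℝ (chartJet I e j f) (e.extend I).target)
    ((continuousOn_chartJet he (by omega) hf).mono hsub) (hfc.mono hsub) (fun y hy v hv t ht => by
      have hz := hsub (hcone y hy v hv t ⟨ht.1.le, ht.2.le⟩)
      have hyr : y ∈ range I := by
        obtain ⟨s, -, rfl⟩ := hy
        simp
      -- For `t > 0` the point `y + t • v` is interior, so the derivative within the target is an
      -- ordinary derivative.
      exact (hdiff _ hz).hasFDerivWithinAt.hasFDerivAt
        (extend_target_mem_nhds e hz (hin y hyr v hv t ht.1)))
  refine h.trans_eq ?_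
  congr 2
  exact eLpNorm_congr_norm_ae (Filter.Eventually.of_forall hnorm)

/-- Sobolev estimate: the derivatives of order `j ≤ k` are in `L^(P / j)` if those of order `≤ k`
are in `L^(P / k)`, `P > d`. -/
theorem exists_eLpNorm_chartJet_le_sum (hI : range I = univ ∨
      ∃ l : EuclideanSpace ℝ (Fin d) →L[ℝ] ℝ, l ≠ 0 ∧ range I = {v | 0 ≤ l v})
    {e : OpenPartialHomeomorph S H} (he : e ∈ IsManifold.maximalAtlas I ∞ S) {U : Set S}
    (hU : IsOpen U) (hUe : U ⊆ e.source) {k : ℕ} {p : ℝ≥0} (hk : 1 ≤ k) (hp : 1 ≤ p)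
    (hdP : (d : ℝ≥0) < k * p) {j : ℕ} (hj : j ≤ k) :
    ∀ {K : Set S}, IsCompact K → K ⊆ U →
    ∃ K', IsCompact K' ∧ K' ⊆ U ∧ ∃ C : ℝ≥0, ∀ f : S → F, ContMDiff I 𝓘(ℝ, F) k f →
      eLpNorm (chartJet I e j f) ((k * p : ℝ≥0) / j) (volume.restrict (e.extend I '' K)) ≤
        C * ∑ l ∈ Finset.range (k + 1),
          eLpNorm (chartJet I e l f) p (volume.restrict (e.extend I '' K')) := by
  -- Start at `j = k`, where `k p / k = p`, and go down. Each step enlarges the compact set slightly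
  -- inside `U`.
  induction hj using Nat.decreasingInduction with
  | self =>
    intro K hK hKU
    refine ⟨K, hK, hKU, 1, fun f hf => ?_⟩
    have : ((k * p : ℝ≥0) : ENNReal) / k = p := by
      push_cast
      rw [mul_comm]
      exact ENNReal.mul_div_cancel_right (by exact_mod_cast (by omega : k ≠ 0)) (by finiteness)
    rw [this, ENNReal.coe_one, one_mul]
    exact Finset.single_le_sum (f := fun l =>
      eLpNorm (chartJet I e l f) p (volume.restrict (e.extend I '' K))) (fun _ _ => zero_le)
      (Finset.self_mem_range_succ k)
  | of_succ j hj ih =>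
    intro K hK hKU
    have hjP : (j : ℝ≥0) + 1 ≤ k * p := by
      calc (j : ℝ≥0) + 1 ≤ k := by exact_mod_cast hj
        _ ≤ k * p := le_mul_of_one_le_right zero_le hp
    obtain ⟨K₁, hK₁, -, hK₁U, C₁, hC₁⟩ :=
      exists_eLpNorm_chartJet_le_succ F hI he hU hUe hK hKU hdP k j hjP hj
    obtain ⟨K₂, hK₂, hK₂U, C₂, hC₂⟩ := ih hK₁ hK₁U
    have hL₁ := isCompact_image_extend (I := I) e hK₁ (hK₁U.trans hUe)
    -- The constant of the embedding `L^p ⊆ L^1` on the compact set, which handles the `L^1` term of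
    -- the cone estimate.
    set c : ENNReal := volume (e.extend I '' K₁) ^ (1 / (1 : ENNReal).toReal - 1 / (p : ENNReal).toReal)
    have hc : c ≠ ⊤ := by
      refine ENNReal.rpow_ne_top_of_nonneg ?_ hL₁.measure_lt_top.ne
      rw [ENNReal.toReal_one, ENNReal.coe_toReal, one_div_one, sub_nonneg, div_le_one (by positivity)]
      exact_mod_cast hp
    refine ⟨K₁ ∪ K₂, hK₁.union hK₂, union_subset hK₁U hK₂U, C₁ * (c.toNNReal + C₂), fun f hf => ?_⟩
    have hmono : ∀ l, ∀ K' ⊆ K₁ ∪ K₂, eLpNorm (chartJet I e l f) p (volume.restrict (e.extend I '' K')) ≤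
        eLpNorm (chartJet I e l f) p (volume.restrict (e.extend I '' (K₁ ∪ K₂))) := fun l K' hK' =>
      eLpNorm_mono_measure _ (Measure.restrict_mono (image_mono hK') le_rfl)
    refine (hC₁ f hf).trans ?_
    push_cast
    rw [mul_assoc]
    gcongr
    rw [add_mul, ENNReal.coe_toNNReal hc]
    gcongr
    · have h1 := eLpNorm_le_eLpNorm_mul_rpow_measure_univ (p := 1) (q := p)
        (by exact_mod_cast hp) (aestronglyMeasurable_chartJet he (by omega : j ≤ k) hf hK₁
          (hK₁U.trans hUe))
      rw [Measure.restrict_apply_univ] at h1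
      refine h1.trans ?_
      rw [mul_comm]
      gcongr
      refine (hmono j K₁ subset_union_left).trans ?_
      exact Finset.single_le_sum (f := fun l =>
        eLpNorm (chartJet I e l f) p (volume.restrict (e.extend I '' (K₁ ∪ K₂)))) (fun _ _ => zero_le)
        (Finset.mem_range.2 (by omega))
    · have h2 := hC₂ f hf
      push_cast at h2
      refine h2.trans ?_
      gcongr with l hl
      exact subset_union_right

end LocalSobolev

/-! ### Classical derivatives are weak derivatives -/

section CoordDeriv

variable {d : ℕ} {F : Type*} [NormedAddCommGroup F] [NormedSpace ℂ F]

/-- The partial derivative `∂_{J 0} ⋯ ∂_{J (j-1)} u` of a vector valued function. -/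
def coordDeriv {j : ℕ} (J : Fin j → Fin d) (u : EuclideanSpace ℝ (Fin d) → F)
    (y : EuclideanSpace ℝ (Fin d)) : F :=
  iteratedFDeriv ℝ j u y (fun l => EuclideanSpace.single (J l) (1 : ℝ))

lemma norm_coordDeriv_le {j : ℕ} (J : Fin j → Fin d) (u : EuclideanSpace ℝ (Fin d) → F)
    (y : EuclideanSpace ℝ (Fin d)) : ‖coordDeriv J u y‖ ≤ ‖iteratedFDeriv ℝ j u y‖ := by
  refine (ContinuousMultilinearMap.le_opNorm _ _).trans_eq ?_
  simp

lemma ContinuousMultilinearMap.norm_le_sum_single {j : ℕ}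
    (f : ContinuousMultilinearMap ℝ (fun _ : Fin j => EuclideanSpace ℝ (Fin d)) F) :
    ‖f‖ ≤ ∑ J : Fin j → Fin d, ‖f fun l => EuclideanSpace.single (J l) (1 : ℝ)‖ := by
  refine f.opNorm_le_bound (Finset.sum_nonneg fun _ _ => norm_nonneg _) fun m => ?_
  have hm : m = fun i => ∑ a : Fin d, m i a • EuclideanSpace.single a (1 : ℝ) := by
    funext i
    ext a
    simp [Finset.sum_apply, Pi.single_apply]
  conv_lhs => rw [hm, f.map_sum]
  refine (norm_sum_le _ _).trans ?_
  rw [Finset.sum_mul]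
  refine Finset.sum_le_sum fun J _ => ?_
  rw [f.map_smul_univ (fun i => m i (J i)) (fun i => EuclideanSpace.single (J i) (1 : ℝ)), norm_smul,
    mul_comm, norm_prod]
  gcongr with i
  exact PiLp.norm_apply_le _ _

lemma norm_iteratedFDeriv_le_sum_coordDeriv_rev {j : ℕ} (u : EuclideanSpace ℝ (Fin d) → F)
    (y : EuclideanSpace ℝ (Fin d)) :
    ‖iteratedFDeriv ℝ j u y‖ ≤ ∑ J : Fin j → Fin d, ‖coordDeriv (J ∘ Fin.rev) u y‖ := by
  refine (ContinuousMultilinearMap.norm_le_sum_single _).trans_eq ?_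
  exact (Equiv.sum_comp (Equiv.arrowCongr Fin.revPerm (Equiv.refl (Fin d)))
    (fun J => ‖coordDeriv J u y‖)).symm

lemma norm_iteratedFDeriv_le_sum_coordDeriv {j : ℕ} (u : EuclideanSpace ℝ (Fin d) → F)
    (y : EuclideanSpace ℝ (Fin d)) :
    ‖iteratedFDeriv ℝ j u y‖ ≤ ∑ J : Fin j → Fin d, ‖coordDeriv J u y‖ :=
  ContinuousMultilinearMap.norm_le_sum_single _

lemma coordDeriv_succ {j : ℕ} (J : Fin (j + 1) → Fin d) {u : EuclideanSpace ℝ (Fin d) → F}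
    {y : EuclideanSpace ℝ (Fin d)} (hu : ContDiffAt ℝ (j + 1 : ℕ) u y) :
    coordDeriv J u y =
      fderiv ℝ (coordDeriv (Fin.tail J) u) y (EuclideanSpace.single (J 0) (1 : ℝ)) :=
  (hu.differentiableAt_iteratedFDeriv (by exact_mod_cast Nat.lt_succ_self j)).iteratedFDeriv_succ_apply_left'

lemma coordDeriv_succ_right {j : ℕ} (J : Fin (j + 1) → Fin d) {u : EuclideanSpace ℝ (Fin d) → F}
    {y : EuclideanSpace ℝ (Fin d)} (hu : ContDiffAt ℝ (j + 1 : ℕ) u y) :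
    coordDeriv J u y = coordDeriv (Fin.init J)
      (fun z => fderiv ℝ u z (EuclideanSpace.single (J (Fin.last j)) (1 : ℝ))) y := by
  rw [coordDeriv, iteratedFDeriv_succ_apply_right]
  have h1 : ContDiffAt ℝ j (fderiv ℝ u) y := hu.fderiv_right (by exact_mod_cast le_rfl)
  have h2 := (ContinuousLinearMap.apply ℝ F
    (EuclideanSpace.single (J (Fin.last j)) (1 : ℝ))).iteratedFDeriv_comp_left h1 (i := j) le_rfl
  rw [coordDeriv]
  exact (congrArg (fun f => f fun l => EuclideanSpace.single (Fin.init J l) (1 : ℝ)) h2).symm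

lemma ContDiffOn.contDiffOn_fderiv_apply {V : Set (EuclideanSpace ℝ (Fin d))} (hV : IsOpen V)
    {u : EuclideanSpace ℝ (Fin d) → F} {j : ℕ} (hu : ContDiffOn ℝ (j + 1 : ℕ) u V)
    (v : EuclideanSpace ℝ (Fin d)) : ContDiffOn ℝ j (fun z => fderiv ℝ u z v) V :=
  (hu.fderiv_of_isOpen hV (by exact_mod_cast le_rfl)).clm_apply contDiffOn_const

lemma continuousOn_coordDeriv {V : Set (EuclideanSpace ℝ (Fin d))} (hV : IsOpen V)
    {u : EuclideanSpace ℝ (Fin d) → F} {k j : ℕ} (hj : j ≤ k) (hu : ContDiffOn ℝ k u V)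
    (J : Fin j → Fin d) : ContinuousOn (coordDeriv J u) V := by
  have h1 : ContinuousOn (iteratedFDeriv ℝ j u) V :=
    (hu.continuousOn_iteratedFDerivWithin (by exact_mod_cast hj) hV.uniqueDiffOn).congr
      fun y hy => (iteratedFDerivWithin_of_isOpen j hV hy).symm
  exact (ContinuousMultilinearMap.apply ℝ (fun _ : Fin j => EuclideanSpace ℝ (Fin d)) F
    fun l => EuclideanSpace.single (J l) (1 : ℝ)).continuous.comp_continuousOn h1

/-- Integration by parts moves the outermost derivative of `φ` onto `u`, where it becomes the
innermost one. Hence the reversed multi-index; symmetry of mixed derivatives is never used. -/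
lemma integral_coordDeriv_smul {V : Set (EuclideanSpace ℝ (Fin d))} (hV : IsOpen V) :
    ∀ {j : ℕ} {u : EuclideanSpace ℝ (Fin d) → F}, ContDiffOn ℝ j u V → ∀ (J : Fin j → Fin d)
      (φ : EuclideanSpace ℝ (Fin d) → ℝ), ContDiff ℝ ∞ φ → HasCompactSupport φ → tsupport φ ⊆ V →
      ∫ y, partialDeriv J φ y • u y = (-1 : ℝ) ^ j • ∫ y, φ y • coordDeriv (J ∘ Fin.rev) u y := by
  intro j
  induction j with
  | zero =>
    intro u _ J φ _ _ _
    simp [partialDeriv, coordDeriv]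
  | succ j ih =>
    intro u hu J φ hφ hc hφV
    set v : EuclideanSpace ℝ (Fin d) := EuclideanSpace.single (J 0) (1 : ℝ)
    set ψ := partialDeriv (Fin.tail J) φ
    have hψ : ContDiff ℝ 1 ψ := by
      have h1 : ContDiff ℝ 1 (iteratedFDeriv ℝ j φ) :=
        hφ.iteratedFDeriv_right (by exact_mod_cast le_top)
      exact (ContinuousMultilinearMap.apply ℝ (fun _ : Fin j => EuclideanSpace ℝ (Fin d)) ℝ
        fun l => EuclideanSpace.single (Fin.tail J l) (1 : ℝ)).contDiff.comp h1
    have hψV : tsupport ψ ⊆ V := (tsupport_partialDeriv_subset _ φ).trans hφV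
    have hψc : HasCompactSupport ψ :=
      hc.of_isClosed_subset (isClosed_tsupport _) (tsupport_partialDeriv_subset _ φ)
    have hJφ : partialDeriv J φ = fun y => fderiv ℝ ψ y v := by
      funext y
      have h := hφ.contDiffAt (x := y)
      exact (h.of_le (by exact_mod_cast le_top : ((j + 1 : ℕ) : WithTop ℕ∞) ≤ ∞)
        |>.differentiableAt_iteratedFDeriv
          (by exact_mod_cast Nat.lt_succ_self j)).iteratedFDeriv_succ_apply_left'
    have hu1 : ContDiffOn ℝ 1 u V := hu.of_le (by exact_mod_cast Nat.le_add_left 1 j)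
    have hu' := hu.contDiffOn_fderiv_apply hV v
    have hud : ∀ y ∈ V, DifferentiableAt ℝ u y := fun y hy =>
      (hu1.differentiableOn one_ne_zero).differentiableAt (hV.mem_nhds hy)
    have hdψ : Continuous fun y => fderiv ℝ ψ y v :=
      (hψ.continuous_fderiv one_ne_zero).clm_apply continuous_const
    have hsub : tsupport (fun y => fderiv ℝ ψ y v) ⊆ tsupport ψ := tsupport_fderiv_apply_subset ℝ v
    have hibp := integral_bilinear_hasLineDerivAt_right_eq_neg_left_of_integrable
      (μ := (volume : Measure (EuclideanSpace ℝ (Fin d)))) (f := ψ) (f' := fun y => fderiv ℝ ψ y v)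
      (g := u) (g' := fun y => fderiv ℝ u y v) (v := v) (B := ContinuousLinearMap.lsmul ℝ ℝ)
      (integrable_test_smul hdψ (hψc.of_isClosed_subset (isClosed_tsupport _) hsub)
        (hsub.trans hψV) (hu1.continuousOn.locallyIntegrableOn hV.measurableSet))
      (integrable_test_smul hψ.continuous hψc hψV
        (hu'.continuousOn.locallyIntegrableOn hV.measurableSet))
      (integrable_test_smul hψ.continuous hψc hψV
        (hu1.continuousOn.locallyIntegrableOn hV.measurableSet))
      (fun y _ => ((hψ.differentiable one_ne_zero) y).hasFDerivAt.hasLineDerivAt v)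
      (fun y hy => (hud y (hψV hy)).hasFDerivAt.hasLineDerivAt v)
    simp only [ContinuousLinearMap.lsmul_apply] at hibp
    rw [hJφ, ← neg_eq_iff_eq_neg.2 hibp, ih hu' (Fin.tail J) φ hφ hc hφV, pow_succ, mul_neg_one,
      neg_smul]
    congr 2
    refine integral_congr_ae (Filter.Eventually.of_forall fun y => ?_)
    by_cases hy : y ∈ V
    · have h := coordDeriv_succ_right (J ∘ Fin.rev) (hu.contDiffAt (hV.mem_nhds hy))
      have h1 : (J ∘ Fin.rev) (Fin.last j) = J 0 := by simp
      have h2 : Fin.init (J ∘ Fin.rev) = Fin.tail J ∘ Fin.rev := by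
        funext l
        simp [Fin.init, Fin.tail, Fin.rev_castSucc]
      rw [h1, h2] at h
      simp only [h]
      rfl
    · have : φ y = 0 := by
        by_contra h0
        exact hy (hφV (subset_tsupport φ h0))
      simp [this]

lemma isWeakDeriv_coordDeriv {V : Set (EuclideanSpace ℝ (Fin d))} (hV : IsOpen V) {k j : ℕ}
    (hj : j ≤ k) {u : EuclideanSpace ℝ (Fin d) → F} (hu : ContDiffOn ℝ k u V) (J : Fin j → Fin d) :
    IsWeakDeriv V J u (coordDeriv (J ∘ Fin.rev) u) :=
  ⟨hu.continuousOn.locallyIntegrableOn hV.measurableSet,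
    (continuousOn_coordDeriv hV hj hu _).locallyIntegrableOn hV.measurableSet,
    integral_coordDeriv_smul hV (hu.of_le (by exact_mod_cast hj)) J⟩

/-- The Sobolev norm of a `C^k` function is bounded by the norms of its derivatives. -/
lemma memSobolevOn_of_contDiffOn {V : Set (EuclideanSpace ℝ (Fin d))} (hV : IsOpen V) {k : ℕ}
    {p : ℝ≥0} {u : EuclideanSpace ℝ (Fin d) → F} (hu : ContDiffOn ℝ k u V)
    (hfin : ∀ j ≤ k, eLpNorm (iteratedFDeriv ℝ j u) p (volume.restrict V) ≠ ⊤) :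
    MemSobolevOn V k p u := by
  intro j hj J
  refine ⟨_, isWeakDeriv_coordDeriv hV hj hu J,
    (continuousOn_coordDeriv hV hj hu _).aestronglyMeasurable hV.measurableSet, ?_⟩
  exact (eLpNorm_mono fun y => norm_coordDeriv_le (J ∘ Fin.rev) u y).trans_lt (hfin j hj).lt_top

lemma eLpNorm_weakDeriv_le [CompleteSpace F] {V : Set (EuclideanSpace ℝ (Fin d))} (hV : IsOpen V)
    {k : ℕ} {p : ℝ≥0} {u : EuclideanSpace ℝ (Fin d) → F} (hu : ContDiffOn ℝ k u V) {j : ℕ}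
    (hj : j ≤ k) (J : Fin j → Fin d) :
    eLpNorm (weakDeriv V J u) p (volume.restrict V) ≤
      eLpNorm (iteratedFDeriv ℝ j u) p (volume.restrict V) := by
  have h := isWeakDeriv_coordDeriv hV hj hu J
  have h' : IsWeakDeriv V J u (weakDeriv V J u) := by
    have hex : ∃ g, IsWeakDeriv V J u g := ⟨_, h⟩
    rw [weakDeriv, dif_pos hex]
    exact hex.choose_spec
  rw [eLpNorm_congr_ae (h'.ae_eq hV h)]
  exact eLpNorm_mono fun y => norm_coordDeriv_le (J ∘ Fin.rev) u y

lemma eLpNorm_iteratedFDeriv_le_sum_weakDeriv [CompleteSpace F]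
    {V : Set (EuclideanSpace ℝ (Fin d))} (hV : IsOpen V)
    {k : ℕ} {p : ℝ≥0} (hp : 1 ≤ p) {u : EuclideanSpace ℝ (Fin d) → F} (hu : ContDiffOn ℝ k u V)
    {j : ℕ} (hj : j ≤ k) :
    eLpNorm (iteratedFDeriv ℝ j u) p (volume.restrict V) ≤
      ∑ J : Fin j → Fin d, eLpNorm (weakDeriv V J u) p (volume.restrict V) := by
  have h' : ∀ J : Fin j → Fin d, eLpNorm (weakDeriv V J u) p (volume.restrict V) =
      eLpNorm (coordDeriv (J ∘ Fin.rev) u) p (volume.restrict V) := fun J => by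
    have h := isWeakDeriv_coordDeriv hV hj hu J
    have h' : IsWeakDeriv V J u (weakDeriv V J u) := by
      have hex : ∃ g, IsWeakDeriv V J u g := ⟨_, h⟩
      rw [weakDeriv, dif_pos hex]
      exact hex.choose_spec
    rw [eLpNorm_congr_ae (h'.ae_eq hV h)]
  simp only [h']
  have h1 : eLpNorm (iteratedFDeriv ℝ j u) p (volume.restrict V) ≤
      eLpNorm (∑ J : Fin j → Fin d, fun y => ‖coordDeriv (J ∘ Fin.rev) u y‖) p
        (volume.restrict V) := by
    refine eLpNorm_mono_real fun y => ?_
    rw [Finset.sum_apply]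
    exact norm_iteratedFDeriv_le_sum_coordDeriv_rev u y
  refine h1.trans ((eLpNorm_sum_le (fun J _ => ?_) (by exact_mod_cast hp)).trans_eq ?_)
  · exact ((continuousOn_coordDeriv hV hj hu _).aestronglyMeasurable hV.measurableSet).norm
  · exact Finset.sum_congr rfl fun J _ => eLpNorm_norm _

end CoordDeriv

/-! ### Mollification -/

section Mollification

open Filter

variable {d : ℕ} {F : Type*} [NormedAddCommGroup F] [NormedSpace ℂ F]

/-- Nonnegative smooth functions with compact support and integral `1`. -/
structure IsMollifier (k : EuclideanSpace ℝ (Fin d) → ℝ) : Prop where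
  contDiff : ContDiff ℝ ∞ k
  nonneg : ∀ v, 0 ≤ k v
  integral_eq_one : ∫ v, k v = 1
  hasCompactSupport : HasCompactSupport k

/-- The kernels live on scaled copies of a ball that need not contain the origin. With a ball of
inward directions, averages at boundary points use values from the interior only. -/
lemma exists_mollifier_seq (v₀ : EuclideanSpace ℝ (Fin d)) {r : ℝ} (hr : 0 < r) :
    ∃ k : ℕ → EuclideanSpace ℝ (Fin d) → ℝ, ∀ n, IsMollifier (k n) ∧
      tsupport (k n) ⊆ (fun v => ((n : ℝ) + 1)⁻¹ • v) '' Metric.closedBall v₀ r := by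
  have hb : ∀ n : ℕ, 0 < ((n : ℝ) + 1)⁻¹ := fun n => by positivity
  let b : ∀ n : ℕ, ContDiffBump (((n : ℝ) + 1)⁻¹ • v₀) := fun n =>
    ⟨((n : ℝ) + 1)⁻¹ * r / 2, ((n : ℝ) + 1)⁻¹ * r, by have := hb n; positivity,
      by have := mul_pos (hb n) hr; linarith⟩
  refine ⟨fun n => (b n).normed volume, fun n => ⟨⟨(b n).contDiff_normed, (b n).nonneg_normed,
    (b n).integral_normed, (b n).hasCompactSupport_normed⟩, ?_⟩⟩
  rw [(b n).tsupport_normed_eq]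
  intro w hw
  have h0 : (n : ℝ) + 1 ≠ 0 := by positivity
  refine ⟨((n : ℝ) + 1) • w, ?_, by simp only [smul_smul, inv_mul_cancel₀ h0, one_smul]⟩
  have h1 : w = ((n : ℝ) + 1)⁻¹ • (((n : ℝ) + 1) • w) := by
    rw [smul_smul, inv_mul_cancel₀ h0, one_smul]
  rw [mem_closedBall_iff_norm] at hw ⊢
  rw [h1, ← smul_sub, norm_smul, Real.norm_of_nonneg (hb n).le] at hw
  exact le_of_mul_le_mul_left hw (hb n)

/-- The weighted average of translates of `g`. -/
def translationAverage (k : EuclideanSpace ℝ (Fin d) → ℝ) (g : EuclideanSpace ℝ (Fin d) → F)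
    (y : EuclideanSpace ℝ (Fin d)) : F :=
  ∫ v, k v • g (y + v)

lemma translationAverage_eq (k : EuclideanSpace ℝ (Fin d) → ℝ) (g : EuclideanSpace ℝ (Fin d) → F)
    (y : EuclideanSpace ℝ (Fin d)) : translationAverage k g y = ∫ w, k (w - y) • g w := by
  rw [translationAverage, ← integral_add_left_eq_self (fun w => k (w - y) • g w) y]
  simp

lemma translationAverage_eq_convolution (k : EuclideanSpace ℝ (Fin d) → ℝ)
    (g : EuclideanSpace ℝ (Fin d) → F) : translationAverage k g =
      convolution g (fun z => k (-z)) (ContinuousLinearMap.lsmul ℝ ℝ).flip volume := by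
  funext y
  rw [translationAverage_eq, convolution_def]
  simp

lemma ContDiff.partialDeriv {j : ℕ} (J : Fin j → Fin d) {φ : EuclideanSpace ℝ (Fin d) → ℝ}
    (hφ : ContDiff ℝ ∞ φ) : ContDiff ℝ ∞ (partialDeriv J φ) := by
  have h1 : ContDiff ℝ ∞ (iteratedFDeriv ℝ j φ) :=
    hφ.iteratedFDeriv_right (by exact_mod_cast le_top)
  exact (ContinuousMultilinearMap.apply ℝ (fun _ : Fin j => EuclideanSpace ℝ (Fin d)) ℝ
    fun l => EuclideanSpace.single (J l) (1 : ℝ)).contDiff.comp h1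

lemma partialDeriv_succ {j : ℕ} (J : Fin (j + 1) → Fin d) {φ : EuclideanSpace ℝ (Fin d) → ℝ}
    (hφ : ContDiff ℝ ∞ φ) (y : EuclideanSpace ℝ (Fin d)) : partialDeriv J φ y =
      fderiv ℝ (partialDeriv (Fin.tail J) φ) y (EuclideanSpace.single (J 0) (1 : ℝ)) :=
  (hφ.contDiffAt.of_le (by exact_mod_cast le_top : ((j + 1 : ℕ) : WithTop ℕ∞) ≤ ∞)
    |>.differentiableAt_iteratedFDeriv
      (by exact_mod_cast Nat.lt_succ_self j)).iteratedFDeriv_succ_apply_left'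

/-- All derivatives fall on the smooth kernel, one at a time. -/
lemma coordDeriv_convolution [CompleteSpace F] {g : EuclideanSpace ℝ (Fin d) → F}
    (hg : LocallyIntegrable g) {ψ : EuclideanSpace ℝ (Fin d) → ℝ} (hψ : ContDiff ℝ ∞ ψ)
    (hc : HasCompactSupport ψ) {j : ℕ} (J : Fin j → Fin d) :
    coordDeriv J (convolution g ψ (ContinuousLinearMap.lsmul ℝ ℝ).flip volume) =
      convolution g (partialDeriv J ψ) (ContinuousLinearMap.lsmul ℝ ℝ).flip volume := by
  induction j with
  | zero =>
    have : partialDeriv J ψ = ψ := by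
      funext y
      simp [partialDeriv]
    rw [this]
    funext y
    simp [coordDeriv]
  | succ j ih =>
    funext y
    have hsm : ContDiff ℝ ∞ (convolution g ψ (ContinuousLinearMap.lsmul ℝ ℝ).flip volume) :=
      hc.contDiff_convolution_right _ hg hψ
    have hcd : HasCompactSupport (partialDeriv (Fin.tail J) ψ) := hc.of_isClosed_subset (isClosed_tsupport _)
      (tsupport_partialDeriv_subset (Fin.tail J) ψ)
    have hd := (hψ.partialDeriv (Fin.tail J)).of_le (by exact_mod_cast le_top : (1 : WithTop ℕ∞) ≤ ∞)
    rw [coordDeriv_succ J (hsm.contDiffAt.of_le (by exact_mod_cast le_top)), ih,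
      (hcd.hasFDerivAt_convolution_right _ hg hd y).fderiv,
      convolution_precompR_apply _ hg (hcd.fderiv ℝ) (hd.continuous_fderiv one_ne_zero)]
    congr 1
    funext z
    exact (partialDeriv_succ J hψ z).symm

lemma partialDeriv_comp_neg {j : ℕ} (J : Fin j → Fin d) {φ : EuclideanSpace ℝ (Fin d) → ℝ}
    (hφ : ContDiff ℝ ∞ φ) (y : EuclideanSpace ℝ (Fin d)) :
    partialDeriv J (fun z => φ (-z)) y = (-1 : ℝ) ^ j * partialDeriv J φ (-y) := by
  have h := iteratedFDeriv_comp_const_smul (i := j) (-1 : ℝ)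
    (hφ.of_le (by exact_mod_cast le_top : (j : WithTop ℕ∞) ≤ ∞))
  simp only [neg_smul, one_smul] at h
  rw [partialDeriv, h]
  rfl

lemma partialDeriv_comp_sub {j : ℕ} (J : Fin j → Fin d) (φ : EuclideanSpace ℝ (Fin d) → ℝ)
    (y w : EuclideanSpace ℝ (Fin d)) :
    partialDeriv J (fun z => φ (z - y)) w = partialDeriv J φ (w - y) := by
  rw [partialDeriv, iteratedFDeriv_comp_sub]
  rfl

lemma IsMollifier.contDiff_translationAverage [CompleteSpace F] {k : EuclideanSpace ℝ (Fin d) → ℝ}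
    (hk : IsMollifier k) {g : EuclideanSpace ℝ (Fin d) → F} (hg : LocallyIntegrable g) :
    ContDiff ℝ ∞ (translationAverage k g) := by
  rw [translationAverage_eq_convolution]
  exact (hk.hasCompactSupport.comp_homeomorph (Homeomorph.neg _)).contDiff_convolution_right _ hg
    (hk.contDiff.comp contDiff_neg)

lemma tsupport_comp_sub (k : EuclideanSpace ℝ (Fin d) → ℝ) (y : EuclideanSpace ℝ (Fin d)) :
    tsupport (fun w => k (w - y)) = (fun v => y + v) '' tsupport k := by
  have h := tsupport_comp_eq_preimage k (Homeomorph.subRight y)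
  have h2 : (k ∘ Homeomorph.subRight y) = fun w => k (w - y) := rfl
  rw [h2] at h
  rw [h]
  ext w
  simp only [mem_preimage, Homeomorph.subRight_apply, mem_image]
  constructor
  · intro hw
    exact ⟨w - y, hw, by abel⟩
  · rintro ⟨v, hv, rfl⟩
    simpa using hv

/-- The derivatives of averages are averages of the weak derivatives. -/
lemma IsMollifier.coordDeriv_translationAverage [CompleteSpace F]
    {k : EuclideanSpace ℝ (Fin d) → ℝ} (hk : IsMollifier k)
    {V : Set (EuclideanSpace ℝ (Fin d))} {j : ℕ} {J : Fin j → Fin d}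
    {u u' g : EuclideanSpace ℝ (Fin d) → F} (hg : IsWeakDeriv V J u g) (hu' : LocallyIntegrable u')
    {y : EuclideanSpace ℝ (Fin d)} (hy : ∀ v ∈ tsupport k, y + v ∈ V ∧ u' (y + v) = u (y + v)) :
    coordDeriv J (translationAverage k u') y = translationAverage k g y := by
  have hsupp := tsupport_comp_sub k y
  have hcs : HasCompactSupport fun w => k (w - y) :=
    hk.hasCompactSupport.comp_homeomorph (Homeomorph.subRight y)
  have hcd : ContDiff ℝ ∞ fun w => k (w - y) := hk.contDiff.comp (contDiff_id.sub contDiff_const)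
  -- The translated kernel is a test function on `V`, since its support is `y + tsupport k`.
  have h1 := hg.2.2 (fun w => k (w - y)) hcd hcs (by
    rw [hsupp]
    rintro _ ⟨v, hv, rfl⟩
    exact (hy v hv).1)
  have hcn : ContDiff ℝ ∞ fun z => k (-z) := hk.contDiff.comp contDiff_neg
  have hsn : HasCompactSupport fun z => k (-z) :=
    hk.hasCompactSupport.comp_homeomorph (Homeomorph.neg _)
  rw [translationAverage_eq_convolution, coordDeriv_convolution hu' hcn hsn,
    convolution_def, translationAverage_eq]
  -- The sign from reflecting the kernel in the convolution is the sign in the definition of a weak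
  -- derivative, so the two cancel below.
  have h2 : ∫ w, partialDeriv J (fun w => k (w - y)) w • u w =
      (-1 : ℝ) ^ j • ∫ w, ((ContinuousLinearMap.lsmul ℝ ℝ).flip (u' w))
        (partialDeriv J (fun z => k (-z)) (y - w)) := by
    rw [← integral_smul]
    refine integral_congr_ae (Eventually.of_forall fun w => ?_)
    simp only [partialDeriv_comp_neg J hk.contDiff, ContinuousLinearMap.flip_apply,
      ContinuousLinearMap.lsmul_apply, neg_sub, partialDeriv_comp_sub, smul_smul]
    rw [← mul_assoc, ← pow_add, ← two_mul, pow_mul, neg_one_sq, one_pow, one_mul]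
    by_cases hw : w - y ∈ tsupport k
    · have := (hy _ hw).2
      rw [add_sub_cancel] at this
      rw [this]
    · have : partialDeriv J k (w - y) = 0 :=
        image_eq_zero_of_notMem_tsupport fun h => hw (tsupport_partialDeriv_subset J k h)
      rw [this, zero_smul, zero_smul]
  rw [h2] at h1
  exact smul_right_injective F (pow_ne_zero j (by norm_num : (-1 : ℝ) ≠ 0)) h1

lemma IsMollifier.integrable {k : EuclideanSpace ℝ (Fin d) → ℝ} (hk : IsMollifier k) :
    Integrable k :=
  hk.contDiff.continuous.integrable_of_hasCompactSupport hk.hasCompactSupport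

lemma IsMollifier.lintegral_eq_one {k : EuclideanSpace ℝ (Fin d) → ℝ} (hk : IsMollifier k) :
    ∫⁻ v, ENNReal.ofReal (k v) = 1 := by
  rw [← ofReal_integral_eq_lintegral_ofReal hk.integrable (Eventually.of_forall hk.nonneg),
    hk.integral_eq_one, ENNReal.ofReal_one]

lemma IsMollifier.integrable_smul {k : EuclideanSpace ℝ (Fin d) → ℝ} (hk : IsMollifier k)
    {g : EuclideanSpace ℝ (Fin d) → F} (hg : LocallyIntegrable g) (y : EuclideanSpace ℝ (Fin d)) :
    Integrable fun v => k v • g (y + v) := by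
  have hcs : HasCompactSupport fun w => k (w - y) :=
    hk.hasCompactSupport.comp_homeomorph (Homeomorph.subRight y)
  have hc : Continuous fun w => k (w - y) := hk.contDiff.continuous.comp (by fun_prop)
  have h := integrable_test_smul hc hcs (subset_univ _) (hg.locallyIntegrableOn univ)
  simpa using h.comp_add_left y

lemma IsMollifier.translationAverage_sub {k : EuclideanSpace ℝ (Fin d) → ℝ} (hk : IsMollifier k)
    {g h : EuclideanSpace ℝ (Fin d) → F} (hg : LocallyIntegrable g) (hh : LocallyIntegrable h) :
    translationAverage k (g - h) = translationAverage k g - translationAverage k h := by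
  funext y
  simp only [translationAverage, Pi.sub_apply, smul_sub]
  exact integral_sub (hk.integrable_smul hg y) (hk.integrable_smul hh y)

lemma IsMollifier.norm_translationAverage_sub_le [CompleteSpace F]
    {k : EuclideanSpace ℝ (Fin d) → ℝ} (hk : IsMollifier k)
    {g : EuclideanSpace ℝ (Fin d) → F} (hg : LocallyIntegrable g) {y : EuclideanSpace ℝ (Fin d)}
    {z : F} {ε : ℝ} (hε : ∀ v ∈ tsupport k, ‖g (y + v) - z‖ ≤ ε) :
    ‖translationAverage k g y - z‖ ≤ ε := by
  have h1 : translationAverage k g y - z = ∫ v, k v • (g (y + v) - z) := by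
    simp only [smul_sub]
    rw [integral_sub (hk.integrable_smul hg y) (hk.integrable.smul_const z), integral_smul_const,
      hk.integral_eq_one, one_smul]
    rfl
  rw [h1]
  calc ‖∫ v, k v • (g (y + v) - z)‖ ≤ ∫ v, k v * ε := by
        refine norm_integral_le_of_norm_le (hk.integrable.mul_const ε)
          (Eventually.of_forall fun v => ?_)
        rw [norm_smul, Real.norm_of_nonneg (hk.nonneg v)]
        by_cases hv : v ∈ tsupport k
        · exact mul_le_mul_of_nonneg_left (hε v hv) (hk.nonneg v)
        · simp [image_eq_zero_of_notMem_tsupport hv]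
    _ = ε := by rw [integral_mul_const, hk.integral_eq_one, one_mul]

/-- Jensen's inequality for the probability measure `k dv`, then Tonelli and translation invariance.
-/
lemma IsMollifier.eLpNorm_translationAverage_le {k : EuclideanSpace ℝ (Fin d) → ℝ}
    (hk : IsMollifier k) {p : ℝ≥0} (hp : 1 ≤ p) {g : EuclideanSpace ℝ (Fin d) → F}
    (hg : AEStronglyMeasurable g) :
    eLpNorm (translationAverage k g) p volume ≤ eLpNorm g p volume := by
  have hp0 : (p : ENNReal) ≠ 0 := by exact_mod_cast (zero_lt_one.trans_le hp).ne'
  rw [eLpNorm_eq_lintegral_rpow_enorm_toReal hp0 ENNReal.coe_ne_top,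
    eLpNorm_eq_lintegral_rpow_enorm_toReal hp0 ENNReal.coe_ne_top]
  refine ENNReal.rpow_le_rpow ?_ (by positivity)
  rw [ENNReal.coe_toReal]
  have hkm : Measurable fun v => ENNReal.ofReal (k v) :=
    hk.contDiff.continuous.measurable.ennreal_ofReal
  set ν : Measure (EuclideanSpace ℝ (Fin d)) := volume.withDensity fun v => ENNReal.ofReal (k v)
    with hν
  have hν1 : ν univ = 1 := by
    rw [hν, withDensity_apply _ MeasurableSet.univ, Measure.restrict_univ, hk.lintegral_eq_one]
  have : IsProbabilityMeasure ν := ⟨hν1⟩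
  set w : EuclideanSpace ℝ (Fin d) → ENNReal := fun y => ‖hg.mk g y‖ₑ
  have hw : Measurable w := hg.stronglyMeasurable_mk.enorm
  have hgw : (fun y => ‖g y‖ₑ) =ᵐ[volume] w := hg.ae_eq_mk.fun_comp _
  have h1 : ∀ y, ‖translationAverage k g y‖ₑ ^ (p : ℝ) ≤ ∫⁻ v, w (y + v) ^ (p : ℝ) ∂ν := by
    intro y
    have hwy : Measurable fun v => w (y + v) := hw.comp (measurable_const_add y)
    have h2 : ‖translationAverage k g y‖ₑ ≤ ∫⁻ v, w (y + v) ∂ν := by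
      refine (enorm_integral_le_lintegral_enorm _).trans_eq ?_
      rw [hν, lintegral_withDensity_eq_lintegral_mul _ hkm hwy]
      have h3 := (measurePreserving_add_left volume y).quasiMeasurePreserving.ae_eq_comp hgw
      refine lintegral_congr_ae ?_
      filter_upwards [h3] with v hv
      rw [enorm_smul, Real.enorm_eq_ofReal (hk.nonneg v), Pi.mul_apply]
      congr 1
    refine (ENNReal.rpow_le_rpow h2 (by positivity)).trans ?_
    have h4 := ENNReal.lintegral_rpow_le_of_one_le (μ := ν) hwy.aemeasurable
      (b := (p : ℝ)) (by exact_mod_cast hp)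
    rwa [hν1, ENNReal.one_rpow, one_mul] at h4
  calc ∫⁻ y, ‖translationAverage k g y‖ₑ ^ (p : ℝ)
      ≤ ∫⁻ y, ∫⁻ v, w (y + v) ^ (p : ℝ) ∂ν := lintegral_mono h1
    _ = ∫⁻ v, (∫⁻ y, w (y + v) ^ (p : ℝ)) ∂ν := by
      refine lintegral_lintegral_swap (Measurable.aemeasurable ?_)
      exact (hw.comp (measurable_fst.add measurable_snd)).pow_const _
    _ = ∫⁻ _, (∫⁻ y, w y ^ (p : ℝ)) ∂ν := by
      refine lintegral_congr fun v => ?_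
      exact lintegral_add_right_eq_self (fun y => w y ^ (p : ℝ)) v
    _ = ∫⁻ y, ‖g y‖ₑ ^ (p : ℝ) := by
      rw [lintegral_const, hν1, mul_one]
      refine lintegral_congr_ae ?_
      filter_upwards [hgw] with y hy
      simp only [hy]

/-- Uniform continuity gives uniform convergence; once the kernels live in the unit ball, the
differences vanish outside a fixed compact set, so convergence in `L^p` follows. -/
lemma tendsto_eLpNorm_translationAverage_sub_of_continuous [CompleteSpace F]
    {k : ℕ → EuclideanSpace ℝ (Fin d) → ℝ} (hk : ∀ n, IsMollifier (k n))
    (hsupp : ∀ ε : ℝ, 0 < ε → ∀ᶠ n in atTop, tsupport (k n) ⊆ Metric.closedBall 0 ε)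
    (p : ℝ≥0) {g : EuclideanSpace ℝ (Fin d) → F} (hg : Continuous g)
    (hc : HasCompactSupport g) :
    Tendsto (fun n => eLpNorm (translationAverage (k n) g - g) p volume) atTop (𝓝 0) := by
  set K := Metric.cthickening 1 (tsupport g)
  have hK : IsCompact K := IsCompact.cthickening hc
  set c : ENNReal := volume K ^ (1 / (p : ENNReal).toReal)
  have hcfin : c ≠ ⊤ := ENNReal.rpow_ne_top_of_nonneg (by positivity) hK.measure_lt_top.ne
  have huc := hc.uniformContinuous_of_continuous hg
  have key : ∀ ε : ℝ, 0 < ε → ∀ᶠ n in atTop,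
      eLpNorm (translationAverage (k n) g - g) p volume ≤ c * ENNReal.ofReal ε := by
    intro ε hε
    obtain ⟨δ, hδ, hδε⟩ := Metric.uniformContinuous_iff.1 huc ε hε
    filter_upwards [hsupp (min (δ / 2) 1) (by positivity)] with n hn
    have hb : ∀ v ∈ tsupport (k n), ‖v‖ ≤ δ / 2 ∧ ‖v‖ ≤ 1 := fun v hv => by
      have := mem_closedBall_zero_iff.1 (hn hv)
      exact ⟨this.trans (min_le_left _ _), this.trans (min_le_right _ _)⟩
    have h1 : ∀ y, ‖translationAverage (k n) g y - g y‖ ≤ ε := fun y =>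
      (hk n).norm_translationAverage_sub_le hg.locallyIntegrable fun v hv => by
        rw [← dist_eq_norm]
        refine (hδε ?_).le
        rw [dist_eq_norm, add_sub_cancel_left]
        linarith [(hb v hv).1]
    have h2 : translationAverage (k n) g - g = K.indicator (translationAverage (k n) g - g) := by
      funext y
      by_cases hy : y ∈ K
      · rw [indicator_of_mem hy]
      · rw [indicator_of_notMem hy]
        have hg0 : ∀ v, ‖v‖ ≤ 1 → g (y + v) = 0 := fun v hv => by
          by_contra h0
          refine hy (Metric.mem_cthickening_of_dist_le y (y + v) 1 _ (subset_tsupport g h0) ?_)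
          rw [dist_eq_norm]
          simpa using hv
        have h3 : ‖translationAverage (k n) g y - 0‖ ≤ 0 :=
          (hk n).norm_translationAverage_sub_le hg.locallyIntegrable fun v hv => by
            rw [hg0 v (hb v hv).2]; simp
        have h4 := hg0 0 (by simp)
        rw [add_zero] at h4
        rw [Pi.sub_apply, h4]
        exact norm_le_zero_iff.1 h3
    rw [h2, eLpNorm_indicator_eq_eLpNorm_restrict hK.measurableSet]
    refine (eLpNorm_le_of_ae_bound (C := ε) (Eventually.of_forall h1)).trans_eq ?_
    rw [Measure.restrict_apply_univ, ← one_div]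
  rw [ENNReal.tendsto_nhds_zero]
  intro ε hε
  rcases eq_or_ne ε ⊤ with rfl | hεt
  · exact Eventually.of_forall fun _ => le_top
  -- Division by `c + 1` covers `c = 0`.
  have h5 : 0 < ε / (c + 1) := ENNReal.div_pos hε.ne' (by finiteness)
  have h6 : ε / (c + 1) ≠ ⊤ := ENNReal.div_ne_top hεt (by simp)
  filter_upwards [key (ε / (c + 1)).toReal (ENNReal.toReal_pos h5.ne' h6)] with n hn
  refine hn.trans ?_
  rw [ENNReal.ofReal_toReal h6]
  calc c * (ε / (c + 1)) ≤ (c + 1) * (ε / (c + 1)) := by gcongr; exact le_self_add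
    _ = ε := ENNReal.mul_div_cancel (by simp) (by finiteness)

/-- Averages over small translations converge in `L^p`. -/
theorem tendsto_eLpNorm_translationAverage_sub [CompleteSpace F]
    {k : ℕ → EuclideanSpace ℝ (Fin d) → ℝ} (hk : ∀ n, IsMollifier (k n))
    (hsupp : ∀ ε : ℝ, 0 < ε → ∀ᶠ n in atTop, tsupport (k n) ⊆ Metric.closedBall 0 ε)
    {p : ℝ≥0} (hp : 1 ≤ p) {g : EuclideanSpace ℝ (Fin d) → F} (hg : MemLp g p volume) :
    Tendsto (fun n => eLpNorm (translationAverage (k n) g - g) p volume) atTop (𝓝 0) := by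
  have hp' : (1 : ENNReal) ≤ p := by exact_mod_cast hp
  rw [ENNReal.tendsto_nhds_zero]
  intro ε hε
  have h3 : ε / 3 ≠ 0 := (ENNReal.div_pos hε.ne' (by simp)).ne'
  obtain ⟨h, hhc, hhε, hcont, hhp⟩ :=
    hg.exists_hasCompactSupport_eLpNorm_sub_le ENNReal.coe_ne_top h3
  have h4 := ENNReal.tendsto_nhds_zero.1
    (tendsto_eLpNorm_translationAverage_sub_of_continuous hk hsupp p hcont hhc) (ε / 3) h3.bot_lt
  filter_upwards [h4] with n hn
  have hgl := hg.locallyIntegrable hp'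
  have hhl := hhp.locallyIntegrable hp'
  -- Approximate `g` by a continuous `h` of compact support; averaging does not increase the `L^p`
  -- distance, so each of the three terms is at most `ε / 3`.
  have e : translationAverage (k n) g - g =
      (translationAverage (k n) (g - h) + (translationAverage (k n) h - h)) + (h - g) := by
    rw [(hk n).translationAverage_sub hgl hhl]
    abel
  have m1 : AEStronglyMeasurable (translationAverage (k n) (g - h)) :=
    ((hk n).contDiff_translationAverage (hgl.sub hhl)).continuous.aestronglyMeasurable
  have m2 : AEStronglyMeasurable (translationAverage (k n) h - h) :=
    (((hk n).contDiff_translationAverage hhl).continuous.sub hcont).aestronglyMeasurable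
  rw [e]
  refine (eLpNorm_add_le (m1.add m2) (hhp.1.sub hg.1) hp').trans ?_
  calc _ ≤ (ε / 3 + ε / 3) + ε / 3 := by
        refine add_le_add ((eLpNorm_add_le m1 m2 hp').trans (add_le_add ?_ hn)) ?_
        · exact ((hk n).eLpNorm_translationAverage_le hp (hg.1.sub hhp.1)).trans hhε
        · rwa [eLpNorm_sub_comm]
    _ = ε := ENNReal.add_thirds ε

end Mollification

/-! ### Norms of derivatives in the charts of a finite atlas -/

section JetNorm

open Filter

/-- `a ≤ C * b` on `s` for a finite constant `C`. -/
def DominatedOn {α : Type*} (s : Set α) (a b : α → ENNReal) : Prop :=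
  ∃ C : ℝ≥0, ∀ f ∈ s, a f ≤ C * b f

lemma DominatedOn.of_le {α : Type*} {s : Set α} {a b : α → ENNReal} (h : ∀ f ∈ s, a f ≤ b f) :
    DominatedOn s a b := ⟨1, fun f hf => by simpa using h f hf⟩

lemma DominatedOn.of_le_mul {α : Type*} {s : Set α} {a b : α → ENNReal} {c : ENNReal} (hc : c ≠ ⊤)
    (h : ∀ f ∈ s, a f ≤ c * b f) : DominatedOn s a b :=
  ⟨c.toNNReal, fun f hf => by rw [ENNReal.coe_toNNReal hc]; exact h f hf⟩

lemma DominatedOn.trans {α : Type*} {s : Set α} {a b c : α → ENNReal} (h : DominatedOn s a b)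
    (h' : DominatedOn s b c) : DominatedOn s a c := by
  obtain ⟨C, hC⟩ := h
  obtain ⟨C', hC'⟩ := h'
  refine ⟨C * C', fun f hf => (hC f hf).trans ?_⟩
  rw [ENNReal.coe_mul, mul_assoc]
  gcongr
  exact hC' f hf

lemma DominatedOn.sum {α ι : Type*} {s : Set α} (t : Finset ι) {a : ι → α → ENNReal}
    {b : α → ENNReal} (h : ∀ i ∈ t, DominatedOn s (a i) b) :
    DominatedOn s (fun f => ∑ i ∈ t, a i f) b := by
  choose! C hC using h
  refine ⟨∑ i ∈ t, C i, fun f hf => ?_⟩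
  rw [ENNReal.ofNNReal_finsetSum, Finset.sum_mul]
  exact Finset.sum_le_sum fun i hi => hC i hi f hf

lemma eLpNorm_restrict_le_sum {α G : Type*} [MeasurableSpace α] {μ : Measure α}
    [NormedAddCommGroup G] {ι : Type*} [Fintype ι] {L : ι → Set α} (hL : ∀ m, MeasurableSet (L m))
    {V : Set α} (hV : V ⊆ ⋃ m, L m) {h : α → G}
    (hm : ∀ m, AEStronglyMeasurable h (μ.restrict (L m))) {q : ENNReal} (hq : 1 ≤ q) :
    eLpNorm h q (μ.restrict V) ≤ ∑ m, eLpNorm h q (μ.restrict (L m)) := by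
  have h1 : eLpNorm h q (μ.restrict (⋃ m, L m)) ≤
      eLpNorm (∑ m, fun y => ‖(L m).indicator h y‖) q μ := by
    rw [← eLpNorm_indicator_eq_eLpNorm_restrict (MeasurableSet.iUnion hL)]
    refine eLpNorm_mono_real fun y => ?_
    rw [Finset.sum_apply]
    by_cases hy : y ∈ ⋃ m, L m
    · obtain ⟨m, hym⟩ := mem_iUnion.1 hy
      rw [indicator_of_mem hy]
      refine le_trans (le_of_eq ?_) (Finset.single_le_sum
        (f := fun m => ‖(L m).indicator h y‖) (fun _ _ => norm_nonneg _) (Finset.mem_univ m))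
      simp only [indicator_of_mem hym]
    · rw [indicator_of_notMem hy, norm_zero]
      exact Finset.sum_nonneg fun _ _ => norm_nonneg _
  refine (eLpNorm_mono_measure _ (Measure.restrict_mono hV le_rfl)).trans (h1.trans ?_)
  refine (eLpNorm_sum_le (fun m _ => ?_) hq).trans_eq ?_
  · exact ((aestronglyMeasurable_indicator_iff (hL m)).2 (hm m)).norm
  · refine Finset.sum_congr rfl fun m _ => ?_
    rw [eLpNorm_norm, eLpNorm_indicator_eq_eLpNorm_restrict (hL m)]

lemma eLpNorm_restrict_le_of_eq_zero {α G : Type*} [MeasurableSpace α] {μ : Measure α}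
    [NormedAddCommGroup G] {V L : Set α} (hV : MeasurableSet V) (hL : MeasurableSet L) {h : α → G}
    (h0 : ∀ y ∈ V, y ∉ L → h y = 0) (q : ENNReal) :
    eLpNorm h q (μ.restrict V) ≤ eLpNorm h q (μ.restrict L) := by
  rw [← eLpNorm_indicator_eq_eLpNorm_restrict hL]
  have h1 : eLpNorm h q (μ.restrict V) = eLpNorm (L.indicator h) q (μ.restrict V) := by
    refine eLpNorm_congr_ae ((ae_restrict_iff' hV).2 (Eventually.of_forall fun y hy => ?_))
    by_cases hyL : y ∈ L
    · rw [indicator_of_mem hyL]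
    · rw [indicator_of_notMem hyL, h0 y hy hyL]
  rw [h1]
  exact eLpNorm_mono_measure _ Measure.restrict_le_self

variable {d : ℕ} {H : Type*} [TopologicalSpace H]
  {I : ModelWithCorners ℝ (EuclideanSpace ℝ (Fin d)) H}
  {S : Type*} [TopologicalSpace S] [ChartedSpace H S] [IsManifold I ∞ S]
  {F : Type*} [NormedAddCommGroup F] [NormedSpace ℂ F]

namespace FiniteAtlas

variable (𝔄 : FiniteAtlas I S)

/-- The `L^q` norm of the `j`-th derivative in the `i`-th chart. -/
def jetNorm (i : Fin 𝔄.card) (j : ℕ) (q : ENNReal) (f : S → F) : ENNReal :=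
  eLpNorm (chartJet I (𝔄.chart i) j f) q (volume.restrict (𝔄.coordDom i))

lemma target_mem_nhds (i : Fin 𝔄.card) {y : EuclideanSpace ℝ (Fin d)} (hy : y ∈ 𝔄.coordDom i) :
    ((𝔄.chart i).extend I).target ∈ 𝓝 y :=
  mem_of_superset ((𝔄.isOpen_coordDom i).mem_nhds hy) (𝔄.coordDom_subset i)

lemma chartJet_eq_iteratedFDeriv (i : Fin 𝔄.card) (j : ℕ) (f : S → F)
    {y : EuclideanSpace ℝ (Fin d)} (hy : y ∈ 𝔄.coordDom i) :
    chartJet I (𝔄.chart i) j f y = iteratedFDeriv ℝ j (𝔄.read i f) y := by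
  have h : ((𝔄.chart i).extend I).target =ᶠ[𝓝 y] univ :=
    eventuallyEq_univ.2 (𝔄.target_mem_nhds i hy)
  rw [chartJet, iteratedFDerivWithin_congr_set h, iteratedFDerivWithin_univ]
  rfl

lemma jetNorm_eq (i : Fin 𝔄.card) (j : ℕ) (q : ENNReal) (f : S → F) : 𝔄.jetNorm i j q f =
    eLpNorm (iteratedFDeriv ℝ j (𝔄.read i f)) q (volume.restrict (𝔄.coordDom i)) :=
  eLpNorm_congr_ae ((ae_restrict_iff' (𝔄.isOpen_coordDom i).measurableSet).2
    (Eventually.of_forall fun _ hy => 𝔄.chartJet_eq_iteratedFDeriv i j f hy))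

lemma contDiffOn_read_coordDom {k : ℕ} {f : S → F} (hf : ContMDiff I 𝓘(ℝ, F) k f)
    (i : Fin 𝔄.card) : ContDiffOn ℝ k (𝔄.read i f) (𝔄.coordDom i) :=
  (𝔄.contDiffOn_read hf i).mono (𝔄.coordDom_subset i)

lemma coordDom_subset_image (i : Fin 𝔄.card) :
    𝔄.coordDom i ⊆ (𝔄.chart i).extend I '' closure (𝔄.dom i) :=
  interior_subset.trans (image_mono subset_closure)

lemma isCompact_image_closure_dom [CompactSpace S] (i : Fin 𝔄.card) :
    IsCompact ((𝔄.chart i).extend I '' closure (𝔄.dom i)) :=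
  isCompact_image_extend _ isClosed_closure.isCompact (𝔄.closure_dom_subset i)

lemma volume_coordDom_ne_top [CompactSpace S] (i : Fin 𝔄.card) : volume (𝔄.coordDom i) ≠ ⊤ :=
  ((measure_mono (𝔄.coordDom_subset_image i)).trans_lt
    (𝔄.isCompact_image_closure_dom i).measure_lt_top).ne

lemma aestronglyMeasurable_chartJet_coordDom {k j : ℕ} (hj : j ≤ k) {f : S → F}
    (hf : ContMDiff I 𝓘(ℝ, F) k f) (i : Fin 𝔄.card) :
    AEStronglyMeasurable (chartJet I (𝔄.chart i) j f) (volume.restrict (𝔄.coordDom i)) :=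
  ((continuousOn_chartJet (𝔄.chart_mem i) hj hf).mono
    (𝔄.coordDom_subset i)).aestronglyMeasurable (𝔄.isOpen_coordDom i).measurableSet

lemma exists_norm_chartJet_le_const [CompactSpace S] {k j : ℕ} (hj : j ≤ k) {f : S → F}
    (hf : ContMDiff I 𝓘(ℝ, F) k f) (i : Fin 𝔄.card) :
    ∃ c : ℝ, ∀ y ∈ 𝔄.coordDom i, ‖chartJet I (𝔄.chart i) j f y‖ ≤ c := by
  obtain ⟨c, hc⟩ := (𝔄.isCompact_image_closure_dom i).exists_bound_of_continuousOn
    ((continuousOn_chartJet (𝔄.chart_mem i) hj hf).mono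
      (image_extend_subset_target _ (𝔄.closure_dom_subset i)))
  exact ⟨c, fun y hy => hc y (𝔄.coordDom_subset_image i hy)⟩

lemma jetNorm_lt_top [CompactSpace S] {k j : ℕ} (hj : j ≤ k) {f : S → F}
    (hf : ContMDiff I 𝓘(ℝ, F) k f) (i : Fin 𝔄.card) (q : ENNReal) : 𝔄.jetNorm i j q f < ⊤ := by
  obtain ⟨c, hc⟩ := 𝔄.exists_norm_chartJet_le_const hj hf i
  have : IsFiniteMeasure (volume.restrict (𝔄.coordDom i)) :=
    ⟨by rw [Measure.restrict_apply_univ]; exact (𝔄.volume_coordDom_ne_top i).lt_top⟩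
  exact (MemLp.of_bound (𝔄.aestronglyMeasurable_chartJet_coordDom hj hf i) c
    ((ae_restrict_iff' (𝔄.isOpen_coordDom i).measurableSet).2 (Eventually.of_forall hc))).2

lemma jetNorm_add_le {k j : ℕ} (hj : j ≤ k) {f g : S → F} (hf : ContMDiff I 𝓘(ℝ, F) k f)
    (hg : ContMDiff I 𝓘(ℝ, F) k g) (i : Fin 𝔄.card) {q : ENNReal} (hq : 1 ≤ q) :
    𝔄.jetNorm i j q (f + g) ≤ 𝔄.jetNorm i j q f + 𝔄.jetNorm i j q g := by
  have h : 𝔄.jetNorm i j q (f + g) ≤ eLpNorm ((fun y => ‖chartJet I (𝔄.chart i) j f y‖) +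
      fun y => ‖chartJet I (𝔄.chart i) j g y‖) q (volume.restrict (𝔄.coordDom i)) := by
    refine eLpNorm_mono_ae_real ((ae_restrict_iff' (𝔄.isOpen_coordDom i).measurableSet).2
      (Eventually.of_forall fun y hy => ?_))
    have hy' := 𝔄.coordDom_subset i hy
    have hjk : (j : WithTop ℕ∞) ≤ k := by exact_mod_cast hj
    have h1 : chartJet I (𝔄.chart i) j (f + g) y =
        chartJet I (𝔄.chart i) j f y + chartJet I (𝔄.chart i) j g y :=
      iteratedFDerivWithin_add_apply (((𝔄.contDiffOn_read hf i) _ hy').of_le hjk)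
        (((𝔄.contDiffOn_read hg i) _ hy').of_le hjk) (uniqueDiffOn_chartTarget _) hy'
    rw [h1]
    exact norm_add_le _ _
  refine h.trans ((eLpNorm_add_le (𝔄.aestronglyMeasurable_chartJet_coordDom hj hf i).norm
    (𝔄.aestronglyMeasurable_chartJet_coordDom hj hg i).norm hq).trans_eq ?_)
  rw [eLpNorm_norm, eLpNorm_norm]
  rfl

lemma jetNorm_const_smul {k j : ℕ} (hj : j ≤ k) (c : ℂ) {f : S → F}
    (hf : ContMDiff I 𝓘(ℝ, F) k f) (i : Fin 𝔄.card) (q : ENNReal) :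
    𝔄.jetNorm i j q (c • f) = ‖c‖ₑ * 𝔄.jetNorm i j q f := by
  have h : eLpNorm (chartJet I (𝔄.chart i) j (c • f)) q (volume.restrict (𝔄.coordDom i)) =
      eLpNorm (‖c‖ • fun y => ‖chartJet I (𝔄.chart i) j f y‖) q (volume.restrict (𝔄.coordDom i)) := by
    refine eLpNorm_congr_norm_ae ((ae_restrict_iff' (𝔄.isOpen_coordDom i).measurableSet).2
      (Eventually.of_forall fun y hy => ?_))
    have hy' := 𝔄.coordDom_subset i hy
    have hjk : (j : WithTop ℕ∞) ≤ k := by exact_mod_cast hj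
    have h1 : chartJet I (𝔄.chart i) j (c • f) y = c • chartJet I (𝔄.chart i) j f y :=
      iteratedFDerivWithin_const_smul_apply (((𝔄.contDiffOn_read hf i) _ hy').of_le hjk)
        (uniqueDiffOn_chartTarget _) hy'
    rw [h1, norm_smul, Pi.smul_apply, norm_smul, norm_norm, norm_norm]
  rw [jetNorm, h, eLpNorm_const_smul, enorm_norm, eLpNorm_norm]
  rfl

/-- A continuous function is bounded by its `L^∞` norm, up to the boundary. -/
lemma enorm_le_eLpNorm_top {G : Type*} [NormedAddCommGroup G] (i : Fin 𝔄.card)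
    {h : EuclideanSpace ℝ (Fin d) → G} (hh : ContinuousOn h ((𝔄.chart i).extend I).target) {s : S}
    (hs : s ∈ 𝔄.dom i) : ‖h ((𝔄.chart i).extend I s)‖ₑ ≤
      eLpNorm h ⊤ (volume.restrict (𝔄.coordDom i)) := by
  -- A strict violation would persist at the points of `coordDom i` near `s`, a nonempty open set
  -- and so one of positive measure.
  by_contra! hlt
  rw [eLpNorm_exponent_top] at hlt
  have h1 : ContinuousWithinAt (fun y => ‖h y‖ₑ) (𝔄.coordDom i) ((𝔄.chart i).extend I s) :=
    ((hh _ (𝔄.extend_mem_target i ⟨s, hs⟩)).mono (𝔄.coordDom_subset i)).enorm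
  have h2 := h1.eventually (lt_mem_nhds hlt)
  obtain ⟨O, hO, hsO, hsub⟩ := mem_nhdsWithin.1 h2
  have h3 : (O ∩ 𝔄.coordDom i).Nonempty :=
    mem_closure_iff.1 (𝔄.mem_closure_coordDom i hs) O hO hsO
  have h4 := (hO.inter (𝔄.isOpen_coordDom i)).measure_pos volume h3
  have h5 := (ae_restrict_iff' (𝔄.isOpen_coordDom i).measurableSet).1
    (ae_le_eLpNormEssSup (f := h) (μ := volume.restrict (𝔄.coordDom i)))
  refine h4.ne' (measure_mono_null (fun y hy => ?_) h5)
  simp only [mem_compl_iff, mem_ofPred_eq, Classical.not_imp, not_le]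
  exact ⟨hy.2, hsub hy⟩

/-- `coordDom` only lacks points of the frontier of `range I`, and the frontier of a convex set is
null. -/
lemma volume_restrict_image_le (i : Fin 𝔄.card) {K : Set S} (hK : K ⊆ 𝔄.dom i) :
    volume.restrict ((𝔄.chart i).extend I '' K) ≤ volume.restrict (𝔄.coordDom i) := by
  obtain ⟨O, hO, hOd⟩ := exists_image_extend_eq (I := I) (𝔄.chart i) (𝔄.isOpen_dom i)
    (subset_closure.trans (𝔄.closure_dom_subset i))
  have h0 : volume (frontier (range I)) = 0 := I.convex_range.addHaar_frontier volume
  have hsub : (𝔄.chart i).extend I '' K ⊆ 𝔄.coordDom i ∪ frontier (range I) := by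
    rintro y hy
    have hy' : y ∈ O ∩ range I := hOd ▸ image_mono hK hy
    by_cases hyi : y ∈ interior (range I)
    · left
      rw [coordDom, hOd, interior_inter, hO.interior_eq]
      exact ⟨hy'.1, hyi⟩
    · right
      exact ⟨subset_closure hy'.2, hyi⟩
  refine (Measure.restrict_mono hsub le_rfl).trans ((Measure.restrict_union_le _ _).trans ?_)
  rw [Measure.restrict_eq_zero.2 h0, add_zero]

lemma chartJet_eq_zero (i : Fin 𝔄.card) (j : ℕ) {f : S → F} {y : EuclideanSpace ℝ (Fin d)}
    (hy : y ∈ ((𝔄.chart i).extend I).target)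
    (hf : ((𝔄.chart i).extend I).symm y ∉ tsupport f) : chartJet I (𝔄.chart i) j f y = 0 := by
  have h1 : f ∘ ((𝔄.chart i).extend I).symm =ᶠ[𝓝[((𝔄.chart i).extend I).target] y] fun _ => 0 :=
    ((𝔄.chart i).continuousOn_extend_symm y hy).eventually
      (notMem_tsupport_iff_eventuallyEq.1 hf)
  rw [chartJet, (h1.iteratedFDerivWithin (𝕜 := ℝ) j).eq_of_nhdsWithin hy,
    iteratedFDerivWithin_fun_zero]
  rfl

lemma dominatedOn_eLpNorm_image [CompactSpace S] {k j : ℕ} (hj : j ≤ k) (m : Fin 𝔄.card)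
    {K : Set S} (hK : IsCompact K) (hKm : K ⊆ (𝔄.chart m).source) {q q' : ENNReal} (hq : q ≤ q')
    (hq0 : 1 ≤ q) :
    DominatedOn {f : S → F | ContMDiff I 𝓘(ℝ, F) k f}
      (fun f => eLpNorm (chartJet I (𝔄.chart m) j f) q (volume.restrict ((𝔄.chart m).extend I '' K)))
      (fun f => eLpNorm (chartJet I (𝔄.chart m) j f) q'
        (volume.restrict ((𝔄.chart m).extend I '' K))) := by
  have hL := isCompact_image_extend (I := I) (𝔄.chart m) hK hKm
  refine DominatedOn.of_le_mul
    (c := volume ((𝔄.chart m).extend I '' K) ^ (1 / q.toReal - 1 / q'.toReal)) ?_ fun f hf => ?_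
  · refine ENNReal.rpow_ne_top_of_nonneg ?_ hL.measure_lt_top.ne
    rw [one_div, one_div, ← ENNReal.toReal_inv, ← ENNReal.toReal_inv, sub_nonneg]
    exact ENNReal.toReal_mono (ENNReal.inv_ne_top.2 (zero_lt_one.trans_le hq0).ne')
      (ENNReal.inv_le_inv.2 hq)
  · have h1 := eLpNorm_le_eLpNorm_mul_rpow_measure_univ hq
      (aestronglyMeasurable_chartJet (𝔄.chart_mem m) hj hf hK hKm)
    rw [Measure.restrict_apply_univ] at h1
    rwa [mul_comm]

lemma dominatedOn_jetNorm_of_le [CompactSpace S] {k j : ℕ} (hj : j ≤ k) (i : Fin 𝔄.card)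
    {q q' : ENNReal} (hq : q ≤ q') (hq0 : 1 ≤ q) :
    DominatedOn {f : S → F | ContMDiff I 𝓘(ℝ, F) k f} (𝔄.jetNorm i j q) (𝔄.jetNorm i j q') := by
  refine DominatedOn.of_le_mul
    (c := volume (𝔄.coordDom i) ^ (1 / q.toReal - 1 / q'.toReal)) ?_ fun f hf => ?_
  · refine ENNReal.rpow_ne_top_of_nonneg ?_ (𝔄.volume_coordDom_ne_top i)
    rw [one_div, one_div, ← ENNReal.toReal_inv, ← ENNReal.toReal_inv, sub_nonneg]
    exact ENNReal.toReal_mono (ENNReal.inv_ne_top.2 (zero_lt_one.trans_le hq0).ne')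
      (ENNReal.inv_le_inv.2 hq)
  · have h1 := eLpNorm_le_eLpNorm_mul_rpow_measure_univ hq
      (𝔄.aestronglyMeasurable_chartJet_coordDom hj hf i)
    rw [Measure.restrict_apply_univ] at h1
    rwa [mul_comm]

/-- For functions with support in `K ⊆ dom m`, the norm in any chart is dominated by the norms in
the `m`-th chart. -/
lemma dominatedOn_jetNorm_of_tsupport [CompactSpace S] [T2Space S] {k j : ℕ} (hj : j ≤ k)
    (i m : Fin 𝔄.card) {K : Set S} (hK : IsCompact K) (hKm : K ⊆ (𝔄.chart m).source) {q : ENNReal}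
    (hq : 1 ≤ q) :
    DominatedOn {f : S → F | ContMDiff I 𝓘(ℝ, F) k f ∧ tsupport f ⊆ K} (𝔄.jetNorm i j q)
      (fun f => ∑ l ∈ Finset.range (k + 1), eLpNorm (chartJet I (𝔄.chart m) l f) q
        (volume.restrict ((𝔄.chart m).extend I '' K))) := by
  -- Outside the image of `K'` the jet in the `i`-th chart vanishes on `coordDom i`; on `K'` both
  -- charts are defined and can be exchanged.
  set K' := closure (𝔄.dom i) ∩ K
  have hK' : IsCompact K' := hK.inter_left isClosed_closure
  have hK'i : K' ⊆ (𝔄.chart i).source := inter_subset_left.trans (𝔄.closure_dom_subset i)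
  have hK'm : K' ⊆ (𝔄.chart m).source := inter_subset_right.trans hKm
  obtain ⟨C, hC⟩ := exists_eLpNorm_chartJet_le (F := F) (𝔄.chart_mem i) (𝔄.chart_mem m) hK' hK'i
    hK'm k
  refine ⟨C, fun f hf => ?_⟩
  have h1 : 𝔄.jetNorm i j q f ≤ eLpNorm (chartJet I (𝔄.chart i) j f) q
      (volume.restrict ((𝔄.chart i).extend I '' K')) := by
    refine eLpNorm_restrict_le_of_eq_zero (𝔄.isOpen_coordDom i).measurableSet
      (isCompact_image_extend _ hK' hK'i).measurableSet (fun y hy hyK => ?_) q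
    refine 𝔄.chartJet_eq_zero i j (𝔄.coordDom_subset i hy) fun hs => hyK ?_
    obtain ⟨s, hsd, rfl⟩ := interior_subset hy
    refine ⟨s, ⟨subset_closure hsd, ?_⟩, rfl⟩
    rw [(𝔄.chart i).extend_left_inv (𝔄.closure_dom_subset i (subset_closure hsd))] at hs
    exact hf.2 hs
  refine h1.trans ((hC f hf.1 j hj q hq).trans ?_)
  refine mul_le_mul_right ?_ _
  calc _ ≤ ∑ l ∈ Finset.range (k + 1), eLpNorm (chartJet I (𝔄.chart m) l f) q
        (volume.restrict ((𝔄.chart m).extend I '' K')) :=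
        Finset.sum_le_sum_of_subset (Finset.range_mono (by omega))
    _ ≤ _ := Finset.sum_le_sum fun l _ =>
        eLpNorm_mono_measure _ (Measure.restrict_mono (image_mono inter_subset_right) le_rfl)

/-- The global Sobolev estimate for `C^k` functions. -/
theorem dominatedOn_jetNorm_div [CompactSpace S] [T2Space S] [CompleteSpace F]
    (hI : range I = univ ∨ ∃ l : EuclideanSpace ℝ (Fin d) →L[ℝ] ℝ, l ≠ 0 ∧ range I = {v | 0 ≤ l v})
    {k : ℕ} {p : ℝ≥0} (hk : 1 ≤ k) (hp : 1 ≤ p) (hdP : (d : ℝ≥0) < k * p) {j : ℕ} (hj : j ≤ k)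
    (i : Fin 𝔄.card) :
    DominatedOn {f : S → F | ContMDiff I 𝓘(ℝ, F) k f}
      (𝔄.jetNorm i j ((k * p : ℝ≥0) / j))
      (fun f => ∑ m, ∑ l ∈ Finset.range (k + 1), 𝔄.jetNorm m l p f) := by
  -- A shrunken cover: the closure of `G m` is compact in `dom m`, which leaves room for the cones
  -- of the local estimate in the `m`-th chart. The closure of `dom i` itself need not have such
  -- room in its own chart domain `dom i`.
  obtain ⟨G, hGU, hGo, hGd⟩ := exists_iUnion_eq_closure_subset 𝔄.isOpen_dom
    (fun _ => Set.toFinite _) 𝔄.iUnion_dom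
  set q : ENNReal := (k * p : ℝ≥0) / j with hq
  have hjq : ∀ l ≤ k, (1 : ENNReal) ≤ (k * p : ℝ≥0) / l := fun l hl => by
    rw [ENNReal.le_div_iff_mul_le (Or.inr (by
      exact_mod_cast (zero_lt_one.trans_le (one_le_mul (by exact_mod_cast hk) hp)).ne'))
      (Or.inl (by finiteness)), one_mul]
    calc (l : ENNReal) ≤ k := by exact_mod_cast hl
      _ ≤ (k * p : ℝ≥0) := by exact_mod_cast le_mul_of_one_le_right zero_le hp
  have hq1 : 1 ≤ q := hjq j hj
  set K : Fin 𝔄.card → Set S := fun m => closure (𝔄.dom i) ∩ closure (G m)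
  have hK : ∀ m, IsCompact (K m) := fun m => (isClosed_closure.inter isClosed_closure).isCompact
  have hKi : ∀ m, K m ⊆ (𝔄.chart i).source := fun m =>
    inter_subset_left.trans (𝔄.closure_dom_subset i)
  have hKd : ∀ m, K m ⊆ 𝔄.dom m := fun m => inter_subset_right.trans (hGd m)
  have hds : ∀ m, 𝔄.dom m ⊆ (𝔄.chart m).source := fun m =>
    subset_closure.trans (𝔄.closure_dom_subset m)
  have h1 : DominatedOn {f : S → F | ContMDiff I 𝓘(ℝ, F) k f} (𝔄.jetNorm i j q)
      (fun f => ∑ m, eLpNorm (chartJet I (𝔄.chart i) j f) q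
        (volume.restrict ((𝔄.chart i).extend I '' K m))) := by
    refine DominatedOn.of_le fun f hf => eLpNorm_restrict_le_sum
      (fun m => (isCompact_image_extend _ (hK m) (hKi m)).measurableSet) ?_
      (fun m => aestronglyMeasurable_chartJet (𝔄.chart_mem i) hj hf (hK m) (hKi m)) hq1
    rw [← image_iUnion, ← inter_iUnion]
    refine (𝔄.coordDom_subset_image i).trans (image_mono fun s hs => ⟨hs, ?_⟩)
    obtain ⟨m, hm⟩ := mem_iUnion.1 (hGU ▸ mem_univ s)
    exact mem_iUnion.2 ⟨m, subset_closure hm⟩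
  refine h1.trans (DominatedOn.sum _ fun m _ => ?_)
  have h2 : DominatedOn {f : S → F | ContMDiff I 𝓘(ℝ, F) k f}
      (fun f => eLpNorm (chartJet I (𝔄.chart i) j f) q
        (volume.restrict ((𝔄.chart i).extend I '' K m)))
      (fun f => ∑ l ∈ Finset.range (j + 1), eLpNorm (chartJet I (𝔄.chart m) l f) q
        (volume.restrict ((𝔄.chart m).extend I '' K m))) := by
    obtain ⟨C, hC⟩ := exists_eLpNorm_chartJet_le (F := F) (𝔄.chart_mem i) (𝔄.chart_mem m) (hK m)
      (hKi m) ((hKd m).trans (hds m)) k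
    exact ⟨C, fun f hf => hC f hf j hj q hq1⟩
  refine h2.trans (DominatedOn.sum _ fun l hl => ?_)
  have hlj : l ≤ j := Nat.lt_succ_iff.1 (Finset.mem_range.1 hl)
  -- The change of charts brings in jets of order `l ≤ j` in `L^(P / j)`; these are dominated by
  -- their `L^(P / l)` norms, for which the local estimate holds.
  have h3 := 𝔄.dominatedOn_eLpNorm_image (F := F) (hlj.trans hj) m (hK m) ((hKd m).trans (hds m))
    (q := q) (q' := (k * p : ℝ≥0) / l) (by rw [hq]; gcongr) hq1
  refine h3.trans ?_
  obtain ⟨K', hK', hK'd, C, hC⟩ := exists_eLpNorm_chartJet_le_sum F hI (𝔄.chart_mem m)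
    (𝔄.isOpen_dom m) (hds m) hk hp hdP (hlj.trans hj) (hK m) (hKd m)
  refine ⟨C, fun f hf => (hC f hf).trans ?_⟩
  refine mul_le_mul_right ?_ _
  refine le_trans ?_ (Finset.single_le_sum
    (f := fun m => ∑ l ∈ Finset.range (k + 1), 𝔄.jetNorm m l p f) (fun _ _ => zero_le)
    (Finset.mem_univ m))
  exact Finset.sum_le_sum fun l' _ => eLpNorm_mono_measure _ (𝔄.volume_restrict_image_le m hK'd)

end FiniteAtlas

end JetNorm

/-! ### Limits of Sobolev functions and of `C^k` functions -/

section Limits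

open Filter

variable {d : ℕ} {F : Type*} [NormedAddCommGroup F] [NormedSpace ℂ F]

lemma IsWeakDeriv.sub {V : Set (EuclideanSpace ℝ (Fin d))} {j : ℕ} {J : Fin j → Fin d}
    {u u' g g' : EuclideanSpace ℝ (Fin d) → F} (h : IsWeakDeriv V J u g)
    (h' : IsWeakDeriv V J u' g') : IsWeakDeriv V J (u - u') (g - g') := by
  have := h.add (h'.const_smul (-1))
  simpa [neg_smul, ← sub_eq_add_neg] using this

lemma MemSobolevOn.sub {V : Set (EuclideanSpace ℝ (Fin d))} {k : ℕ} {p : ℝ≥0}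
    {u u' : EuclideanSpace ℝ (Fin d) → F} (h : MemSobolevOn V k p u)
    (h' : MemSobolevOn V k p u') : MemSobolevOn V k p (u - u') := by
  have := h.add (h'.const_smul (-1))
  simpa [neg_smul, ← sub_eq_add_neg] using this

lemma enorm_integral_smul_le {V : Set (EuclideanSpace ℝ (Fin d))}
    {φ : EuclideanSpace ℝ (Fin d) → ℝ} {c : ℝ} (hc : ∀ y, ‖φ y‖ ≤ c) (hφV : tsupport φ ⊆ V)
    (g : EuclideanSpace ℝ (Fin d) → F) :
    ‖∫ y, φ y • g y‖ₑ ≤ ENNReal.ofReal c * eLpNorm g 1 (volume.restrict V) := by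
  have h1 : ∫ y, φ y • g y = ∫ y in V, φ y • g y := by
    refine (setIntegral_eq_integral_of_forall_compl_eq_zero fun y hy => ?_).symm
    rw [image_eq_zero_of_notMem_tsupport fun h => hy (hφV h), zero_smul]
  rw [h1, eLpNorm_one_eq_lintegral_enorm, ← lintegral_const_mul' _ _ ENNReal.ofReal_ne_top]
  refine (enorm_integral_le_lintegral_enorm _).trans (lintegral_mono fun y => ?_)
  rw [enorm_smul]
  gcongr
  rw [← ofReal_norm]
  exact ENNReal.ofReal_le_ofReal (hc y)

lemma exists_norm_le_of_hasCompactSupport {φ : EuclideanSpace ℝ (Fin d) → ℝ} (hφ : Continuous φ)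
    (hc : HasCompactSupport φ) : ∃ c, ∀ y, ‖φ y‖ ≤ c := hc.exists_bound_of_continuous hφ

lemma tendsto_integral_smul_of_eLpNorm_one {V : Set (EuclideanSpace ℝ (Fin d))} (hV : IsOpen V)
    {φ : EuclideanSpace ℝ (Fin d) → ℝ} (hφ : Continuous φ) (hφc : HasCompactSupport φ)
    (hφV : tsupport φ ⊆ V) {g : ℕ → EuclideanSpace ℝ (Fin d) → F}
    {g' : EuclideanSpace ℝ (Fin d) → F} (hg : ∀ n, LocallyIntegrableOn (g n) V)
    (hg' : LocallyIntegrableOn g' V)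
    (h : Tendsto (fun n => eLpNorm (g n - g') 1 (volume.restrict V)) atTop (𝓝 0)) :
    Tendsto (fun n => ∫ y, φ y • g n y) atTop (𝓝 (∫ y, φ y • g' y)) := by
  obtain ⟨c, hc⟩ := exists_norm_le_of_hasCompactSupport hφ hφc
  rw [tendsto_iff_edist_tendsto_0]
  have h1 : Tendsto (fun n => ENNReal.ofReal c * eLpNorm (g n - g') 1 (volume.restrict V)) atTop
      (𝓝 0) := by
    simpa using ENNReal.Tendsto.const_mul h (Or.inr ENNReal.ofReal_ne_top)
  refine tendsto_of_tendsto_of_tendsto_of_le_of_le tendsto_const_nhds h1 (fun _ => zero_le) fun n => ?_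
  simp only
  rw [edist_eq_enorm_sub, ← integral_sub (integrable_test_smul hφ hφc hφV (hg n))
    (integrable_test_smul hφ hφc hφV hg')]
  simp only [← smul_sub]
  exact enorm_integral_smul_le hc hφV (g n - g')

/-- Uniform limits of Cauchy sequences in the Sobolev norm. -/
theorem memSobolevOn_of_tendsto [CompleteSpace F] {V : Set (EuclideanSpace ℝ (Fin d))}
    (hV : IsOpen V) (hVt : volume V ≠ ⊤) {k : ℕ} {p : ℝ≥0} (hp : 1 ≤ p)
    {u : ℕ → EuclideanSpace ℝ (Fin d) → F} {w : EuclideanSpace ℝ (Fin d) → F}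
    (hu : ∀ n, MemSobolevOn V k p (u n)) (huc : ∀ n, ContinuousOn (u n) V) (hwc : ContinuousOn w V)
    (hcau : ∀ ε : ℝ, 0 < ε → ∃ N, ∀ m ≥ N, ∀ n ≥ N, sobolevNormOn V k p (u m - u n) ≤ ε)
    (hw : TendstoUniformlyOn u w atTop V) :
    MemSobolevOn V k p w ∧ Tendsto (fun n => sobolevNormOn V k p (u n - w)) atTop (𝓝 0) := by
  have hp1 : (1 : ENNReal) ≤ p := by exact_mod_cast hp
  have : Fact (1 ≤ (p : ENNReal)) := ⟨hp1⟩
  have hfm : IsFiniteMeasure (volume.restrict V) :=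
    ⟨by rw [Measure.restrict_apply_univ]; exact hVt.lt_top⟩
  -- The weak derivatives form Cauchy sequences in `L^p`; their limits are weak derivatives of `w`,
  -- by passing to the limit in the integral identities.
  have key : ∀ j ≤ k, ∀ J : Fin j → Fin d, ∃ g, IsWeakDeriv V J w g ∧
      MemLp g p (volume.restrict V) ∧
      Tendsto (fun n => eLpNorm (weakDeriv V J (u n) - g) p (volume.restrict V)) atTop (𝓝 0) := by
    intro j hj J
    have hm : ∀ n, MemLp (weakDeriv V J (u n)) p (volume.restrict V) := fun n =>
      (hu n).memLp hV hj J
    have hwd : ∀ n, IsWeakDeriv V J (u n) (weakDeriv V J (u n)) := fun n =>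
      (hu n).isWeakDeriv hj J
    have hle : ∀ m n, (eLpNorm (weakDeriv V J (u m) - weakDeriv V J (u n)) p
        (volume.restrict V)).toReal ≤ sobolevNormOn V k p (u m - u n) := by
      intro m n
      have h1 := ((hwd m).sub (hwd n)).ae_eq hV (((hu m).sub (hu n)).isWeakDeriv hj J)
      rw [eLpNorm_congr_ae h1]
      refine le_trans ?_ (Finset.single_le_sum (f := fun j => ∑ J : Fin j → Fin d,
        (eLpNorm (weakDeriv V J (u m - u n)) p (volume.restrict V)).toReal)
        (fun _ _ => Finset.sum_nonneg fun _ _ => ENNReal.toReal_nonneg)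
        (Finset.mem_range.2 (Nat.lt_succ_of_le hj)))
      exact Finset.single_le_sum (f := fun J : Fin j → Fin d =>
        (eLpNorm (weakDeriv V J (u m - u n)) p (volume.restrict V)).toReal)
        (fun _ _ => ENNReal.toReal_nonneg) (Finset.mem_univ J)
    have hcs : CauchySeq fun n => (hm n).toLp := by
      rw [Metric.cauchySeq_iff]
      intro ε hε
      obtain ⟨N, hN⟩ := hcau (ε / 2) (by positivity)
      refine ⟨N, fun m hm' n hn => ?_⟩
      rw [dist_eq_norm, ← MemLp.toLp_sub, Lp.norm_toLp]
      exact ((hle m n).trans (hN m hm' n hn)).trans_lt (by linarith)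
    obtain ⟨g₀, hg⟩ := cauchySeq_tendsto_of_complete hcs
    set g : EuclideanSpace ℝ (Fin d) → F := ⇑g₀ with hgdef
    have hgp : MemLp g p (volume.restrict V) := Lp.memLp g₀
    have hlim : Tendsto (fun n => eLpNorm (weakDeriv V J (u n) - g) p (volume.restrict V)) atTop
        (𝓝 0) := by
      rw [Lp.tendsto_Lp_iff_tendsto_eLpNorm'] at hg
      refine hg.congr fun n => eLpNorm_congr_ae ?_
      filter_upwards [(hm n).coeFn_toLp] with y hy
      simp only [Pi.sub_apply, hy, hgdef]
    have hgl : LocallyIntegrableOn g V := (show IntegrableOn g V volume from hgp.integrable hp1).locallyIntegrableOn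
    refine ⟨g, ⟨hwc.locallyIntegrableOn hV.measurableSet, hgl, fun φ hφ hc hφV => ?_⟩, hgp, hlim⟩
    -- Integrals against bounded test functions need only `L^1` convergence, which is weaker because
    -- `V` has finite volume.
    have h1 : Tendsto (fun n => eLpNorm (weakDeriv V J (u n) - g) 1 (volume.restrict V)) atTop
        (𝓝 0) := by
      set c : ENNReal := volume V ^ (1 / (1 : ENNReal).toReal - 1 / (p : ENNReal).toReal)
      have hc : c ≠ ⊤ := by
        refine ENNReal.rpow_ne_top_of_nonneg ?_ hVt
        rw [ENNReal.toReal_one, ENNReal.coe_toReal, one_div_one, sub_nonneg,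
          div_le_one (by positivity)]
        exact_mod_cast hp
      have h2 : Tendsto (fun n => eLpNorm (weakDeriv V J (u n) - g) p (volume.restrict V) * c) atTop
          (𝓝 0) := by
        simpa using ENNReal.Tendsto.mul_const hlim (Or.inr hc)
      refine tendsto_of_tendsto_of_tendsto_of_le_of_le tendsto_const_nhds h2 (fun _ => zero_le)
        fun n => ?_
      have h3 := eLpNorm_le_eLpNorm_mul_rpow_measure_univ hp1 ((hm n).sub hgp).1
      rwa [Measure.restrict_apply_univ] at h3
    have h2 : Tendsto (fun n => eLpNorm (u n - w) 1 (volume.restrict V)) atTop (𝓝 0) := by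
      rw [ENNReal.tendsto_nhds_zero]
      intro ε hε
      rcases eq_or_ne ε ⊤ with rfl | hεt
      · exact Eventually.of_forall fun _ => le_top
      have h5 : 0 < ε / (volume V + 1) := ENNReal.div_pos hε.ne' (by finiteness)
      have h6 : ε / (volume V + 1) ≠ ⊤ := ENNReal.div_ne_top hεt (by simp)
      filter_upwards [Metric.tendstoUniformlyOn_iff.1 hw _ (ENNReal.toReal_pos h5.ne' h6)] with n hn
      have h7 := eLpNorm_le_of_ae_bound (μ := volume.restrict V) (p := 1) (f := u n - w)
        (C := (ε / (volume V + 1)).toReal) ((ae_restrict_iff' hV.measurableSet).2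
          (Eventually.of_forall fun y hy => by
            rw [Pi.sub_apply, ← dist_eq_norm, dist_comm]
            exact (hn y hy).le))
      refine h7.trans ?_
      rw [ENNReal.ofReal_toReal h6, Measure.restrict_apply_univ, ENNReal.toReal_one, inv_one,
        ENNReal.rpow_one]
      calc volume V * (ε / (volume V + 1)) ≤ (volume V + 1) * (ε / (volume V + 1)) := by
            gcongr; exact le_self_add
        _ = ε := ENNReal.mul_div_cancel (by simp) (by finiteness)
    have hcd : HasCompactSupport (partialDeriv J φ) :=
      hc.of_isClosed_subset (isClosed_tsupport _) (tsupport_partialDeriv_subset J φ)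
    have h3 := tendsto_integral_smul_of_eLpNorm_one hV (continuous_partialDeriv J hφ) hcd
      ((tsupport_partialDeriv_subset J φ).trans hφV)
      (fun n => (huc n).locallyIntegrableOn hV.measurableSet)
      (hwc.locallyIntegrableOn hV.measurableSet) h2
    have h4 := (tendsto_integral_smul_of_eLpNorm_one hV hφ.continuous hc hφV
      (fun n => (hwd n).2.1) hgl h1).const_smul ((-1 : ℝ) ^ j)
    exact tendsto_nhds_unique h3 (h4.congr fun n => ((hwd n).2.2 φ hφ hc hφV).symm)
  have hmem : MemSobolevOn V k p w := fun j hj J => by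
    obtain ⟨g, h1, h2, -⟩ := key j hj J
    exact ⟨g, h1, h2⟩
  refine ⟨hmem, ?_⟩
  have hz : (0 : ℝ) = ∑ j ∈ Finset.range (k + 1), ∑ _J : Fin j → Fin d, (0 : ENNReal).toReal := by
    simp
  rw [hz]
  refine tendsto_finsetSum _ fun j hj => tendsto_finsetSum _ fun J _ => ?_
  have hj : j ≤ k := Nat.lt_succ_iff.1 (Finset.mem_range.1 hj)
  obtain ⟨g, h1, h2, h3⟩ := key j hj J
  refine (ENNReal.tendsto_toReal ENNReal.zero_ne_top).comp (h3.congr fun n => ?_)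
  exact eLpNorm_congr_ae ((((hu n).isWeakDeriv hj J).sub h1).ae_eq hV
    (((hu n).sub hmem).isWeakDeriv hj J))

/-- On the convex set `s` the mean value inequality bounds the increments of `f m - f N` by the
distance of the derivatives; let `m → ∞` and compare with the expansion of `f N`. Derivatives within
`s` are used so that boundary points are included. -/
lemma hasFDerivWithinAt_of_tendstoUniformlyOn {E G : Type*} [NormedAddCommGroup E] [NormedSpace ℝ E]
    [NormedAddCommGroup G] [NormedSpace ℝ G] {s : Set E} (hs : Convex ℝ s) {f : ℕ → E → G}
    {f' : ℕ → E → E →L[ℝ] G} {g : E → G} {g' : E → E →L[ℝ] G}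
    (hf : ∀ n, ∀ x ∈ s, HasFDerivWithinAt (f n) (f' n x) s x)
    (hfg : ∀ x ∈ s, Tendsto (fun n => f n x) atTop (𝓝 (g x)))
    (hf' : TendstoUniformlyOn f' g' atTop s) {x : E} (hx : x ∈ s) :
    HasFDerivWithinAt g (g' x) s x := by
  refine HasFDerivWithinAt.of_isLittleO (Asymptotics.isLittleO_iff.2 fun ε hε => ?_)
  -- With `ε / 6` two of the derivatives differ by at most `ε / 3`.
  obtain ⟨N, hN⟩ := eventually_atTop.1 (Metric.tendstoUniformlyOn_iff.1 hf' (ε / 6) (by positivity))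
  have h1 := Asymptotics.isLittleO_iff.1 (hf N x hx).isLittleO (c := ε / 3) (by positivity)
  filter_upwards [h1, self_mem_nhdsWithin] with y hy hys
  have h2 : ∀ m ≥ N, ‖(f m y - f N y) - (f m x - f N x)‖ ≤ ε / 3 * ‖y - x‖ := fun m hm =>
    hs.norm_image_sub_le_of_norm_hasFDerivWithin_le (f := fun z => f m z - f N z)
      (f' := fun z => f' m z - f' N z) (fun z hz => (hf m z hz).fun_sub (hf N z hz))
      (fun z hz => by
        have h3 := hN m hm z hz
        have h4 := hN N le_rfl z hz
        rw [dist_eq_norm] at h3 h4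
        calc ‖f' m z - f' N z‖ = ‖(g' z - f' N z) - (g' z - f' m z)‖ := by congr 1; abel
          _ ≤ _ := (norm_sub_le _ _).trans (by linarith)) hx hys
  have h3 : ‖(g y - f N y) - (g x - f N x)‖ ≤ ε / 3 * ‖y - x‖ := by
    refine le_of_tendsto ((((hfg y hys).sub_const _).sub ((hfg x hx).sub_const _)).norm) ?_
    filter_upwards [eventually_ge_atTop N] with m hm using h2 m hm
  have h4 : ‖(f' N x - g' x) (y - x)‖ ≤ ε / 3 * ‖y - x‖ := by
    refine (ContinuousLinearMap.le_opNorm _ _).trans ?_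
    gcongr
    have := hN N le_rfl x hx
    rw [dist_comm, dist_eq_norm] at this
    linarith
  have h5 : g y - g x - g' x (y - x) = ((g y - f N y) - (g x - f N x)) +
      (f N y - f N x - f' N x (y - x)) + (f' N x - g' x) (y - x) := by
    rw [sub_apply]; abel
  rw [h5]
  refine (norm_add₃_le).trans ?_
  linarith

/-- Limits of `C^k` functions on convex sets. -/
theorem contDiffOn_of_uniformCauchySeqOn [CompleteSpace F] {E : Type*} [NormedAddCommGroup E]
    [NormedSpace ℝ E] {s : Set E} (hs : Convex ℝ s) (hsu : UniqueDiffOn ℝ s) {k : ℕ}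
    {f : ℕ → E → F} {g : E → F} (hf : ∀ n, ContDiffOn ℝ k (f n) s)
    (hfg : ∀ x ∈ s, Tendsto (fun n => f n x) atTop (𝓝 (g x)))
    (hc : ∀ j ≤ k, UniformCauchySeqOn (fun n => iteratedFDerivWithin ℝ j (f n) s) atTop s) :
    ContDiffOn ℝ k g s ∧ ∀ j ≤ k, ∀ x ∈ s, Tendsto (fun n => iteratedFDerivWithin ℝ j (f n) s x)
      atTop (𝓝 (iteratedFDerivWithin ℝ j g s x)) := by
  have h1 : ∀ j, ∃ P : E → ContinuousMultilinearMap ℝ (fun _ : Fin j => E) F, j ≤ k →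
      TendstoUniformlyOn (fun n => iteratedFDerivWithin ℝ j (f n) s) P atTop s := by
    intro j
    by_cases hj : j ≤ k
    · have h2 : ∀ x, ∃ z, x ∈ s → Tendsto (fun n => iteratedFDerivWithin ℝ j (f n) s x) atTop
          (𝓝 z) := fun x => by
        by_cases hx : x ∈ s
        · obtain ⟨z, hz⟩ := cauchySeq_tendsto_of_complete ((hc j hj).cauchySeq hx)
          exact ⟨z, fun _ => hz⟩
        · exact ⟨0, fun h => absurd h hx⟩
      choose P hP using h2
      exact ⟨P, fun _ => (hc j hj).tendstoUniformlyOn_of_tendsto hP⟩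
    · exact ⟨0, fun h => absurd h hj⟩
  choose P hP using h1
  -- The uniform limits of the derivatives of each order together form a Taylor series of `g`.
  have ht : HasFTaylorSeriesUpToOn k g (fun x j => P j x) s := by
    refine ⟨fun x hx => ?_, fun m hm x hx => ?_, fun m hm => ?_⟩
    · have h2 := ((hP 0 (Nat.zero_le k)).tendsto_at hx)
      have h3 := ((continuousMultilinearCurryFin0 ℝ E F).continuous.tendsto _).comp h2
      refine tendsto_nhds_unique h3 ((hfg x hx).congr fun n => ?_)
      simp [iteratedFDerivWithin_zero_apply]
    · have hm : m < k := by exact_mod_cast hm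
      refine hasFDerivWithinAt_of_tendstoUniformlyOn hs
        (f := fun n => iteratedFDerivWithin ℝ m (f n) s)
        (f' := fun n x => (iteratedFDerivWithin ℝ (m + 1) (f n) s x).curryLeft)
        (g' := fun x => (P (m + 1) x).curryLeft)
        (fun n y hy => ((hf n).ftaylorSeriesWithin hsu).fderivWithin m (by exact_mod_cast hm) y hy)
        (fun y hy => (hP m hm.le).tendsto_at hy) ?_ hx
      exact (continuousMultilinearCurryLeftEquiv ℝ (fun _ : Fin (m + 1) => E)
        F).lipschitz.uniformContinuous.comp_tendstoUniformlyOn (hP (m + 1) hm)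
    · have hm : m ≤ k := by exact_mod_cast hm
      exact (hP m hm).continuousOn (Frequently.of_forall fun n =>
        (hf n).continuousOn_iteratedFDerivWithin (by exact_mod_cast hm) hsu)
  have ht' : HasFTaylorSeriesUpToOn ((k : ℕ∞) : WithTop ℕ∞) g (fun x j => P j x) s := by
    exact_mod_cast ht
  refine ⟨by exact_mod_cast ht'.contDiffOn, fun j hj x hx => ?_⟩
  rw [← ht.eq_iteratedFDerivWithin_of_uniqueDiffOn (by exact_mod_cast hj) hsu hx]
  exact (hP j hj).tendsto_at hx

end Limits

/-! ### The norms of the regularity classes -/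

section RegularityNorms

open Filter

variable {d : ℕ} {H : Type*} [TopologicalSpace H]
  {I : ModelWithCorners ℝ (EuclideanSpace ℝ (Fin d)) H}
  {S : Type*} [TopologicalSpace S] [ChartedSpace H S]
  {F : Type*} [NormedAddCommGroup F] [NormedSpace ℂ F]

namespace Regularity

/-- The number of derivatives. -/
def order : Regularity d → ℕ
  | C k => k
  | W k _ _ _ _ => k

/-- The derivatives of order `j` are in `L^(exponent / j)`. -/
def exponent : Regularity d → ENNReal
  | C _ => ⊤
  | W k p _ _ _ => (k * p : ℝ≥0)

lemma le_exponent (R : Regularity d) : (R.order : ENNReal) ≤ R.exponent := by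
  cases R with
  | C k => exact le_top
  | W k p hk hp _ =>
    calc ((k : ℕ) : ENNReal) = ((k : ℝ≥0) : ENNReal) := by simp
      _ ≤ _ := by
        simp only [exponent]
        exact_mod_cast le_mul_of_one_le_right (zero_le (a := (k : ℝ≥0))) hp

lemma exponent_ne_zero (R : Regularity d) : R.exponent ≠ 0 := by
  cases R with
  | C k => exact ENNReal.top_ne_zero
  | W k p hk hp _ =>
    simp only [exponent]
    exact_mod_cast (mul_pos (by exact_mod_cast hk : (0 : ℝ≥0) < k) (zero_lt_one.trans_le hp)).ne'

lemma one_le_exponent_div (R : Regularity d) {j : ℕ} (hj : j ≤ R.order) :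
    1 ≤ R.exponent / j := by
  rw [ENNReal.le_div_iff_mul_le (Or.inr R.exponent_ne_zero) (Or.inl (by finiteness)), one_mul]
  exact le_trans (by exact_mod_cast hj) R.le_exponent

end Regularity

lemma DominatedOn.comp {α β : Type*} {s : Set α} {t : Set β} {a b : α → ENNReal}
    (h : DominatedOn s a b) {φ : β → α} (hφ : MapsTo φ t s) :
    DominatedOn t (a ∘ φ) (b ∘ φ) := by
  obtain ⟨C, hC⟩ := h
  exact ⟨C, fun f hf => hC _ (hφ hf)⟩

variable [IsManifold I ∞ S] [CompactSpace S] (𝔄 : FiniteAtlas I S)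

lemma FiniteAtlas.norm_chartJet_le_ckNorm {k j : ℕ} (hj : j ≤ k) {f : S → F}
    (hf : ContMDiff I 𝓘(ℝ, F) k f) (i : Fin 𝔄.card) {s : S} (hs : s ∈ 𝔄.dom i) :
    ‖chartJet I (𝔄.chart i) j f ((𝔄.chart i).extend I s)‖ ≤ 𝔄.ckNorm k f := by
  refine (le_ciSup (𝔄.bddAbove_ck hj hf i) ⟨s, hs⟩).trans ?_
  refine le_trans ?_ (Finset.single_le_sum (f := fun i => ∑ j ∈ Finset.range (k + 1),
    ⨆ s : 𝔄.dom i, ‖iteratedFDerivWithin ℝ j (𝔄.read i f) ((𝔄.chart i).extend I).target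
      ((𝔄.chart i).extend I s)‖) (fun _ _ => Finset.sum_nonneg fun _ _ =>
        Real.iSup_nonneg fun _ => norm_nonneg _) (Finset.mem_univ i))
  exact Finset.single_le_sum (f := fun j => ⨆ s : 𝔄.dom i, ‖iteratedFDerivWithin ℝ j (𝔄.read i f)
    ((𝔄.chart i).extend I).target ((𝔄.chart i).extend I s)‖)
    (fun _ _ => Real.iSup_nonneg fun _ => norm_nonneg _)
    (Finset.mem_range.2 (Nat.lt_succ_of_le hj))

lemma FiniteAtlas.chartJet_sub {k j : ℕ} (hj : j ≤ k) {f g : S → F}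
    (hf : ContMDiff I 𝓘(ℝ, F) k f) (hg : ContMDiff I 𝓘(ℝ, F) k g) (i : Fin 𝔄.card)
    {y : EuclideanSpace ℝ (Fin d)} (hy : y ∈ ((𝔄.chart i).extend I).target) :
    chartJet I (𝔄.chart i) j (f - g) y =
      chartJet I (𝔄.chart i) j f y - chartJet I (𝔄.chart i) j g y := by
  have hjk : (j : WithTop ℕ∞) ≤ k := by exact_mod_cast hj
  exact iteratedFDerivWithin_sub_apply (((𝔄.contDiffOn_read hf i) _ hy).of_le hjk)
    (((𝔄.contDiffOn_read hg i) _ hy).of_le hjk) (uniqueDiffOn_chartTarget _) hy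

lemma ContMDiff.sub' {k : ℕ} {f g : S → F} (hf : ContMDiff I 𝓘(ℝ, F) k f)
    (hg : ContMDiff I 𝓘(ℝ, F) k g) : ContMDiff I 𝓘(ℝ, F) k (f - g) :=
  ((contDiff_fst.sub contDiff_snd).contMDiff (n := k)).comp (hf.prodMk_space hg)

/-- Uniform limits of Cauchy sequences in the `C^k` norm. -/
theorem FiniteAtlas.contMDiff_of_tendsto [CompleteSpace F] {k : ℕ} {x : ℕ → S → F} {y : S → F}
    (hx : ∀ n, ContMDiff I 𝓘(ℝ, F) k (x n))
    (hcau : ∀ ε : ℝ, 0 < ε → ∃ N, ∀ m ≥ N, ∀ n ≥ N, 𝔄.ckNorm k (x m - x n) ≤ ε)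
    (hy : ∀ s, Tendsto (fun n => x n s) atTop (𝓝 (y s))) :
    ContMDiff I 𝓘(ℝ, F) k y ∧ ∀ i, ∀ j ≤ k, ∀ s ∈ 𝔄.dom i,
      Tendsto (fun n => chartJet I (𝔄.chart i) j (x n) ((𝔄.chart i).extend I s)) atTop
        (𝓝 (chartJet I (𝔄.chart i) j y ((𝔄.chart i).extend I s))) := by
  have hk : (k : WithTop ℕ∞) ≤ ∞ := by exact_mod_cast le_top
  have : IsManifold I k S := IsManifold.of_le hk
  have key : ∀ i, ∀ s ∈ 𝔄.dom i, ContMDiffAt I 𝓘(ℝ, F) k y s ∧ ∀ j ≤ k,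
      Tendsto (fun n => chartJet I (𝔄.chart i) j (x n) ((𝔄.chart i).extend I s)) atTop
        (𝓝 (chartJet I (𝔄.chart i) j y ((𝔄.chart i).extend I s))) := by
    intro i s hs
    have hds : 𝔄.dom i ⊆ (𝔄.chart i).source := subset_closure.trans (𝔄.closure_dom_subset i)
    obtain ⟨O, hO, hOd⟩ := exists_image_extend_eq (I := I) (𝔄.chart i) (𝔄.isOpen_dom i) hds
    have hsO : (𝔄.chart i).extend I s ∈ O := (hOd ▸ mem_image_of_mem _ hs :
      (𝔄.chart i).extend I s ∈ O ∩ range I).1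
    obtain ⟨ρ, hρ, hball⟩ := Metric.isOpen_iff.1 hO _ hsO
    set B := Metric.ball ((𝔄.chart i).extend I s) ρ
    -- A convex neighborhood of the point in the half-space, as the limit theorem needs; near its
    -- points it agrees with the chart target, so the jets are the same.
    set Q := range I ∩ B
    have hQd : Q ⊆ (𝔄.chart i).extend I '' 𝔄.dom i := by
      rw [hOd]
      exact fun z hz => ⟨hball hz.2, hz.1⟩
    have hQt : Q ⊆ ((𝔄.chart i).extend I).target :=
      hQd.trans (image_extend_subset_target _ hds)
    have hset : ∀ z ∈ Q, ((𝔄.chart i).extend I).target =ᶠ[𝓝 z] Q := by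
      intro z hz
      obtain ⟨t, ht, rfl⟩ := hQd hz
      refine ((𝔄.chart i).extend_target_eventuallyEq (hds ht)).trans ?_
      exact (inter_eventuallyEq_left.2 (Filter.mem_of_superset (Metric.isOpen_ball.mem_nhds hz.2)
        fun w hw _ => hw)).symm
    have hjet : ∀ (f : S → F) (j : ℕ), ∀ z ∈ Q,
        iteratedFDerivWithin ℝ j (𝔄.read i f) Q z = chartJet I (𝔄.chart i) j f z :=
      fun f j z hz => (iteratedFDerivWithin_congr_set (hset z hz) j).symm
    have hconv : Convex ℝ Q := I.convex_range.inter (convex_ball _ _)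
    have hu : UniqueDiffOn ℝ Q := I.uniqueDiffOn.inter Metric.isOpen_ball
    have hsQ : (𝔄.chart i).extend I s ∈ Q := ⟨by simp, Metric.mem_ball_self hρ⟩
    have h := contDiffOn_of_uniformCauchySeqOn hconv hu (f := fun n => 𝔄.read i (x n))
      (g := 𝔄.read i y) (k := k) (fun n => (𝔄.contDiffOn_read (hx n) i).mono hQt)
      (fun z _ => hy _) (fun j hj => by
        rw [Metric.uniformCauchySeqOn_iff]
        intro ε hε
        obtain ⟨N, hN⟩ := hcau (ε / 2) (by positivity)
        refine ⟨N, fun m hm n hn z hz => ?_⟩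
        rw [hjet _ _ z hz, hjet _ _ z hz, dist_eq_norm,
          ← 𝔄.chartJet_sub hj (hx m) (hx n) i (hQt hz)]
        obtain ⟨t, ht, rfl⟩ := hQd hz
        refine ((𝔄.norm_chartJet_le_ckNorm hj ((hx m).sub' (hx n)) i ht).trans
          (hN m hm n hn)).trans_lt (by linarith))
    refine ⟨?_, fun j hj => ?_⟩
    · rw [← contMDiffWithinAt_univ, contMDiffWithinAt_iff_source_of_mem_maximalAtlas
        (IsManifold.maximalAtlas_subset_of_le hk (𝔄.chart_mem i)) (hds hs),
        contMDiffWithinAt_iff_contDiffWithinAt, preimage_univ, univ_inter]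
      refine (h.1 _ hsQ).mono_of_mem_nhdsWithin ?_
      exact Filter.inter_mem self_mem_nhdsWithin
        (mem_nhdsWithin_of_mem_nhds (Metric.ball_mem_nhds _ hρ))
    · have h1 := h.2 j hj _ hsQ
      simp only [hjet _ _ _ hsQ] at h1
      exact h1
  refine ⟨fun s => ?_, fun i j hj s hs => (key i s hs).2 j hj⟩
  obtain ⟨i, hi⟩ := mem_iUnion.1 (𝔄.iUnion_dom ▸ mem_univ s)
  exact (key i s hi).1

namespace Regularity

variable (R : Regularity d)

lemma mem_of_contMDiff {f : C(S, F)} (hf : ContMDiff I 𝓘(ℝ, F) R.order f) : R.Mem 𝔄 f := by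
  cases R with
  | C k => exact hf
  | W k p _ _ _ =>
    refine fun i => memSobolevOn_of_contDiffOn (𝔄.isOpen_coordDom i)
      (𝔄.contDiffOn_read_coordDom hf i) fun j hj => ?_
    rw [← 𝔄.jetNorm_eq]
    exact (𝔄.jetNorm_lt_top hj hf i p).ne

/-- The norm of a `C^k` function is dominated by the norms of its derivatives. -/
theorem dominatedOn_normOn [CompleteSpace F] :
    DominatedOn {f : C(S, F) | ContMDiff I 𝓘(ℝ, F) R.order f}
      (fun f => ENNReal.ofReal (R.normOn 𝔄 f))
      (fun f => ∑ i, ∑ j ∈ Finset.range (R.order + 1), 𝔄.jetNorm i j (R.exponent / j) f) := by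
  cases R with
  | C k =>
    refine DominatedOn.of_le fun f hf => ?_
    simp only [normOn, FiniteAtlas.ckNorm]
    rw [ENNReal.ofReal_sum_of_nonneg (fun _ _ => Finset.sum_nonneg fun _ _ =>
      Real.iSup_nonneg fun _ => norm_nonneg _)]
    refine Finset.sum_le_sum fun i _ => ?_
    rw [ENNReal.ofReal_sum_of_nonneg (fun _ _ => Real.iSup_nonneg fun _ => norm_nonneg _)]
    refine Finset.sum_le_sum fun j hj => ?_
    have hj : j ≤ k := Nat.lt_succ_iff.1 (Finset.mem_range.1 hj)
    have htop := (𝔄.jetNorm_lt_top hj hf i ⊤).ne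
    simp only [exponent]
    rw [ENNReal.top_div_of_ne_top (by finiteness)]
    refine ENNReal.ofReal_le_of_le_toReal (Real.iSup_le (fun s => ?_) ENNReal.toReal_nonneg)
    rw [← ENNReal.ofReal_le_iff_le_toReal htop, ofReal_norm]
    exact 𝔄.enorm_le_eLpNorm_top i (continuousOn_chartJet (𝔄.chart_mem i) hj hf) s.2
  | W k p hk hp hdP =>
    have h1 : DominatedOn {f : C(S, F) | ContMDiff I 𝓘(ℝ, F) k f}
        (fun f => ENNReal.ofReal ((W k p hk hp hdP).normOn 𝔄 f))
        (fun f => ∑ i, ∑ j ∈ Finset.range (k + 1), ∑ _J : Fin j → Fin d, 𝔄.jetNorm i j p f) := by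
      refine DominatedOn.of_le fun f hf => ?_
      simp only [normOn, sobolevNormOn]
      rw [ENNReal.ofReal_sum_of_nonneg (fun _ _ => Finset.sum_nonneg fun _ _ =>
        Finset.sum_nonneg fun _ _ => ENNReal.toReal_nonneg)]
      refine Finset.sum_le_sum fun i _ => ?_
      rw [ENNReal.ofReal_sum_of_nonneg (fun _ _ => Finset.sum_nonneg fun _ _ =>
        ENNReal.toReal_nonneg)]
      refine Finset.sum_le_sum fun j hj => ?_
      rw [ENNReal.ofReal_sum_of_nonneg (fun _ _ => ENNReal.toReal_nonneg)]
      refine Finset.sum_le_sum fun J _ => ENNReal.ofReal_toReal_le.trans ?_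
      rw [𝔄.jetNorm_eq]
      exact eLpNorm_weakDeriv_le (𝔄.isOpen_coordDom i) (𝔄.contDiffOn_read_coordDom hf i)
        (Nat.lt_succ_iff.1 (Finset.mem_range.1 hj)) J
    refine h1.trans (DominatedOn.sum _ fun i _ => DominatedOn.sum _ fun j hj =>
      DominatedOn.sum _ fun J _ => ?_)
    have hjk : j ≤ k := Nat.lt_succ_iff.1 (Finset.mem_range.1 hj)
    -- As `j ≤ k`, the `L^(P / j)` norm dominates the `L^p` norm on sets of finite volume.
    have hle : (p : ENNReal) ≤ (k * p : ℝ≥0) / j := by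
      have h0 : ((k * p : ℝ≥0) : ENNReal) ≠ 0 := (W k p hk hp hdP).exponent_ne_zero
      rw [ENNReal.le_div_iff_mul_le (Or.inr h0) (Or.inl (by finiteness)), mul_comm]
      push_cast
      gcongr
    refine ((𝔄.dominatedOn_jetNorm_of_le (F := F) hjk i hle (by exact_mod_cast hp)).comp
      (φ := fun f : C(S, F) => (f : S → F)) fun f hf => hf).trans (DominatedOn.of_le fun f _ => ?_)
    refine le_trans ?_ (Finset.single_le_sum (f := fun i => ∑ j ∈ Finset.range (k + 1),
      𝔄.jetNorm i j ((k * p : ℝ≥0) / j) f) (fun _ _ => zero_le) (Finset.mem_univ i))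
    exact Finset.single_le_sum (f := fun j : ℕ => 𝔄.jetNorm i j ((k * p : ℝ≥0) / j) f)
      (fun _ _ => zero_le) hj

lemma jetNorm_le_ofReal_sobolev [CompleteSpace F] {k : ℕ} {p : ℝ≥0} (hp : 1 ≤ p) {f : S → F}
    (hf : ContMDiff I 𝓘(ℝ, F) k f) {j : ℕ} (hj : j ≤ k) (i : Fin 𝔄.card) :
    𝔄.jetNorm i j p f ≤ ENNReal.ofReal (∑ i, sobolevNormOn (𝔄.coordDom i) k p (𝔄.read i f)) := by
  rw [𝔄.jetNorm_eq]
  refine (eLpNorm_iteratedFDeriv_le_sum_weakDeriv (𝔄.isOpen_coordDom i) hp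
    (𝔄.contDiffOn_read_coordDom hf i) hj).trans ?_
  have hfin : ∀ J : Fin j → Fin d, eLpNorm (weakDeriv (𝔄.coordDom i) J (𝔄.read i f)) p
      (volume.restrict (𝔄.coordDom i)) ≠ ⊤ := fun J => by
    refine ((eLpNorm_weakDeriv_le (𝔄.isOpen_coordDom i) (𝔄.contDiffOn_read_coordDom hf i) hj
      J).trans_lt ?_).ne
    rw [← 𝔄.jetNorm_eq]
    exact 𝔄.jetNorm_lt_top hj hf i p
  rw [← ENNReal.ofReal_toReal (ENNReal.sum_ne_top.2 fun J _ => hfin J)]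
  refine ENNReal.ofReal_le_ofReal ?_
  rw [ENNReal.toReal_sum fun J _ => hfin J]
  refine le_trans ?_ (Finset.single_le_sum (f := fun i =>
    sobolevNormOn (𝔄.coordDom i) k p (𝔄.read i f)) (fun _ _ => sobolevNormOn_nonneg _ _ _ _)
    (Finset.mem_univ i))
  exact Finset.single_le_sum (f := fun j => ∑ J : Fin j → Fin d,
    (eLpNorm (weakDeriv (𝔄.coordDom i) J (𝔄.read i f)) p (volume.restrict (𝔄.coordDom i))).toReal)
    (fun _ _ => Finset.sum_nonneg fun _ _ => ENNReal.toReal_nonneg)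
    (Finset.mem_range.2 (Nat.lt_succ_of_le hj))

/-- The derivatives of a `C^k` function are dominated by its norm. -/
theorem dominatedOn_jetNorm [T2Space S] [CompleteSpace F]
    (hI : range I = univ ∨ ∃ l : EuclideanSpace ℝ (Fin d) →L[ℝ] ℝ, l ≠ 0 ∧ range I = {v | 0 ≤ l v})
    (i : Fin 𝔄.card) {j : ℕ} (hj : j ≤ R.order) :
    DominatedOn {f : C(S, F) | ContMDiff I 𝓘(ℝ, F) R.order f}
      (fun f => 𝔄.jetNorm i j (R.exponent / j) f)
      (fun f => ENNReal.ofReal (R.normOn 𝔄 f)) := by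
  cases R with
  | C k =>
    refine DominatedOn.of_le fun f hf => ?_
    simp only [exponent]
    rw [ENNReal.top_div_of_ne_top (by finiteness)]
    have h := eLpNorm_le_of_ae_bound (p := ⊤) (μ := volume.restrict (𝔄.coordDom i))
      (f := chartJet I (𝔄.chart i) j f) (C := 𝔄.ckNorm k f)
      ((ae_restrict_iff' (𝔄.isOpen_coordDom i).measurableSet).2
        (Eventually.of_forall fun y hy => by
          obtain ⟨s, hs, rfl⟩ := interior_subset hy
          exact 𝔄.norm_chartJet_le_ckNorm hj hf i hs))
    rwa [ENNReal.toReal_top, inv_zero, ENNReal.rpow_zero, one_mul] at h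
  | W k p hk hp hdP =>
    refine ((𝔄.dominatedOn_jetNorm_div (F := F) hI hk hp hdP hj i).comp
      (φ := fun f : C(S, F) => (f : S → F)) fun f hf => hf).trans ?_
    exact DominatedOn.sum _ fun m _ => DominatedOn.sum _ fun l hl => DominatedOn.of_le fun f hf =>
      jetNorm_le_ofReal_sobolev 𝔄 hp hf (Nat.lt_succ_iff.1 (Finset.mem_range.1 hl)) m

/-- Uniform limits of Cauchy sequences. -/
theorem mem_of_tendstoUniformly [CompleteSpace F] {x : ℕ → C(S, F)} (hx : ∀ n, R.Mem 𝔄 (x n))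
    (hcau : ∀ ε : ℝ, 0 < ε → ∃ N, ∀ m ≥ N, ∀ n ≥ N, R.normOn 𝔄 (x m - x n) ≤ ε) {y : C(S, F)}
    (hy : TendstoUniformly (fun n s => x n s) y atTop) :
    R.Mem 𝔄 y ∧ Tendsto (fun n => R.normOn 𝔄 (x n - y)) atTop (𝓝 0) := by
  cases R with
  | C k =>
    have hx' : ∀ n, ContMDiff I 𝓘(ℝ, F) k (x n) := hx
    have h := 𝔄.contMDiff_of_tendsto hx' hcau fun s => hy.tendsto_at s
    refine ⟨h.1, ?_⟩
    rw [Metric.tendsto_atTop]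
    intro ε hε
    -- The number of terms in the `C^k` norm, plus one to make the final inequality strict.
    set c : ℝ := 𝔄.card * (k + 1) + 1
    have hc : 0 < c := by positivity
    obtain ⟨N, hN⟩ := hcau (ε / c) (by positivity)
    refine ⟨N, fun n hn => ?_⟩
    rw [Real.dist_eq, sub_zero]
    change |𝔄.ckNorm k (x n - y)| < ε
    rw [abs_of_nonneg (𝔄.ckNorm_nonneg k _)]
    have h1 : ∀ i, ∀ j ≤ k, ∀ s ∈ 𝔄.dom i,
        ‖chartJet I (𝔄.chart i) j (x n - y) ((𝔄.chart i).extend I s)‖ ≤ ε / c := by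
      intro i j hj s hs
      have ht : (𝔄.chart i).extend I s ∈ ((𝔄.chart i).extend I).target :=
        𝔄.extend_mem_target i ⟨s, hs⟩
      rw [ContinuousMap.coe_sub, 𝔄.chartJet_sub hj (hx' n) h.1 i ht]
      -- Let `m → ∞` in the Cauchy estimate at a fixed point; the bound stays uniform in the point.
      refine le_of_tendsto ((h.2 i j hj s hs).const_sub _).norm ?_
      filter_upwards [eventually_ge_atTop N] with m hm
      rw [← 𝔄.chartJet_sub hj (hx' n) (hx' m) i ht]
      exact (𝔄.norm_chartJet_le_ckNorm hj ((hx' n).sub' (hx' m)) i hs).trans (hN n hn m hm)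
    calc 𝔄.ckNorm k (x n - y) ≤ ∑ _i : Fin 𝔄.card, ∑ _j ∈ Finset.range (k + 1), ε / c := by
          refine Finset.sum_le_sum fun i _ => Finset.sum_le_sum fun j hj => ?_
          exact Real.iSup_le (fun s => h1 i j (Nat.lt_succ_iff.1 (Finset.mem_range.1 hj)) s s.2)
            (by positivity)
      _ = (𝔄.card * (k + 1)) * (ε / c) := by
          simp only [Finset.sum_const, Finset.card_univ, Fintype.card_fin, Finset.card_range,
            nsmul_eq_mul]
          push_cast
          ring
      _ < c * (ε / c) := by
          gcongr
          simp only [c]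
          linarith
      _ = ε := by field_simp
  | W k p hk hp hdP =>
    have h : ∀ i, MemSobolevOn (𝔄.coordDom i) k p (𝔄.read i y) ∧
        Tendsto (fun n => sobolevNormOn (𝔄.coordDom i) k p (𝔄.read i (x n) - 𝔄.read i y)) atTop
          (𝓝 0) := by
      intro i
      refine memSobolevOn_of_tendsto (𝔄.isOpen_coordDom i) (𝔄.volume_coordDom_ne_top i) hp
        (fun n => hx n i) (fun n => (𝔄.continuousOn_read i (x n)).mono (𝔄.coordDom_subset i))
        ((𝔄.continuousOn_read i y).mono (𝔄.coordDom_subset i)) (fun ε hε => ?_)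
        ((hy.comp _).tendstoUniformlyOn)
      obtain ⟨N, hN⟩ := hcau ε hε
      refine ⟨N, fun m hm n hn => le_trans ?_ (hN m hm n hn)⟩
      exact Finset.single_le_sum (f := fun i =>
        sobolevNormOn (𝔄.coordDom i) k p (𝔄.read i (x m - x n)))
        (fun _ _ => sobolevNormOn_nonneg _ _ _ _) (Finset.mem_univ i)
    refine ⟨fun i => (h i).1, ?_⟩
    have h2 := tendsto_finsetSum Finset.univ fun i _ => (h i).2
    rw [Finset.sum_const_zero] at h2
    exact h2

end Regularity

end RegularityNorms

/-! ### Density of `C^k` functions -/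

section Density

open Filter

variable {d : ℕ} {H : Type*} [TopologicalSpace H]
  {I : ModelWithCorners ℝ (EuclideanSpace ℝ (Fin d)) H}
  {S : Type*} [TopologicalSpace S] [ChartedSpace H S] [IsManifold I ∞ S] [CompactSpace S]
  {F : Type*} [NormedAddCommGroup F] [NormedSpace ℂ F] [CompleteSpace F] (𝔄 : FiniteAtlas I S)

namespace Regularity

variable (R : Regularity d)

lemma normOn_add_le {x y : C(S, F)} (hx : R.Mem 𝔄 x) (hy : R.Mem 𝔄 y) :
    R.normOn 𝔄 (x + y) ≤ R.normOn 𝔄 x + R.normOn 𝔄 y :=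
  (MapSpace.normedSpaceCore 𝔄 R ∅ (F := F)).norm_triangle ⟨x, hx, by simp⟩ ⟨y, hy, by simp⟩

lemma normOn_nonneg {x : C(S, F)} (hx : R.Mem 𝔄 x) : 0 ≤ R.normOn 𝔄 x :=
  (MapSpace.normedSpaceCore 𝔄 R ∅ (F := F)).norm_nonneg ⟨x, hx, by simp⟩

lemma normOn_zero : R.normOn 𝔄 (0 : C(S, F)) = 0 :=
  ((MapSpace.normedSpaceCore 𝔄 R ∅ (F := F)).norm_eq_zero_iff 0).2 rfl

variable {R} in
lemma Mem.sub {x y : C(S, F)} (hx : R.Mem 𝔄 x) (hy : R.Mem 𝔄 y) : R.Mem 𝔄 (x - y) := by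
  have := hx.add 𝔄 (hy.const_smul 𝔄 (-1))
  simpa [neg_smul, ← sub_eq_add_neg] using this

lemma normOn_sum_le {ι : Type*} (t : Finset ι) {x : ι → C(S, F)} (hx : ∀ i ∈ t, R.Mem 𝔄 (x i)) :
    R.Mem 𝔄 (∑ i ∈ t, x i) ∧ R.normOn 𝔄 (∑ i ∈ t, x i) ≤ ∑ i ∈ t, R.normOn 𝔄 (x i) := by
  classical
  induction t using Finset.induction_on with
  | empty => simpa [R.normOn_zero 𝔄] using R.mem_zero 𝔄
  | insert a t ha ih =>
    have h1 := ih fun i hi => hx i (Finset.mem_insert_of_mem hi)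
    have h2 := hx a (Finset.mem_insert_self a t)
    rw [Finset.sum_insert ha, Finset.sum_insert ha]
    exact ⟨h2.add 𝔄 h1.1, (R.normOn_add_le 𝔄 h2 h1.1).trans (by linarith [h1.2])⟩

end Regularity

/-! ### Localized functions in a single chart and their mollification. -/

namespace FiniteAtlas

lemma dominatedOn_sobolevNormOn {k : ℕ} {p : ℝ≥0} :
    DominatedOn {f : S → F | ContMDiff I 𝓘(ℝ, F) k f}
      (fun f => ENNReal.ofReal (∑ i, sobolevNormOn (𝔄.coordDom i) k p (𝔄.read i f)))
      (fun f => ∑ i, ∑ j ∈ Finset.range (k + 1), ∑ _J : Fin j → Fin d, 𝔄.jetNorm i j p f) := by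
  refine DominatedOn.of_le fun f hf => ?_
  simp only [sobolevNormOn]
  rw [ENNReal.ofReal_sum_of_nonneg (fun _ _ => Finset.sum_nonneg fun _ _ =>
    Finset.sum_nonneg fun _ _ => ENNReal.toReal_nonneg)]
  refine Finset.sum_le_sum fun i _ => ?_
  rw [ENNReal.ofReal_sum_of_nonneg (fun _ _ => Finset.sum_nonneg fun _ _ =>
    ENNReal.toReal_nonneg)]
  refine Finset.sum_le_sum fun j hj => ?_
  rw [ENNReal.ofReal_sum_of_nonneg (fun _ _ => ENNReal.toReal_nonneg)]
  refine Finset.sum_le_sum fun J _ => ENNReal.ofReal_toReal_le.trans ?_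
  rw [𝔄.jetNorm_eq]
  exact eLpNorm_weakDeriv_le (𝔄.isOpen_coordDom i) (𝔄.contDiffOn_read_coordDom hf i)
    (Nat.lt_succ_iff.1 (Finset.mem_range.1 hj)) J

/-- Smoothness has to be checked only on the support of `χ`, where the chart is smooth. -/
lemma contMDiff_smul_comp_extend (m : Fin 𝔄.card) {χ : S → ℝ} (hχ : ContMDiff I 𝓘(ℝ) ∞ χ)
    (hχm : tsupport χ ⊆ (𝔄.chart m).source) {w : EuclideanSpace ℝ (Fin d) → F}
    (hw : ContDiff ℝ ∞ w) :
    ContMDiff I 𝓘(ℝ, F) ∞ fun s => χ s • w ((𝔄.chart m).extend I s) := by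
  refine contMDiff_of_tsupport fun s hs => ?_
  have hs' : s ∈ (𝔄.chart m).source := hχm (tsupport_smul_subset_left _ _ hs)
  have he : ContMDiffAt I 𝓘(ℝ, EuclideanSpace ℝ (Fin d)) ∞ ((𝔄.chart m).extend I) s :=
    ((𝔄.chart m).contMDiffOn_extend (𝔄.chart_mem m)).contMDiffAt ((𝔄.chart m).open_source.mem_nhds hs')
  exact (hχ s).smul (hw.contMDiff.contMDiffAt.comp s he)

/-- Leibniz' rule; the derivatives of `χ` are bounded on the compact set and go into the constant.
-/
lemma dominatedOn_eLpNorm_chartJet_smul {k : ℕ} (m : Fin 𝔄.card) {K : Set S} (hK : IsCompact K)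
    (hKm : K ⊆ (𝔄.chart m).source) {χ : S → ℝ} (hχ : ContMDiff I 𝓘(ℝ) ∞ χ) {p : ℝ≥0} (hp : 1 ≤ p)
    {l : ℕ} (hl : l ≤ k) :
    DominatedOn {w : EuclideanSpace ℝ (Fin d) → F | ContDiff ℝ ∞ w}
      (fun w => eLpNorm (chartJet I (𝔄.chart m) l fun s => χ s • w ((𝔄.chart m).extend I s)) p
        (volume.restrict ((𝔄.chart m).extend I '' K)))
      (fun w => ∑ b ∈ Finset.range (k + 1), ∑ J : Fin b → Fin d,
        eLpNorm (coordDeriv J w) p (volume.restrict ((𝔄.chart m).extend I '' K))) := by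
  set L := (𝔄.chart m).extend I '' K
  have hp1 : (1 : ENNReal) ≤ p := by exact_mod_cast hp
  have hL : IsCompact L := isCompact_image_extend _ hK hKm
  have hLt : L ⊆ ((𝔄.chart m).extend I).target := image_extend_subset_target _ hKm
  have hu : UniqueDiffOn ℝ ((𝔄.chart m).extend I).target := uniqueDiffOn_chartTarget _
  have hχ' : ContMDiff I 𝓘(ℝ, ℝ) (k : ℕ) χ := hχ.of_le (by exact_mod_cast le_top)
  have hχc : ContDiffOn ℝ k (χ ∘ ((𝔄.chart m).extend I).symm) ((𝔄.chart m).extend I).target := by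
    have hk : (k : WithTop ℕ∞) ≤ ∞ := by exact_mod_cast le_top
    have hm : 𝔄.chart m ∈ IsManifold.maximalAtlas I k S :=
      IsManifold.maximalAtlas_subset_of_le hk (𝔄.chart_mem m)
    have : IsManifold I k S := IsManifold.of_le hk
    rw [← contMDiffOn_iff_contDiffOn, OpenPartialHomeomorph.extend_target']
    exact hχ'.comp_contMDiffOn (contMDiffOn_extend_symm hm)
  have hb : ∀ a : ℕ, ∃ c : ℝ, a ≤ k → ∀ y ∈ L, ‖iteratedFDerivWithin ℝ a
      (χ ∘ ((𝔄.chart m).extend I).symm) ((𝔄.chart m).extend I).target y‖ ≤ c := fun a => by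
    by_cases ha : a ≤ k
    · obtain ⟨c, hc⟩ := hL.exists_bound_of_continuousOn
        ((hχc.continuousOn_iteratedFDerivWithin (by exact_mod_cast ha) hu).mono hLt)
      exact ⟨c, fun _ => hc⟩
    · exact ⟨0, fun h => absurd h ha⟩
  choose c hc using hb
  -- `2 ^ k` bounds all the binomial coefficients that occur.
  set D : ℝ := ∑ a ∈ Finset.range (k + 1), (2 : ℝ) ^ k * |c a|
  have hD : ∀ a ≤ l, (l.choose a : ℝ) * |c a| ≤ D := fun a ha => by
    have h1 : (l.choose a : ℝ) ≤ 2 ^ k := by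
      exact_mod_cast (Nat.choose_le_two_pow l a).trans (Nat.pow_le_pow_right two_pos hl)
    refine le_trans ?_ (Finset.single_le_sum (f := fun a => (2 : ℝ) ^ k * |c a|)
      (fun _ _ => by positivity) (Finset.mem_range.2 (by omega : a < k + 1)))
    gcongr
  refine DominatedOn.of_le_mul (c := ENNReal.ofReal D) ENNReal.ofReal_ne_top fun w hw => ?_
  have hw : ContDiff ℝ ∞ w := hw
  have hpt : ∀ y ∈ L, ‖chartJet I (𝔄.chart m) l (fun s => χ s • w ((𝔄.chart m).extend I s)) y‖ ≤
      D * ∑ b ∈ Finset.range (k + 1), ∑ J : Fin b → Fin d, ‖coordDeriv J w y‖ := by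
    intro y hy
    have heq : EqOn ((fun s => χ s • w ((𝔄.chart m).extend I s)) ∘ ((𝔄.chart m).extend I).symm)
        (fun z => (χ ∘ ((𝔄.chart m).extend I).symm) z • w z) ((𝔄.chart m).extend I).target :=
      fun z hz => by simp only [Function.comp_apply, ((𝔄.chart m).extend I).right_inv hz]
    rw [chartJet, iteratedFDerivWithin_congr heq (hLt hy)]
    have hwk : ContDiff ℝ k w := hw.of_le (by exact_mod_cast le_top)
    refine (norm_iteratedFDerivWithin_smul_le hχc hwk.contDiffOn hu (hLt hy)
      (by exact_mod_cast hl)).trans ?_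
    have h1 : ∀ a ∈ Finset.range (l + 1), (l.choose a : ℝ) *
        ‖iteratedFDerivWithin ℝ a (χ ∘ ((𝔄.chart m).extend I).symm) ((𝔄.chart m).extend I).target y‖ *
        ‖iteratedFDerivWithin ℝ (l - a) w ((𝔄.chart m).extend I).target y‖ ≤
        D * ∑ J : Fin (l - a) → Fin d, ‖coordDeriv J w y‖ := by
      intro a ha
      have hal : a ≤ l := Nat.lt_succ_iff.1 (Finset.mem_range.1 ha)
      rw [iteratedFDerivWithin_eq_iteratedFDeriv hu
        (hwk.contDiffAt.of_le (by exact_mod_cast (Nat.sub_le l a).trans hl)) (hLt hy)]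
      refine mul_le_mul ((mul_le_mul_of_nonneg_left ((hc a (hal.trans hl) y hy).trans
        (le_abs_self _)) (by positivity)).trans (hD a hal))
        (norm_iteratedFDeriv_le_sum_coordDeriv w y) (norm_nonneg _)
        (Finset.sum_nonneg fun _ _ => by positivity)
    refine (Finset.sum_le_sum h1).trans ?_
    rw [← Finset.mul_sum]
    refine mul_le_mul_of_nonneg_left ?_ (Finset.sum_nonneg fun _ _ => by positivity)
    have hrefl : ∑ a ∈ Finset.range (l + 1), ∑ J : Fin (l - a) → Fin d, ‖coordDeriv J w y‖ =
        ∑ b ∈ Finset.range (l + 1), ∑ J : Fin b → Fin d, ‖coordDeriv J w y‖ :=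
      Finset.sum_range_reflect (fun b => ∑ J : Fin b → Fin d, ‖coordDeriv J w y‖) (l + 1)
    rw [hrefl]
    exact Finset.sum_le_sum_of_subset_of_nonneg (Finset.range_mono (by omega))
      fun _ _ _ => Finset.sum_nonneg fun _ _ => norm_nonneg _
  have hcont : ∀ b (J : Fin b → Fin d), AEStronglyMeasurable (fun y => ‖coordDeriv J w y‖)
      (volume.restrict L) := fun b J => by
    have h2 := continuousOn_coordDeriv isOpen_univ (le_refl b)
      (hw.of_le (by exact_mod_cast le_top) : ContDiff ℝ b w).contDiffOn J
    exact (continuousOn_univ.1 h2).norm.aestronglyMeasurable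
  have h3 : eLpNorm (chartJet I (𝔄.chart m) l fun s => χ s • w ((𝔄.chart m).extend I s)) p
      (volume.restrict L) ≤ ENNReal.ofReal D * eLpNorm (∑ b ∈ Finset.range (k + 1),
        ∑ J : Fin b → Fin d, fun y => ‖coordDeriv J w y‖) p (volume.restrict L) := by
    refine eLpNorm_le_mul_eLpNorm_of_ae_le_mul ((ae_restrict_iff' hL.measurableSet).2
      (Eventually.of_forall fun y hy => (hpt y hy).trans_eq ?_)) _
    simp only [Finset.sum_apply]
    rw [Real.norm_of_nonneg (Finset.sum_nonneg fun _ _ => Finset.sum_nonneg fun _ _ =>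
      norm_nonneg _)]
  refine h3.trans (mul_le_mul_right ?_ _)
  refine (eLpNorm_sum_le (fun b _ => Finset.aestronglyMeasurable_sum _ fun J _ => hcont b J)
    hp1).trans ?_
  refine Finset.sum_le_sum fun b _ => (eLpNorm_sum_le (fun J _ => hcont b J) hp1).trans_eq ?_
  exact Finset.sum_congr rfl fun J _ => eLpNorm_norm _

lemma coordDeriv_sub {j : ℕ} (J : Fin j → Fin d) {u w : EuclideanSpace ℝ (Fin d) → F}
    (hu : ContDiff ℝ j u) (hw : ContDiff ℝ j w) :
    coordDeriv J (u - w) = coordDeriv J u - coordDeriv J w := by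
  funext y
  simp only [coordDeriv, Pi.sub_apply]
  rw [iteratedFDeriv_sub_apply hu.contDiffAt hw.contDiffAt]
  rfl

/-- A function supported in one chart domain is controlled in all charts by its derivatives there,
so mollified functions can be compared in `ℝᵈ` alone. -/
lemma dominatedOn_sobolevNormOn_smul [T2Space S] {k : ℕ} {p : ℝ≥0} (hp : 1 ≤ p)
    (m : Fin 𝔄.card) {χ : S → ℝ} (hχ : ContMDiff I 𝓘(ℝ) ∞ χ)
    (hχm : tsupport χ ⊆ (𝔄.chart m).source) :
    DominatedOn {w : EuclideanSpace ℝ (Fin d) → F | ContDiff ℝ ∞ w}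
      (fun w => ENNReal.ofReal (∑ i, sobolevNormOn (𝔄.coordDom i) k p
        (𝔄.read i fun s => χ s • w ((𝔄.chart m).extend I s))))
      (fun w => ∑ b ∈ Finset.range (k + 1), ∑ J : Fin b → Fin d,
        eLpNorm (coordDeriv J w) p (volume.restrict ((𝔄.chart m).extend I '' tsupport χ))) := by
  have hK : IsCompact (tsupport χ) := (isClosed_tsupport χ).isCompact
  have hp1 : (1 : ENNReal) ≤ p := by exact_mod_cast hp
  have h1 : DominatedOn {f : S → F | ContMDiff I 𝓘(ℝ, F) k f ∧ tsupport f ⊆ tsupport χ}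
      (fun f => ENNReal.ofReal (∑ i, sobolevNormOn (𝔄.coordDom i) k p (𝔄.read i f)))
      (fun f => ∑ l ∈ Finset.range (k + 1), eLpNorm (chartJet I (𝔄.chart m) l f) p
        (volume.restrict ((𝔄.chart m).extend I '' tsupport χ))) := by
    refine DominatedOn.trans (((𝔄.dominatedOn_sobolevNormOn (F := F) (k := k) (p := p)).comp
      (φ := id) fun f hf => hf.1)) ?_
    exact DominatedOn.sum _ fun i _ => DominatedOn.sum _ fun j hj => DominatedOn.sum _ fun J _ =>
      𝔄.dominatedOn_jetNorm_of_tsupport (Nat.lt_succ_iff.1 (Finset.mem_range.1 hj)) i m hK hχm hp1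
  refine (h1.comp (φ := fun (w : EuclideanSpace ℝ (Fin d) → F) s =>
    χ s • w ((𝔄.chart m).extend I s)) (t := {w | ContDiff ℝ ∞ w}) fun w hw =>
      ⟨(𝔄.contMDiff_smul_comp_extend m hχ hχm hw).of_le (by exact_mod_cast le_top),
        closure_mono fun s hs h0 => hs (by simp [h0])⟩).trans ?_
  exact DominatedOn.sum _ fun l hl => 𝔄.dominatedOn_eLpNorm_chartJet_smul m hK hχm hχ hp
    (Nat.lt_succ_iff.1 (Finset.mem_range.1 hl))

/-- Approximation of a localized Sobolev function by smooth functions. -/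
lemma exists_seq_tendsto_smul [T2Space S]
    (hI : range I = univ ∨ ∃ l : EuclideanSpace ℝ (Fin d) →L[ℝ] ℝ, l ≠ 0 ∧ range I = {v | 0 ≤ l v})
    {k : ℕ} {p : ℝ≥0} (hp : 1 ≤ p) (m : Fin 𝔄.card) {χ : S → ℝ} (hχ : ContMDiff I 𝓘(ℝ) ∞ χ)
    (hχm : tsupport χ ⊆ 𝔄.dom m) {x : C(S, F)}
    (hx : MemSobolevOn (𝔄.coordDom m) k p (𝔄.read m x)) :
    ∃ f : ℕ → S → F, (∀ n, ContMDiff I 𝓘(ℝ, F) ∞ (f n)) ∧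
      TendstoUniformly f (fun s => χ s • x s) atTop ∧
      ∀ ε : ℝ, 0 < ε → ∃ N, ∀ a ≥ N, ∀ b ≥ N,
        ∑ i, sobolevNormOn (𝔄.coordDom i) k p (𝔄.read i (f a - f b)) ≤ ε := by
  have hdm : 𝔄.dom m ⊆ (𝔄.chart m).source := subset_closure.trans (𝔄.closure_dom_subset m)
  have hKm := hχm.trans hdm
  have hK : IsCompact (tsupport χ) := (isClosed_tsupport χ).isCompact
  have hp1 : (1 : ENNReal) ≤ p := by exact_mod_cast hp
  obtain ⟨v₀, r, hr, hin⟩ := exists_ball_inward hI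
  obtain ⟨K', hK', hKK', hK'U, T, hT, hcone⟩ :=
    exists_compact_cone (𝔄.chart m) (𝔄.isOpen_dom m) hdm hK hχm hin
  obtain ⟨O, hO, hOd⟩ := exists_image_extend_eq (I := I) (𝔄.chart m) (𝔄.isOpen_dom m) hdm
  obtain ⟨κ, hκ⟩ := exists_mollifier_seq v₀ hr
  set L := (𝔄.chart m).extend I '' tsupport χ with hLdef
  set L' := (𝔄.chart m).extend I '' K' with hL'def
  have hLL' : L ⊆ L' := image_mono hKK'
  have hL : IsCompact L := isCompact_image_extend _ hK hKm
  have hL' : IsCompact L' := isCompact_image_extend _ hK' (hK'U.trans hdm)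
  have hL't : L' ⊆ ((𝔄.chart m).extend I).target :=
    image_extend_subset_target _ (hK'U.trans hdm)
  set V := 𝔄.coordDom m with hVdef
  set u := 𝔄.read m x with hu_def
  have huc : ContinuousOn u L' := (𝔄.continuousOn_read m x).mono hL't
  -- The cut makes `u` integrable on all of `ℝᵈ`, so that averages are defined and smooth
  -- everywhere; near `L` the averages still see `u` itself.
  set u' := L'.indicator u with hu'_def
  have hu'i : LocallyIntegrable u' :=
    ((integrable_indicator_iff hL'.measurableSet).2
      (huc.integrableOn_compact hL')).locallyIntegrable
  -- Even if `y` is a boundary point, `y + v` lies in the open set `V`, because `v` points inward.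
  have hmem : ∀ᶠ n in atTop, ∀ y ∈ L, ∀ v ∈ tsupport (κ n), y + v ∈ V ∧ y + v ∈ L' := by
    have hlim : Tendsto (fun n : ℕ => ((n : ℝ) + 1)⁻¹) atTop (𝓝 0) := by
      simpa [one_div] using tendsto_one_div_add_atTop_nhds_zero_nat (𝕜 := ℝ)
    filter_upwards [hlim.eventually (ge_mem_nhds hT)] with n hn y hy v hv
    obtain ⟨v', hv', rfl⟩ := (hκ n).2 hv
    have hpos : 0 < ((n : ℝ) + 1)⁻¹ := by positivity
    have h1 : y + ((n : ℝ) + 1)⁻¹ • v' ∈ L' := hcone y hy v' hv' _ ⟨hpos.le, hn⟩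
    have h2 : y + ((n : ℝ) + 1)⁻¹ • v' ∈ O ∩ range I := hOd ▸ image_mono hK'U h1
    have hyI : y ∈ range I := (hOd ▸ image_mono hχm hy : y ∈ O ∩ range I).2
    refine ⟨?_, h1⟩
    have h3 : O ∩ interior (range I) ⊆ V :=
      interior_maximal (hOd ▸ inter_subset_inter_right _ interior_subset)
        (hO.inter isOpen_interior)
    exact h3 ⟨h2.1, hin y hyI v' hv' _ hpos⟩
  have hsmall : ∀ ε : ℝ, 0 < ε → ∀ᶠ n in atTop, tsupport (κ n) ⊆ Metric.closedBall 0 ε := by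
    intro ε hε
    have hlim : Tendsto (fun n : ℕ => ((n : ℝ) + 1)⁻¹ * (‖v₀‖ + r)) atTop (𝓝 0) := by
      simpa [one_div] using (tendsto_one_div_add_atTop_nhds_zero_nat (𝕜 := ℝ)).mul_const (‖v₀‖ + r)
    filter_upwards [hlim.eventually (ge_mem_nhds hε)] with n hn v hv
    obtain ⟨v', hv', rfl⟩ := (hκ n).2 hv
    rw [mem_closedBall_zero_iff, norm_smul, Real.norm_of_nonneg (by positivity)]
    refine le_trans ?_ hn
    have h2 : ‖v' - v₀‖ ≤ r := mem_closedBall_iff_norm.1 hv'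
    have h3 := norm_le_norm_add_norm_sub v₀ v'
    have h4 := norm_sub_rev v' v₀
    gcongr
    linarith
  set w : ℕ → EuclideanSpace ℝ (Fin d) → F := fun n => translationAverage (κ n) u' with hwdef
  have hw : ∀ n, ContDiff ℝ ∞ (w n) := fun n => (hκ n).1.contDiff_translationAverage hu'i
  refine ⟨fun n s => χ s • w n ((𝔄.chart m).extend I s),
    fun n => 𝔄.contMDiff_smul_comp_extend m hχ hKm (hw n), ?_, ?_⟩
  · obtain ⟨c, hc⟩ := (isCompact_univ (X := S)).exists_bound_of_continuousOn
      hχ.continuous.continuousOn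
    rw [Metric.tendstoUniformly_iff]
    intro ε hε
    set ε' := ε / (2 * (|c| + 1))
    have hε' : 0 < ε' := by positivity
    obtain ⟨δ, hδ, huδ⟩ := Metric.uniformContinuousOn_iff.1
      (hL'.uniformContinuousOn_of_continuous huc) ε' hε'
    filter_upwards [hmem, hsmall (δ / 2) (by positivity)] with n hn hn2 s
    by_cases hs : s ∈ tsupport χ
    · have hy : (𝔄.chart m).extend I s ∈ L := mem_image_of_mem _ hs
      have h1 : ‖w n ((𝔄.chart m).extend I s) - x s‖ ≤ ε' := by
        refine (hκ n).1.norm_translationAverage_sub_le hu'i fun v hv => ?_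
        have h2 := (hn _ hy v hv).2
        have h3 := huδ _ h2 _ (hLL' hy) (by
          rw [dist_eq_norm, add_sub_cancel_left]
          have := mem_closedBall_zero_iff.1 (hn2 hv)
          linarith)
        rw [hu'_def, indicator_of_mem h2]
        rw [dist_eq_norm] at h3
        have h4 : u ((𝔄.chart m).extend I s) = x s := 𝔄.read_extend m x (hχm hs)
        rw [h4] at h3
        exact h3.le
      rw [dist_comm, dist_eq_norm, ← smul_sub, norm_smul]
      calc ‖χ s‖ * ‖w n ((𝔄.chart m).extend I s) - x s‖ ≤ |c| * ε' := by
            gcongr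
            exact (hc s (mem_univ s)).trans (le_abs_self c)
        _ < (2 * (|c| + 1)) * ε' := by
            gcongr
            linarith [abs_nonneg c]
        _ = ε := by
            simp only [ε']
            field_simp
    · have h0 : χ s = 0 := image_eq_zero_of_notMem_tsupport hs
      simpa [h0] using hε
  · obtain ⟨C, hC⟩ := 𝔄.dominatedOn_sobolevNormOn_smul (F := F) (k := k) hp m hχ hKm
    set e : ℕ → ENNReal := fun n => ∑ b ∈ Finset.range (k + 1), ∑ J : Fin b → Fin d,
      eLpNorm (translationAverage (κ n) (V.indicator (weakDeriv V J u)) -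
        V.indicator (weakDeriv V J u)) p volume with hedef
    have hLp : ∀ b ≤ k, ∀ J : Fin b → Fin d, MemLp (V.indicator (weakDeriv V J u)) p volume :=
      fun b hb J => (memLp_indicator_iff_restrict (𝔄.isOpen_coordDom m).measurableSet).2
        (MemSobolevOn.memLp (𝔄.isOpen_coordDom m) hx hb J)
    have he : Tendsto (fun n => C * e n) atTop (𝓝 0) := by
      have h1 : Tendsto e atTop (𝓝 0) := by
        have := tendsto_finsetSum (Finset.range (k + 1)) fun b hb =>
          tendsto_finsetSum (Finset.univ : Finset (Fin b → Fin d)) fun J _ =>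
          tendsto_eLpNorm_translationAverage_sub (fun n => (hκ n).1) hsmall hp
            (hLp b (Nat.lt_succ_iff.1 (Finset.mem_range.1 hb)) J)
        simpa using this
      simpa using ENNReal.Tendsto.const_mul h1 (Or.inr ENNReal.coe_ne_top)
    -- On `L` the classical derivatives of the averages are averages of the weak derivatives
    -- extended by zero, and these converge in `L^p`.
    have hjet : ∀ᶠ n in atTop, ∀ b ≤ k, ∀ J : Fin b → Fin d, ∀ y ∈ L, coordDeriv J (w n) y =
        translationAverage (κ n) (V.indicator (weakDeriv V J u)) y := by
      filter_upwards [hmem] with n hn b hb J y hy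
      rw [(hκ n).1.coordDeriv_translationAverage (hx.isWeakDeriv hb J) hu'i fun v hv =>
        ⟨(hn y hy v hv).1, indicator_of_mem (hn y hy v hv).2 _⟩]
      refine integral_congr_ae (Eventually.of_forall fun v => ?_)
      by_cases hv : v ∈ tsupport (κ n)
      · simp only [indicator_of_mem (hn y hy v hv).1]
      · simp only [image_eq_zero_of_notMem_tsupport hv, zero_smul]
    intro ε hε
    obtain ⟨N, hN⟩ := eventually_atTop.1 (hjet.and (he.eventually
      (ge_mem_nhds (by positivity : (0 : ENNReal) < ENNReal.ofReal (ε / 2)))))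
    refine ⟨N, fun a ha b hb => ?_⟩
    have h1 := hC (w a - w b) ((hw a).sub (hw b))
    have h2 : (fun s => χ s • (w a - w b) ((𝔄.chart m).extend I s)) =
        (fun s => χ s • w a ((𝔄.chart m).extend I s)) -
          fun s => χ s • w b ((𝔄.chart m).extend I s) := by
      funext s
      simp [smul_sub]
    simp only [h2] at h1
    rw [← ENNReal.ofReal_le_ofReal_iff hε.le]
    refine h1.trans ?_
    have h3 : ∑ j ∈ Finset.range (k + 1), ∑ J : Fin j → Fin d,
        eLpNorm (coordDeriv J (w a - w b)) p (volume.restrict L) ≤ e a + e b := by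
      simp only [hedef, ← Finset.sum_add_distrib]
      refine Finset.sum_le_sum fun j hj => Finset.sum_le_sum fun J _ => ?_
      have hj : j ≤ k := Nat.lt_succ_iff.1 (Finset.mem_range.1 hj)
      have hle : (j : WithTop ℕ∞) ≤ ∞ := by exact_mod_cast le_top
      set g := V.indicator (weakDeriv V J u) with hg
      have hgl : LocallyIntegrable g := (hLp j hj J).locallyIntegrable hp1
      have hm : ∀ n, AEStronglyMeasurable (translationAverage (κ n) g - g) volume := fun n =>
        ((hκ n).1.contDiff_translationAverage hgl).continuous.aestronglyMeasurable.sub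
          (hLp j hj J).aestronglyMeasurable
      calc eLpNorm (coordDeriv J (w a - w b)) p (volume.restrict L)
          = eLpNorm ((translationAverage (κ a) g - g) - (translationAverage (κ b) g - g)) p
              (volume.restrict L) := by
            refine eLpNorm_congr_ae ((ae_restrict_iff' hL.measurableSet).2
              (Eventually.of_forall fun y hy => ?_))
            rw [coordDeriv_sub J ((hw a).of_le hle) ((hw b).of_le hle)]
            simp only [Pi.sub_apply, (hN a ha).1 j hj J y hy, (hN b hb).1 j hj J y hy]
            abel
        _ ≤ eLpNorm ((translationAverage (κ a) g - g) - (translationAverage (κ b) g - g)) p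
              volume := eLpNorm_mono_measure _ Measure.restrict_le_self
        _ ≤ _ := eLpNorm_sub_le (hm a) (hm b) hp1
    calc (C : ENNReal) * _ ≤ C * (e a + e b) := mul_le_mul_right h3 _
      _ = C * e a + C * e b := mul_add _ _ _
      _ ≤ ENNReal.ofReal (ε / 2) + ENNReal.ofReal (ε / 2) :=
          add_le_add (hN a ha).2 (hN b hb).2
      _ = ENNReal.ofReal ε := by
          rw [← ENNReal.ofReal_add (by positivity) (by positivity), add_halves]

end FiniteAtlas

namespace Regularity

/-- `C^k` functions are dense. -/
theorem exists_seq_tendsto [T2Space S] (R : Regularity d)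
    (hI : range I = univ ∨ ∃ l : EuclideanSpace ℝ (Fin d) →L[ℝ] ℝ, l ≠ 0 ∧ range I = {v | 0 ≤ l v})
    {x : C(S, F)} (hx : R.Mem 𝔄 x) :
    ∃ f : ℕ → C(S, F), (∀ n, ContMDiff I 𝓘(ℝ, F) R.order (f n)) ∧
      TendstoUniformly (fun n s => f n s) x atTop ∧
      Tendsto (fun n => R.normOn 𝔄 (f n - x)) atTop (𝓝 0) := by
  cases R with
  | C k =>
    refine ⟨fun _ => x, fun _ => hx, fun U hU => Eventually.of_forall fun _ _ =>
      refl_mem_uniformity hU, ?_⟩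
    simp only [sub_self]
    rw [normOn_zero]
    exact tendsto_const_nhds
  | W k p hk hp hdP =>
    obtain ⟨χ, hχ⟩ := SmoothPartitionOfUnity.exists_isSubordinate I isClosed_univ 𝔄.dom
      𝔄.isOpen_dom (by rw [𝔄.iUnion_dom])
    choose f hf hfu hfc using fun m => 𝔄.exists_seq_tendsto_smul hI hp m (χ m).contMDiff (hχ m)
      (hx m)
    set f' : Fin 𝔄.card → ℕ → C(S, F) := fun m n => ⟨f m n, (hf m n).continuous⟩ with hf'
    set y : Fin 𝔄.card → C(S, F) := fun m =>
      ⟨fun s => χ m s • x s, (χ m).contMDiff.continuous.smul x.continuous⟩ with hy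
    have hf'k : ∀ m n, ContMDiff I 𝓘(ℝ, F) k (f' m n) := fun m n =>
      (hf m n).of_le (by exact_mod_cast le_top)
    have hmem : ∀ m n, (W k p hk hp hdP).Mem 𝔄 (f' m n) := fun m n =>
      (W k p hk hp hdP).mem_of_contMDiff 𝔄 (hf'k m n)
    -- Only the Cauchy property of the approximations was shown. Completeness identifies the limit
    -- with `χ m • x`, which avoids a product rule for weak derivatives.
    have hlim := fun m => (W k p hk hp hdP).mem_of_tendstoUniformly 𝔄 (hmem m) (y := y m)
      (hfc m) (hfu m)
    have hxy : ∑ m, y m = x := by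
      ext s
      have h1 := χ.sum_eq_one (mem_univ s)
      rw [finsum_eq_sum_of_fintype] at h1
      simp only [ContinuousMap.coe_sum, Finset.sum_apply, hy, ContinuousMap.coe_mk]
      rw [← Finset.sum_smul, h1, one_smul]
    have hsum := fun n => (W k p hk hp hdP).normOn_sum_le 𝔄 Finset.univ
      (x := fun m => f' m n - y m) fun m _ => (hmem m n).sub 𝔄 (hlim m).1
    refine ⟨fun n => ∑ m, f' m n, fun n => ?_, ?_, ?_⟩
    · simp only [ContinuousMap.coe_sum]
      exact contMDiff_finsetSum' fun m _ => hf'k m n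
    · rw [← hxy]
      rw [Metric.tendstoUniformly_iff]
      intro ε hε
      have h1 : ∀ m, ∀ᶠ n in atTop, ∀ s, dist (y m s) (f' m n s) < ε / (𝔄.card + 1) := fun m =>
        Metric.tendstoUniformly_iff.1 (hfu m) _ (by positivity)
      filter_upwards [eventually_all.2 h1] with n hn s
      simp only [ContinuousMap.coe_sum, Finset.sum_apply]
      refine (dist_sum_sum_le _ _ _).trans_lt ?_
      calc ∑ m, dist (y m s) (f' m n s) ≤ ∑ _m : Fin 𝔄.card, ε / (𝔄.card + 1) :=
            Finset.sum_le_sum fun m _ => (hn m s).le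
        _ = 𝔄.card * (ε / (𝔄.card + 1)) := by simp
        _ < (𝔄.card + 1) * (ε / (𝔄.card + 1)) := by
            gcongr
            linarith
        _ = ε := by field_simp
    · have h1 : ∀ n, ∑ m, f' m n - x = ∑ m, (f' m n - y m) := fun n => by
        rw [Finset.sum_sub_distrib, hxy]
      have h2 := tendsto_finsetSum Finset.univ fun m _ => (hlim m).2
      rw [Finset.sum_const_zero] at h2
      refine squeeze_zero (fun n => ?_) (fun n => ?_) h2
      · rw [h1]
        exact (W k p hk hp hdP).normOn_nonneg 𝔄 (hsum n).1
      · rw [h1]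
        exact (hsum n).2

end Regularity

end Density

/-! ### Norms on the algebra of `C^k` functions -/

section CkAlgebra

open Filter

/-- The Cauchy product of two truncated series, cut off at total degree `k`, omits only nonnegative
terms. -/
lemma sum_range_mul_le_mul_sum {k : ℕ} {u v : ℕ → ℝ} (hu : ∀ l, 0 ≤ u l) (hv : ∀ l, 0 ≤ v l) :
    ∑ j ∈ Finset.range (k + 1), ∑ l ∈ Finset.range (j + 1), u l * v (j - l) ≤
      (∑ l ∈ Finset.range (k + 1), u l) * ∑ l ∈ Finset.range (k + 1), v l := by
  rw [Finset.sum_mul_sum, ← Finset.sum_product']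
  have h := Finset.sum_fiberwise_le_sum_of_sum_fiber_nonneg
    (s := Finset.range (k + 1) ×ˢ Finset.range (k + 1)) (t := Finset.range (k + 1))
    (g := fun q => q.1 + q.2) (f := fun q => u q.1 * v q.2)
    fun _ _ => Finset.sum_nonneg fun q _ => mul_nonneg (hu _) (hv _)
  refine le_trans (Finset.sum_le_sum fun j hj => ?_) h
  rw [← Finset.Nat.sum_antidiagonal_eq_sum_range_succ (fun a b => u a * v b)]
  refine Finset.sum_le_sum_of_subset_of_nonneg (fun q hq => ?_)
    fun q _ _ => mul_nonneg (hu _) (hv _)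
  rw [Finset.HasAntidiagonal.mem_antidiagonal] at hq
  rw [Finset.mem_range] at hj
  exact Finset.mem_filter.2 ⟨Finset.mem_product.2 ⟨Finset.mem_range.2 (by omega),
    Finset.mem_range.2 (by omega)⟩, hq⟩

variable {d : ℕ} {H : Type*} [TopologicalSpace H]
  {I : ModelWithCorners ℝ (EuclideanSpace ℝ (Fin d)) H}
  {S : Type*} [TopologicalSpace S] [ChartedSpace H S] [IsManifold I ∞ S] [CompactSpace S]
  {F : Type*} [NormedAddCommGroup F] [NormedSpace ℂ F] [CompleteSpace F] (𝔄 : FiniteAtlas I S)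

lemma ContMDiff.mul' {k : ℕ} {f g : S → ℂ} (hf : ContMDiff I 𝓘(ℝ, ℂ) k f)
    (hg : ContMDiff I 𝓘(ℝ, ℂ) k g) : ContMDiff I 𝓘(ℝ, ℂ) k (f * g) :=
  ((contDiff_fst.mul contDiff_snd).contMDiff (n := k)).comp (hf.prodMk_space hg)

lemma ContMDiff.add' {k : ℕ} {f g : S → F} (hf : ContMDiff I 𝓘(ℝ, F) k f)
    (hg : ContMDiff I 𝓘(ℝ, F) k g) : ContMDiff I 𝓘(ℝ, F) k (f + g) :=
  ((contDiff_fst.add contDiff_snd).contMDiff (n := k)).comp (hf.prodMk_space hg)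

/-- `l / P + (j - l) / P = j / P`. This is why order `j` is measured in `L^(P / j)`: every term of
Leibniz' rule fits Hölder's inequality exactly. -/
lemma Regularity.holderTriple (R : Regularity d) {l j : ℕ} (hlj : l ≤ j) :
    ENNReal.HolderTriple (R.exponent / l) (R.exponent / ((j - l : ℕ) : ENNReal))
      (R.exponent / j) := by
  have h : ∀ a : ℕ, (R.exponent / a)⁻¹ = a / R.exponent := fun a =>
    ENNReal.inv_div (Or.inl (by finiteness)) (Or.inr R.exponent_ne_zero)
  refine ⟨?_⟩
  rw [h, h, h, ← ENNReal.add_div, ← Nat.cast_add, Nat.add_sub_cancel' hlj]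

namespace FiniteAtlas

lemma jetNorm_mul_le (R : Regularity d) (i : Fin 𝔄.card) {j : ℕ} (hj : j ≤ R.order) {f g : S → ℂ}
    (hf : ContMDiff I 𝓘(ℝ, ℂ) R.order f) (hg : ContMDiff I 𝓘(ℝ, ℂ) R.order g) :
    𝔄.jetNorm i j (R.exponent / j) (f * g) ≤ ∑ l ∈ Finset.range (j + 1), (j.choose l : ENNReal) *
      (𝔄.jetNorm i l (R.exponent / l) f *
        𝔄.jetNorm i (j - l) (R.exponent / ((j - l : ℕ) : ENNReal)) g) := by
  set μ := volume.restrict (𝔄.coordDom i)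
  have hmf : ∀ l ∈ Finset.range (j + 1), AEStronglyMeasurable
      (fun y => ‖chartJet I (𝔄.chart i) l f y‖) μ := fun l hl =>
    (𝔄.aestronglyMeasurable_chartJet_coordDom
      ((Nat.lt_succ_iff.1 (Finset.mem_range.1 hl)).trans hj) hf i).norm
  have hmg : ∀ l ∈ Finset.range (j + 1), AEStronglyMeasurable
      (fun y => ‖chartJet I (𝔄.chart i) (j - l) g y‖) μ := fun l hl =>
    (𝔄.aestronglyMeasurable_chartJet_coordDom ((Nat.sub_le j l).trans hj) hg i).norm
  have h1 : 𝔄.jetNorm i j (R.exponent / j) (f * g) ≤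
      eLpNorm (∑ l ∈ Finset.range (j + 1), (j.choose l : ℝ) •
        ((fun y => ‖chartJet I (𝔄.chart i) l f y‖) •
          fun y => ‖chartJet I (𝔄.chart i) (j - l) g y‖)) (R.exponent / j) μ := by
    refine eLpNorm_mono_ae_real ((ae_restrict_iff' (𝔄.isOpen_coordDom i).measurableSet).2
      (Eventually.of_forall fun y hy => ?_))
    have hy' := 𝔄.coordDom_subset i hy
    refine (norm_iteratedFDerivWithin_mul_le (𝔄.contDiffOn_read hf i) (𝔄.contDiffOn_read hg i)
      (uniqueDiffOn_chartTarget _) hy' (by exact_mod_cast hj)).trans_eq ?_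
    simp only [Finset.sum_apply, Pi.smul_apply, smul_eq_mul, mul_assoc]
    rfl
  refine h1.trans ((eLpNorm_sum_le (fun l hl => ((hmf l hl).smul (hmg l hl)).const_smul _)
    (R.one_le_exponent_div hj)).trans (Finset.sum_le_sum fun l hl => ?_))
  have := R.holderTriple (Nat.lt_succ_iff.1 (Finset.mem_range.1 hl))
  rw [eLpNorm_const_smul]
  refine mul_le_mul' ?_ ?_
  · rw [Real.enorm_natCast]
  · refine (eLpNorm_smul_le_mul_eLpNorm (p := R.exponent / l)
      (q := R.exponent / ((j - l : ℕ) : ENNReal)) (hmg l hl) (hmf l hl)).trans_eq ?_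
    rw [eLpNorm_norm, eLpNorm_norm]
    rfl

lemma jetNorm_zero_le (i : Fin 𝔄.card) (f : C(S, F)) (q : ENNReal)
    (hq : q = ⊤) : 𝔄.jetNorm i 0 q f ≤ ENNReal.ofReal ‖f‖ := by
  subst hq
  have h := eLpNorm_le_of_ae_bound (p := ⊤) (μ := volume.restrict (𝔄.coordDom i))
    (f := chartJet I (𝔄.chart i) 0 f) (C := ‖f‖)
    (Eventually.of_forall fun y => by
      rw [chartJet, norm_iteratedFDerivWithin_zero]
      exact f.norm_coe_le_norm _)
  rwa [ENNReal.toReal_top, inv_zero, ENNReal.rpow_zero, one_mul] at h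

end FiniteAtlas

lemma Regularity.exponent_div_zero (R : Regularity d) : R.exponent / ((0 : ℕ) : ENNReal) = ⊤ := by
  rw [Nat.cast_zero, ENNReal.div_zero R.exponent_ne_zero]

/-- The algebra of `C^k` functions. -/
def ckSubalgebra (I : ModelWithCorners ℝ (EuclideanSpace ℝ (Fin d)) H) (S : Type*)
    [TopologicalSpace S] [ChartedSpace H S] [IsManifold I ∞ S] [CompactSpace S] (k : ℕ) :
    Subalgebra ℂ C(S, ℂ) where
  carrier := {f | ContMDiff I 𝓘(ℝ, ℂ) k f}
  mul_mem' := fun hf hg => ContMDiff.mul' hf hg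
  add_mem' := fun hf hg => ContMDiff.add' hf hg
  algebraMap_mem' := fun c => contMDiff_const (c := c)

/-- The algebra of `C^k` functions, with the norm
`‖f‖_∞ + ∑_{1 ≤ j ≤ k} ε ^ j / j! ‖D^j f‖_{P / j}`, where `P = ∞`, respectively `P = k p`. -/
def CkAlgebra (_ : FiniteAtlas I S) (R : Regularity d) (_ : ℝ≥0) : Type _ :=
  ckSubalgebra I S R.order

/-! ### The weighted submultiplicative norm. -/

namespace CkAlgebra

variable {𝔄} {R : Regularity d} {ε : ℝ≥0}

instance : CommRing (CkAlgebra 𝔄 R ε) := inferInstanceAs (CommRing (ckSubalgebra I S R.order))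

instance : Algebra ℂ (CkAlgebra 𝔄 R ε) :=
  inferInstanceAs (Algebra ℂ (ckSubalgebra I S R.order))

/-- The underlying continuous function. -/
def toMap (f : CkAlgebra 𝔄 R ε) : C(S, ℂ) := f.1

lemma contMDiff (f : CkAlgebra 𝔄 R ε) : ContMDiff I 𝓘(ℝ, ℂ) R.order f.toMap := f.2

variable (𝔄 R ε) in
/-- The weighted norm of the `j`-th derivative in the `i`-th chart. -/
def jetWeight (i : Fin 𝔄.card) (j : ℕ) (f : C(S, ℂ)) : ℝ :=
  (ε : ℝ) ^ j / (j.factorial : ℝ) * (𝔄.jetNorm i j (R.exponent / j) f).toReal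

lemma jetWeight_nonneg (i : Fin 𝔄.card) (j : ℕ) (f : C(S, ℂ)) : 0 ≤ jetWeight 𝔄 R ε i j f := by
  unfold jetWeight
  positivity

lemma jetWeight_zero_le (i : Fin 𝔄.card) (f : C(S, ℂ)) : jetWeight 𝔄 R ε i 0 f ≤ ‖f‖ := by
  have h := 𝔄.jetNorm_zero_le i f _ R.exponent_div_zero
  simp only [jetWeight, pow_zero, Nat.factorial_zero, Nat.cast_one, div_one, one_mul]
  exact ENNReal.toReal_le_of_le_ofReal (norm_nonneg f) h

lemma jetWeight_add_le (i : Fin 𝔄.card) {j : ℕ} (hj : j ≤ R.order) (f g : CkAlgebra 𝔄 R ε) :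
    jetWeight 𝔄 R ε i j (f + g).toMap ≤
      jetWeight 𝔄 R ε i j f.toMap + jetWeight 𝔄 R ε i j g.toMap := by
  unfold jetWeight
  rw [← mul_add]
  refine mul_le_mul_of_nonneg_left ?_ (by positivity)
  have hf := (𝔄.jetNorm_lt_top hj f.contMDiff i (R.exponent / j)).ne
  have hg := (𝔄.jetNorm_lt_top hj g.contMDiff i (R.exponent / j)).ne
  rw [← ENNReal.toReal_add hf hg]
  exact ENNReal.toReal_mono (ENNReal.add_ne_top.2 ⟨hf, hg⟩)
    (𝔄.jetNorm_add_le hj f.contMDiff g.contMDiff i (R.one_le_exponent_div hj))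

lemma jetWeight_smul (i : Fin 𝔄.card) {j : ℕ} (hj : j ≤ R.order) (c : ℂ) (f : CkAlgebra 𝔄 R ε) :
    jetWeight 𝔄 R ε i j (c • f).toMap = ‖c‖ * jetWeight 𝔄 R ε i j f.toMap := by
  have h : (𝔄.jetNorm i j (R.exponent / j) (c • f).toMap).toReal =
      ‖c‖ * (𝔄.jetNorm i j (R.exponent / j) f.toMap).toReal := by
    have := 𝔄.jetNorm_const_smul hj c f.contMDiff i (R.exponent / j)
    change (𝔄.jetNorm i j (R.exponent / j) (c • (f.toMap : S → ℂ))).toReal = _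
    rw [this, ENNReal.toReal_mul, toReal_enorm]
  unfold jetWeight
  rw [h]
  ring

/-- The norm of `CkAlgebra`. -/
def normFun (f : CkAlgebra 𝔄 R ε) : ℝ :=
  ‖f.toMap‖ + ∑ i, ∑ j ∈ Finset.range R.order, jetWeight 𝔄 R ε i (j + 1) f.toMap

/-- The weight `ε^j / j!` absorbs the binomial coefficient: `choose j l / j! = 1 / (l! (j - l)!)`,
and `ε^j` splits accordingly. -/
lemma jetWeight_mul_le (i : Fin 𝔄.card) {j : ℕ} (hj : j ≤ R.order) (f g : CkAlgebra 𝔄 R ε) :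
    jetWeight 𝔄 R ε i j (f * g).toMap ≤ ∑ l ∈ Finset.range (j + 1),
      jetWeight 𝔄 R ε i l f.toMap * jetWeight 𝔄 R ε i (j - l) g.toMap := by
  have hfin : ∀ l ∈ Finset.range (j + 1), (j.choose l : ENNReal) *
      (𝔄.jetNorm i l (R.exponent / l) f.toMap *
        𝔄.jetNorm i (j - l) (R.exponent / ((j - l : ℕ) : ENNReal)) g.toMap) ≠ ⊤ := fun l hl =>
    ENNReal.mul_ne_top (by finiteness) (ENNReal.mul_ne_top
      (𝔄.jetNorm_lt_top ((Nat.lt_succ_iff.1 (Finset.mem_range.1 hl)).trans hj) f.contMDiff i _).ne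
      (𝔄.jetNorm_lt_top ((Nat.sub_le j l).trans hj) g.contMDiff i _).ne)
  have h1 := ENNReal.toReal_mono (ENNReal.sum_ne_top.2 hfin)
    (𝔄.jetNorm_mul_le R i hj f.contMDiff g.contMDiff)
  rw [ENNReal.toReal_sum hfin] at h1
  calc jetWeight 𝔄 R ε i j (f * g).toMap ≤ (ε : ℝ) ^ j / (j.factorial : ℝ) * _ :=
        mul_le_mul_of_nonneg_left h1 (by positivity)
    _ = _ := by
        rw [Finset.mul_sum]
        refine Finset.sum_congr rfl fun l hl => ?_
        have hl : l ≤ j := Nat.lt_succ_iff.1 (Finset.mem_range.1 hl)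
        rw [ENNReal.toReal_mul, ENNReal.toReal_mul, ENNReal.toReal_natCast, jetWeight, jetWeight,
          Nat.cast_choose ℝ hl]
        have h2 : (ε : ℝ) ^ j = (ε : ℝ) ^ l * (ε : ℝ) ^ (j - l) := by
          rw [← pow_add, Nat.add_sub_cancel' hl]
        rw [h2]
        field_simp

lemma norm_toMap_le_normFun (f : CkAlgebra 𝔄 R ε) : ‖f.toMap‖ ≤ normFun f :=
  le_add_of_nonneg_right (Finset.sum_nonneg fun i _ => Finset.sum_nonneg fun _ _ =>
    jetWeight_nonneg i _ _)

lemma jetWeight_le_normFun (i : Fin 𝔄.card) {j : ℕ} (hj : j ≤ R.order) (f : CkAlgebra 𝔄 R ε) :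
    jetWeight 𝔄 R ε i j f.toMap ≤ normFun f := by
  rcases j with _ | j
  · exact (jetWeight_zero_le i _).trans (norm_toMap_le_normFun f)
  · refine le_trans ?_ (le_add_of_nonneg_left (norm_nonneg _))
    refine le_trans ?_ (Finset.single_le_sum (f := fun i => ∑ j ∈ Finset.range R.order,
      jetWeight 𝔄 R ε i (j + 1) f.toMap) (fun i _ => Finset.sum_nonneg fun j _ =>
        jetWeight_nonneg i _ _) (Finset.mem_univ i))
    exact Finset.single_le_sum (f := fun j => jetWeight 𝔄 R ε i (j + 1) f.toMap)
      (fun j _ => jetWeight_nonneg i _ _) (Finset.mem_range.2 hj)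

/-- In each chart the weighted jets satisfy the inequality of a truncated Cauchy product; the zeroth
jets are replaced by the global supremum norm, which is common to all charts and is counted once. -/
lemma normFun_mul_le (f g : CkAlgebra 𝔄 R ε) : normFun (f * g) ≤ normFun f * normFun g := by
  set u : Fin 𝔄.card → ℕ → ℝ := fun i j => if j = 0 then ‖f.toMap‖ else jetWeight 𝔄 R ε i j f.toMap
    with hu
  set v : Fin 𝔄.card → ℕ → ℝ := fun i j => if j = 0 then ‖g.toMap‖ else jetWeight 𝔄 R ε i j g.toMap
    with hv
  have hu0 : ∀ i l, 0 ≤ u i l := fun i l => by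
    simp only [hu]
    split_ifs
    exacts [norm_nonneg _, jetWeight_nonneg _ _ _]
  have hv0 : ∀ i l, 0 ≤ v i l := fun i l => by
    simp only [hv]
    split_ifs
    exacts [norm_nonneg _, jetWeight_nonneg _ _ _]
  have hfu : ∀ i l, jetWeight 𝔄 R ε i l f.toMap ≤ u i l := fun i l => by
    simp only [hu]
    split_ifs with h
    · exact h ▸ jetWeight_zero_le i _
    · exact le_rfl
  have hgv : ∀ i l, jetWeight 𝔄 R ε i l g.toMap ≤ v i l := fun i l => by
    simp only [hv]
    split_ifs with h
    · exact h ▸ jetWeight_zero_le i _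
    · exact le_rfl
  set a := ‖f.toMap‖
  set b := ‖g.toMap‖
  set A : Fin 𝔄.card → ℝ := fun i => ∑ j ∈ Finset.range R.order, jetWeight 𝔄 R ε i (j + 1) f.toMap
  set B : Fin 𝔄.card → ℝ := fun i => ∑ j ∈ Finset.range R.order, jetWeight 𝔄 R ε i (j + 1) g.toMap
  have hA : ∀ i, 0 ≤ A i := fun i => Finset.sum_nonneg fun j _ => jetWeight_nonneg i _ _
  have hB : ∀ i, 0 ≤ B i := fun i => Finset.sum_nonneg fun j _ => jetWeight_nonneg i _ _
  have hsumu : ∀ i, ∑ l ∈ Finset.range (R.order + 1), u i l = A i + a := fun i => by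
    rw [Finset.sum_range_succ']
    simp [hu, A, a]
  have hsumv : ∀ i, ∑ l ∈ Finset.range (R.order + 1), v i l = B i + b := fun i => by
    rw [Finset.sum_range_succ']
    simp [hv, B, b]
  -- Expand `(A i + a) * (B i + b)`, drop the order-zero term `a * b`, and enlarge `B i` in the
  -- product `A i * B i` to the sum over all charts, so that the total factors.
  have hi : ∀ i, ∑ j ∈ Finset.range R.order, jetWeight 𝔄 R ε i (j + 1) (f * g).toMap ≤
      a * B i + A i * b + A i * ∑ m, B m := by
    intro i
    have h1 := sum_range_mul_le_mul_sum (k := R.order) (hu0 i) (hv0 i)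
    rw [hsumu, hsumv, Finset.sum_range_succ'] at h1
    have h2 : ∑ j ∈ Finset.range R.order, jetWeight 𝔄 R ε i (j + 1) (f * g).toMap ≤
        ∑ j ∈ Finset.range R.order, ∑ l ∈ Finset.range (j + 1 + 1), u i l * v i (j + 1 - l) := by
      refine Finset.sum_le_sum fun j hj => (jetWeight_mul_le i (Finset.mem_range.1 hj) f g).trans ?_
      exact Finset.sum_le_sum fun l _ => mul_le_mul (hfu i l) (hgv i _) (jetWeight_nonneg _ _ _)
        (hu0 i l)
    have h3 : ∑ l ∈ Finset.range (0 + 1), u i l * v i (0 - l) = a * b := by simp [hu, hv, a, b]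
    have h4 : A i * B i ≤ A i * ∑ m, B m :=
      mul_le_mul_of_nonneg_left (Finset.single_le_sum (fun m _ => hB m) (Finset.mem_univ i)) (hA i)
    nlinarith
  have hab : ‖(f * g).toMap‖ ≤ a * b := norm_mul_le _ _
  calc normFun (f * g) ≤ a * b + ∑ i, (a * B i + A i * b + A i * ∑ m, B m) :=
        add_le_add hab (Finset.sum_le_sum fun i _ => hi i)
    _ = (a + ∑ i, A i) * (b + ∑ i, B i) := by
        rw [Finset.sum_add_distrib, Finset.sum_add_distrib, ← Finset.mul_sum, ← Finset.sum_mul,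
          ← Finset.sum_mul]
        ring

lemma normFun_smul (c : ℂ) (f : CkAlgebra 𝔄 R ε) : normFun (c • f) = ‖c‖ * normFun f := by
  unfold normFun
  rw [mul_add, Finset.mul_sum]
  congr 1
  · exact norm_smul c f.toMap
  · refine Finset.sum_congr rfl fun i _ => ?_
    rw [Finset.mul_sum]
    exact Finset.sum_congr rfl fun j hj => jetWeight_smul i (Finset.mem_range.1 hj) c f

lemma normFun_add_le (f g : CkAlgebra 𝔄 R ε) : normFun (f + g) ≤ normFun f + normFun g := by
  unfold normFun
  rw [add_add_add_comm, ← Finset.sum_add_distrib]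
  refine add_le_add (norm_add_le f.toMap g.toMap) (Finset.sum_le_sum fun i _ => ?_)
  rw [← Finset.sum_add_distrib]
  exact Finset.sum_le_sum fun j hj => jetWeight_add_le i (Finset.mem_range.1 hj) f g

variable (𝔄 R ε) in
/-- The norm of `CkAlgebra`, bundled. -/
def ringNorm : RingNorm (CkAlgebra 𝔄 R ε) where
  toFun := normFun
  map_zero' := by simpa using normFun_smul (0 : ℂ) (0 : CkAlgebra 𝔄 R ε)
  add_le' := normFun_add_le
  neg' f := by simpa using normFun_smul (-1 : ℂ) f
  mul_le' := normFun_mul_le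
  eq_zero_of_map_eq_zero' f hf := by
    have h := (norm_toMap_le_normFun f).trans_eq hf
    exact Subtype.ext (norm_le_zero_iff.1 h)

instance : NormedCommRing (CkAlgebra 𝔄 R ε) where
  __ := (ringNorm 𝔄 R ε).toNormedRing
  mul_comm := mul_comm

instance : NormedAlgebra ℂ (CkAlgebra 𝔄 R ε) where
  norm_smul_le c f := (normFun_smul c f).le

lemma norm_def (f : CkAlgebra 𝔄 R ε) : ‖f‖ = normFun f := rfl

end CkAlgebra

end CkAlgebra

/-! ### The spaces of maps are Banach spaces -/

section Completeness

open Filter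

variable {d : ℕ} {H : Type*} [TopologicalSpace H]
  {I : ModelWithCorners ℝ (EuclideanSpace ℝ (Fin d)) H}
  {S : Type*} [TopologicalSpace S] [ChartedSpace H S] [IsManifold I ∞ S] [CompactSpace S]
  [T2Space S]
  {F : Type*} [NormedAddCommGroup F] [NormedSpace ℂ F] [CompleteSpace F] (𝔄 : FiniteAtlas I S)
  (R : Regularity d)
  (hI : range I = univ ∨ ∃ l : EuclideanSpace ℝ (Fin d) →L[ℝ] ℝ, l ≠ 0 ∧ range I = {v | 0 ≤ l v})

include hI in
lemma Regularity.exists_jetNorm_toReal_le (i : Fin 𝔄.card) {j : ℕ} (hj : j ≤ R.order) :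
    ∃ C : ℝ≥0, ∀ f : C(S, F), ContMDiff I 𝓘(ℝ, F) R.order f →
      (𝔄.jetNorm i j (R.exponent / j) f).toReal ≤ C * R.normOn 𝔄 f := by
  obtain ⟨C, hC⟩ := R.dominatedOn_jetNorm (F := F) 𝔄 hI i hj
  refine ⟨C, fun f hf => ?_⟩
  have h0 := R.normOn_nonneg 𝔄 (R.mem_of_contMDiff 𝔄 hf)
  have h := ENNReal.toReal_mono (ENNReal.mul_ne_top ENNReal.coe_ne_top ENNReal.ofReal_ne_top)
    (hC f hf)
  rwa [ENNReal.toReal_mul, ENNReal.coe_toReal, ENNReal.toReal_ofReal h0] at h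

include hI in
/-- The supremum norm is dominated by the norm of the regularity class. -/
theorem Regularity.exists_norm_apply_le :
    ∃ C : ℝ≥0, ∀ x : C(S, F), R.Mem 𝔄 x → ∀ s, ‖x s‖ ≤ C * R.normOn 𝔄 x := by
  choose C hC using fun i => R.exists_jetNorm_toReal_le (F := F) 𝔄 hI i (Nat.zero_le R.order)
  have h1 : ∀ f : C(S, F), ContMDiff I 𝓘(ℝ, F) R.order f → ∀ s,
      ‖f s‖ ≤ (∑ i, C i : ℝ≥0) * R.normOn 𝔄 f := by
    intro f hf s
    obtain ⟨i, hi⟩ := mem_iUnion.1 (𝔄.iUnion_dom ▸ mem_univ s)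
    have h0 := R.normOn_nonneg 𝔄 (R.mem_of_contMDiff 𝔄 hf)
    have h2 := 𝔄.enorm_le_eLpNorm_top i (𝔄.continuousOn_read i f) hi
    have h3 : eLpNorm (𝔄.read i f) ⊤ (volume.restrict (𝔄.coordDom i)) =
        𝔄.jetNorm i 0 (R.exponent / ((0 : ℕ) : ENNReal)) f := by
      rw [R.exponent_div_zero]
      refine eLpNorm_congr_norm_ae (Eventually.of_forall fun y => ?_)
      rw [chartJet, norm_iteratedFDerivWithin_zero]
      rfl
    rw [h3, 𝔄.read_extend i f hi] at h2
    have h4 := ENNReal.toReal_mono (𝔄.jetNorm_lt_top (Nat.zero_le _) hf i _).ne h2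
    rw [toReal_enorm] at h4
    refine h4.trans ((hC i f hf).trans (mul_le_mul_of_nonneg_right ?_ h0))
    exact_mod_cast Finset.single_le_sum (f := C) (fun _ _ => zero_le) (Finset.mem_univ i)
  refine ⟨∑ i, C i, fun x hx s => ?_⟩
  -- The bound extends from `C^k` functions by density, since the approximations converge both
  -- pointwise and in norm.
  obtain ⟨f, hf, hfu, hfn⟩ := R.exists_seq_tendsto 𝔄 hI hx
  have h2 : Tendsto (fun n => ((∑ i, C i : ℝ≥0) : ℝ) * (R.normOn 𝔄 (f n - x) + R.normOn 𝔄 x)) atTop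
      (𝓝 ((∑ i, C i : ℝ≥0) * (0 + R.normOn 𝔄 x))) := (hfn.add_const _).const_mul _
  rw [zero_add] at h2
  refine le_of_tendsto_of_tendsto' (hfu.tendsto_at s).norm h2 fun n => (h1 (f n) (hf n) s).trans ?_
  refine mul_le_mul_of_nonneg_left ?_ (NNReal.coe_nonneg _)
  have := R.normOn_add_le 𝔄 ((R.mem_of_contMDiff 𝔄 (hf n)).sub 𝔄 hx) hx
  rwa [sub_add_cancel] at this

namespace MapSpace

variable (A : Set S)

/-- The inclusion into the space of continuous maps. -/
def toMapL : MapSpace 𝔄 R A F →L[ℂ] C(S, F) :=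
  LinearMap.mkContinuousOfExistsBound
    { toFun := toMap
      map_add' := fun _ _ => rfl
      map_smul' := fun _ _ => rfl } (by
    obtain ⟨C, hC⟩ := R.exists_norm_apply_le (F := F) 𝔄 hI
    refine ⟨C, fun x => ?_⟩
    exact (ContinuousMap.norm_le _ (mul_nonneg C.2 (norm_nonneg x))).2 fun s => hC x.toMap x.2.1 s)

lemma toMap_injective : Function.Injective (toMap : MapSpace 𝔄 R A F → C(S, F)) :=
  Subtype.val_injective

lemma norm_def (x : MapSpace 𝔄 R A F) : ‖x‖ = R.normOn 𝔄 x.toMap := rfl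

include hI in
theorem completeSpace : CompleteSpace (MapSpace 𝔄 R A F) := by
  refine Metric.complete_of_cauchySeq_tendsto fun x hx => ?_
  -- The supremum norm is dominated, so a uniform limit exists and is the candidate; being uniform,
  -- it also vanishes on `A`.
  obtain ⟨y, hy⟩ := cauchySeq_tendsto_of_complete
    ((toMapL 𝔄 R hI A (F := F)).uniformContinuous.comp_cauchySeq hx)
  have hyu : TendstoUniformly (fun n s => (x n).toMap s) y atTop :=
    ContinuousMap.tendsto_iff_tendstoUniformly.1 hy
  obtain ⟨h1, h2⟩ := R.mem_of_tendstoUniformly 𝔄 (fun n => (x n).2.1) (fun ε hε => by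
    obtain ⟨N, hN⟩ := Metric.cauchySeq_iff.1 hx ε hε
    refine ⟨N, fun m hm n hn => ?_⟩
    have := hN m hm n hn
    rw [dist_eq_norm] at this
    exact this.le) hyu
  have h3 : ∀ s ∈ A, y s = 0 := fun s hs =>
    tendsto_nhds_unique (hyu.tendsto_at s) (by
      have : ∀ n, (x n).toMap s = 0 := fun n => (x n).2.2 s hs
      simp only [this]
      exact tendsto_const_nhds)
  exact ⟨⟨y, h1, h3⟩, tendsto_iff_norm_sub_tendsto_zero.2 h2⟩

end MapSpace

end Completeness

/-! ### Analytic functions of maps -/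

section AnalyticComposition

open Filter

variable {d : ℕ} {H : Type*} [TopologicalSpace H]
  {I : ModelWithCorners ℝ (EuclideanSpace ℝ (Fin d)) H}
  {S : Type*} [TopologicalSpace S] [ChartedSpace H S] [IsManifold I ∞ S] [CompactSpace S]
  [T2Space S] (𝔄 : FiniteAtlas I S) (R : Regularity d)
  (hI : range I = univ ∨ ∃ l : EuclideanSpace ℝ (Fin d) →L[ℝ] ℝ, l ≠ 0 ∧ range I = {v | 0 ≤ l v})

namespace CkAlgebra

/-- The constant may blow up as `ε → 0`; it is needed only for each fixed weight. -/
lemma exists_normOn_le {ε : ℝ≥0} (hε : 0 < ε) :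
    ∃ C : ℝ, ∀ f : CkAlgebra 𝔄 R ε, R.normOn 𝔄 f.toMap ≤ C * ‖f‖ := by
  obtain ⟨C, hC⟩ := R.dominatedOn_normOn (F := ℂ) 𝔄
  refine ⟨C * ∑ i : Fin 𝔄.card, ∑ j ∈ Finset.range (R.order + 1), (j.factorial : ℝ) / (ε : ℝ) ^ j,
    fun f => ?_⟩
  have hfin : ∀ i, ∀ j ∈ Finset.range (R.order + 1),
      𝔄.jetNorm i j (R.exponent / j) f.toMap ≠ ⊤ := fun i j hj =>
    (𝔄.jetNorm_lt_top (Nat.lt_succ_iff.1 (Finset.mem_range.1 hj)) f.contMDiff i _).ne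
  have hfin' : ∀ i ∈ Finset.univ, ∑ j ∈ Finset.range (R.order + 1),
      𝔄.jetNorm i j (R.exponent / j) f.toMap ≠ ⊤ := fun i _ => ENNReal.sum_ne_top.2 (hfin i)
  have h := ENNReal.toReal_mono (ENNReal.mul_ne_top ENNReal.coe_ne_top
    (ENNReal.sum_ne_top.2 hfin')) (hC f.toMap f.contMDiff)
  rw [ENNReal.toReal_ofReal (R.normOn_nonneg 𝔄 (R.mem_of_contMDiff 𝔄 f.contMDiff)),
    ENNReal.toReal_mul, ENNReal.coe_toReal, ENNReal.toReal_sum hfin'] at h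
  refine h.trans ?_
  rw [mul_assoc]
  refine mul_le_mul_of_nonneg_left ?_ C.2
  rw [Finset.sum_mul]
  refine Finset.sum_le_sum fun i _ => ?_
  rw [ENNReal.toReal_sum (hfin i), Finset.sum_mul]
  refine Finset.sum_le_sum fun j hj => ?_
  have hε' : (0 : ℝ) < ε := hε
  have h1 := jetWeight_le_normFun i (Nat.lt_succ_iff.1 (Finset.mem_range.1 hj)) f
  rw [norm_def]
  calc (𝔄.jetNorm i j (R.exponent / j) f.toMap).toReal
      = (j.factorial : ℝ) / (ε : ℝ) ^ j * jetWeight 𝔄 R ε i j f.toMap := by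
        have : (j.factorial : ℝ) ≠ 0 := by positivity
        unfold jetWeight
        field_simp
    _ ≤ _ := mul_le_mul_of_nonneg_left h1 (by positivity)

include hI in
-- In this direction the constant does not depend on `ε ≤ 1`. This uniformity lets an approximation
-- error be fixed before `ε` tends to `0`.
lemma exists_norm_le : ∃ C : ℝ, 0 ≤ C ∧ ∀ ε : ℝ≥0, ε ≤ 1 → ∀ f : CkAlgebra 𝔄 R ε,
    ‖f‖ ≤ C * R.normOn 𝔄 f.toMap := by
  obtain ⟨C₀, hC₀⟩ := R.exists_norm_apply_le (F := ℂ) 𝔄 hI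
  have h : ∀ (i : Fin 𝔄.card) (j : ℕ), ∃ C : ℝ≥0, j ≤ R.order → ∀ f : C(S, ℂ),
      ContMDiff I 𝓘(ℝ, ℂ) R.order f →
        (𝔄.jetNorm i j (R.exponent / j) f).toReal ≤ C * R.normOn 𝔄 f := fun i j => by
    by_cases hj : j ≤ R.order
    · obtain ⟨C, hC⟩ := R.exists_jetNorm_toReal_le (F := ℂ) 𝔄 hI i hj
      exact ⟨C, fun _ => hC⟩
    · exact ⟨0, fun h => absurd h hj⟩
  choose C hC using h
  refine ⟨C₀ + ∑ i, ∑ j ∈ Finset.range R.order, (C i (j + 1) : ℝ), by positivity, fun ε hε f => ?_⟩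
  have h0 := R.normOn_nonneg 𝔄 (R.mem_of_contMDiff 𝔄 f.contMDiff)
  rw [norm_def, normFun, add_mul, Finset.sum_mul]
  refine add_le_add ((ContinuousMap.norm_le _ (by positivity)).2 fun s =>
    hC₀ _ (R.mem_of_contMDiff 𝔄 f.contMDiff) s) (Finset.sum_le_sum fun i _ => ?_)
  rw [Finset.sum_mul]
  refine Finset.sum_le_sum fun j hj => le_trans ?_ (hC i (j + 1) (Finset.mem_range.1 hj) f.toMap
    f.contMDiff)
  refine mul_le_of_le_one_left ENNReal.toReal_nonneg ?_
  have hε1 : (ε : ℝ) ≤ 1 := hε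
  have h2 : (1 : ℝ) ≤ ((j + 1).factorial : ℝ) := by exact_mod_cast (j + 1).factorial_pos
  exact div_le_one_of_le₀ ((pow_le_one₀ ε.2 hε1).trans h2) (by positivity)

/-- `C^k` functions as elements of the algebra. -/
def ofMap (ε : ℝ≥0) (f : C(S, ℂ)) (hf : ContMDiff I 𝓘(ℝ, ℂ) R.order f) : CkAlgebra 𝔄 R ε := ⟨f, hf⟩

/-- Only the supremum norm carries no positive power of `ε`. -/
lemma tendsto_norm (f : C(S, ℂ)) (hf : ContMDiff I 𝓘(ℝ, ℂ) R.order f) {ε : ℕ → ℝ≥0}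
    (hε : Tendsto ε atTop (𝓝 0)) :
    Tendsto (fun l => ‖ofMap 𝔄 R (ε l) f hf‖) atTop (𝓝 ‖f‖) := by
  have hε' : Tendsto (fun l => (ε l : ℝ)) atTop (𝓝 0) := by
    simpa using NNReal.tendsto_coe.2 hε
  have h : ∀ (i : Fin 𝔄.card) (j : ℕ),
      Tendsto (fun l => jetWeight 𝔄 R (ε l) i (j + 1) f) atTop (𝓝 0) := fun i j => by
    have := ((hε'.pow (j + 1)).div_const ((j + 1).factorial : ℝ)).mul_const
      (𝔄.jetNorm i (j + 1) (R.exponent / ((j + 1 : ℕ) : ENNReal)) f).toReal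
    simpa [jetWeight] using this
  have h2 := (tendsto_const_nhds (x := ‖f‖)).add (tendsto_finsetSum Finset.univ fun i _ =>
    tendsto_finsetSum (Finset.range R.order) fun j _ => h i j)
  simp only [Finset.sum_const_zero, add_zero] at h2
  exact h2

/-- The inclusion of the `C^k` functions. -/
def incl (ε : ℝ≥0) : CkAlgebra 𝔄 R ε →ₗ[ℂ] MapSpace 𝔄 R ∅ ℂ where
  toFun f := ⟨f.toMap, R.mem_of_contMDiff 𝔄 f.contMDiff, fun _ h => h.elim⟩
  map_add' _ _ := rfl
  map_smul' _ _ := rfl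

include hI in
lemma denseRange_incl (ε : ℝ≥0) : DenseRange (incl 𝔄 R ε) := by
  intro x
  obtain ⟨f, hf, -, hfn⟩ := R.exists_seq_tendsto 𝔄 hI x.2.1
  refine mem_closure_of_tendsto (f := fun n => incl 𝔄 R ε ⟨f n, hf n⟩)
    (tendsto_iff_norm_sub_tendsto_zero.2 hfn) (Eventually.of_forall fun n => mem_range_self _)

lemma denseRange_toCompl (ε : ℝ≥0) : DenseRange (UniformSpace.Completion.toComplₗᵢ (𝕜 := ℂ)
    (E := CkAlgebra 𝔄 R ε)).toLinearMap :=
  UniformSpace.Completion.denseRange_coe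

include hI in
/-- The completion of the algebra of `C^k` functions is the space of functions of the given
regularity, up to an equivalence of norms with one bound independent of the weight. -/
theorem exists_equiv : ∃ C : ℝ, 0 ≤ C ∧ ∀ ε : ℝ≥0, 0 < ε → ε ≤ 1 →
    ∃ J : UniformSpace.Completion (CkAlgebra 𝔄 R ε) ≃L[ℂ] MapSpace 𝔄 R ∅ ℂ,
      (∀ f : CkAlgebra 𝔄 R ε, J f = incl 𝔄 R ε f) ∧ ∀ y, ‖J.symm y‖ ≤ C * ‖y‖ := by
  obtain ⟨C, hC0, hC⟩ := exists_norm_le 𝔄 R hI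
  refine ⟨C, hC0, fun ε hε hε1 => ?_⟩
  have : CompleteSpace (MapSpace 𝔄 R ∅ ℂ) := MapSpace.completeSpace 𝔄 R hI ∅
  obtain ⟨C', hC'⟩ := exists_normOn_le 𝔄 R hε
  have h1 : ∃ C, ∀ f : CkAlgebra 𝔄 R ε, ‖incl 𝔄 R ε (LinearEquiv.refl ℂ _ f)‖ ≤
      C * ‖(UniformSpace.Completion.toComplₗᵢ (𝕜 := ℂ)).toLinearMap f‖ := ⟨C', fun f => by
    have h2 : ‖(UniformSpace.Completion.toComplₗᵢ (𝕜 := ℂ)).toLinearMap f‖ = ‖f‖ :=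
      UniformSpace.Completion.norm_coe f
    rw [h2]
    exact hC' f⟩
  have h2 : ∀ f : CkAlgebra 𝔄 R ε, ‖(UniformSpace.Completion.toComplₗᵢ (𝕜 := ℂ)).toLinearMap
      ((LinearEquiv.refl ℂ _).symm f)‖ ≤ C * ‖incl 𝔄 R ε f‖ := fun f => by
    have h3 : ‖(UniformSpace.Completion.toComplₗᵢ (𝕜 := ℂ)).toLinearMap f‖ = ‖f‖ :=
      UniformSpace.Completion.norm_coe f
    refine Eq.trans_le h3 (hC ε hε1 f)
  -- The `C^k` functions are dense in both complete spaces and the two norms are equivalent on them,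
  -- so their identity map extends to an isomorphism.
  refine ⟨(LinearEquiv.refl ℂ (CkAlgebra 𝔄 R ε)).extend _ _ (denseRange_toCompl 𝔄 R ε) h1
    (denseRange_incl 𝔄 R hI ε) ⟨C, h2⟩, fun f => ?_, fun y => ?_⟩
  · exact LinearEquiv.extend_eq _ _ _ (denseRange_toCompl 𝔄 R ε) h1
      (denseRange_incl 𝔄 R hI ε) ⟨C, h2⟩ f
  · exact LinearEquiv.norm_extend_symm_le _ _ _ C (denseRange_toCompl 𝔄 R ε) h1
      (denseRange_incl 𝔄 R hI ε) h2 y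

end CkAlgebra

end AnalyticComposition

/-! ### Holomorphic functions of scalar maps -/

section ScalarMaps

open Filter

variable {d : ℕ} {H : Type*} [TopologicalSpace H]
  {I : ModelWithCorners ℝ (EuclideanSpace ℝ (Fin d)) H}
  {S : Type*} [TopologicalSpace S] [ChartedSpace H S] [IsManifold I ∞ S] [CompactSpace S]
  [T2Space S] (𝔄 : FiniteAtlas I S) (R : Regularity d)
  (hI : range I = univ ∨ ∃ l : EuclideanSpace ℝ (Fin d) →L[ℝ] ℝ, l ≠ 0 ∧ range I = {v | 0 ≤ l v})

namespace MapSpace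

lemma exists_toMap_eq_ofReal {g : S → ℝ} (hg : ContMDiff I 𝓘(ℝ) ∞ g) :
    ∃ x : MapSpace 𝔄 R ∅ ℂ, ∀ s, x.toMap s = g s := by
  have h : ContMDiff I 𝓘(ℝ, ℂ) R.order fun s => (g s : ℂ) :=
    (Complex.ofRealCLM.contDiff.contMDiff.comp hg).of_le (by exact_mod_cast le_top)
  exact ⟨⟨⟨_, h.continuous⟩, R.mem_of_contMDiff 𝔄 h, fun _ h => h.elim⟩, fun s => rfl⟩

/-- The `ψ` are smooth Urysohn functions, equal to `1` on the supports of a partition of unity and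
`0` outside the sets of the cover. -/
lemma exists_partition (t : Finset S) (U : S → Set S) (hU : ∀ a, IsOpen (U a))
    (ht : (⋃ a ∈ t, U a) = univ) : ∃ φ ψ : S → MapSpace 𝔄 R ∅ ℂ,
      (∀ s, ∑ a ∈ t, (φ a).toMap s = 1) ∧ ∀ a ∈ t, ∀ s, ‖(ψ a).toMap s‖ ≤ 1 ∧
        (s ∉ U a → (ψ a).toMap s = 0) ∧ ((φ a).toMap s ≠ 0 → (ψ a).toMap s = 1) := by
  obtain ⟨p, hp⟩ := SmoothPartitionOfUnity.exists_isSubordinate I isClosed_univ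
    (fun a : t => U a) (fun a => hU a) (by rw [← ht, iUnion_subtype])
  have h : ∀ a : S, ∃ φ ψ : MapSpace 𝔄 R ∅ ℂ, ∀ h : a ∈ t, (∀ s, φ.toMap s = p ⟨a, h⟩ s) ∧
      ∀ s, ‖ψ.toMap s‖ ≤ 1 ∧ (s ∉ U a → ψ.toMap s = 0) ∧ (φ.toMap s ≠ 0 → ψ.toMap s = 1) := by
    intro a
    by_cases h : a ∈ t
    · obtain ⟨φ, hφ⟩ := exists_toMap_eq_ofReal 𝔄 R (p ⟨a, h⟩).contMDiff
      obtain ⟨g, hg0, hg1, hg⟩ := exists_contMDiffMap_zero_one_of_isClosed (n := ⊤) I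
        (hU a).isClosed_compl (isClosed_tsupport (p ⟨a, h⟩))
        (disjoint_compl_left_iff_subset.2 (hp ⟨a, h⟩))
      obtain ⟨ψ, hψ⟩ := exists_toMap_eq_ofReal 𝔄 R g.contMDiff
      refine ⟨φ, ψ, fun _ => ⟨hφ, fun s => ⟨?_, fun hs => ?_, fun hs => ?_⟩⟩⟩
      · rw [hψ, Complex.norm_real, Real.norm_of_nonneg (hg s).1]
        exact (hg s).2
      · rw [hψ, hg0 hs, Pi.zero_apply, Complex.ofReal_zero]
      · have : s ∈ tsupport (p ⟨a, h⟩) := subset_tsupport _ fun h0 => hs (by rw [hφ, h0]; simp)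
        rw [hψ, hg1 this, Pi.one_apply, Complex.ofReal_one]
    · exact ⟨0, 0, fun h' => absurd h' h⟩
  choose φ ψ hφψ using h
  refine ⟨φ, ψ, fun s => ?_, fun a ha => (hφψ a ha).2⟩
  have h1 := p.sum_eq_one (mem_univ s)
  rw [finsum_eq_sum_of_fintype] at h1
  rw [← Finset.sum_coe_sort, ← Complex.ofReal_one, ← h1, Complex.ofReal_sum]
  exact Finset.sum_congr rfl fun a _ => (hφψ a a.2).1 s

include hI in
-- The abstract composition theorem for the completions of `CkAlgebra` with the weights `ε = 1 / (l
-- + 1)`.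
theorem exists_analyticAt_comp {n : ℕ} {Ω : Set (EuclideanSpace ℂ (Fin n))}
    {f : EuclideanSpace ℂ (Fin n) → ℂ} (hf : AnalyticOnNhd ℂ f Ω)
    (x₀ : Fin n → MapSpace 𝔄 R ∅ ℂ)
    (hx₀ : ∀ s, WithLp.toLp 2 (fun j => (x₀ j).toMap s) ∈ Ω) :
    ∃ G : (Fin n → MapSpace 𝔄 R ∅ ℂ) → MapSpace 𝔄 R ∅ ℂ, AnalyticAt ℂ G x₀ ∧
      ∀ᶠ x in 𝓝 x₀, ∀ s, (G x).toMap s = f (WithLp.toLp 2 fun j => (x j).toMap s) := by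
  -- On an empty `S` a bound on all values says nothing, not even that the bound is nonnegative, so
  -- the norm comparison below would fail.
  rcases isEmpty_or_nonempty S with hS | hS
  · exact ⟨fun _ => 0, analyticAt_const, Eventually.of_forall fun _ s => (hS.false s).elim⟩
  set ε : ℕ → ℝ≥0 := fun l => ((l : ℝ≥0) + 1)⁻¹ with hε
  have hε0 : ∀ l, 0 < ε l := fun l => by positivity
  have hε1 : ∀ l, ε l ≤ 1 := fun l => inv_le_one_of_one_le₀ (by simp)
  have hεlim : Tendsto ε atTop (𝓝 0) := by
    simpa [hε, one_div] using tendsto_one_div_add_atTop_nhds_zero_nat (𝕜 := ℝ≥0)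
  obtain ⟨C, hC0, hC⟩ := CkAlgebra.exists_equiv 𝔄 R hI
  choose J hJ hJn using fun l => hC (ε l) (hε0 l) (hε1 l)
  let ev : S → MapSpace 𝔄 R ∅ ℂ →L[ℂ] ℂ := fun s =>
    (ContinuousMap.evalCLM ℂ s).comp (toMapL 𝔄 R hI ∅)
  have hev : ∀ s x, ev s x = x.toMap s := fun s x => rfl
  obtain ⟨C₀, hC₀⟩ := R.exists_norm_apply_le (F := ℂ) 𝔄 hI
  -- Evaluation at `s` is multiplicative on `C^k` functions, hence on the completion by continuity.
  let χ : ∀ l, S → (UniformSpace.Completion (CkAlgebra 𝔄 R (ε l)) →ₐ[ℂ] ℂ) := fun l s =>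
    AlgHom.ofLinearMap ((ev s).comp (J l).toContinuousLinearMap).toLinearMap (by
      change ev s (J l 1) = 1
      rw [← UniformSpace.Completion.coe_one, hJ]
      rfl) fun a b => by
      change ev s (J l (a * b)) = ev s (J l a) * ev s (J l b)
      refine UniformSpace.Completion.induction_on₂ a b (isClosed_eq ?_ ?_) fun f g => ?_
      · exact (ev s).continuous.comp ((J l).continuous.comp continuous_mul)
      · exact ((ev s).continuous.comp ((J l).continuous.comp continuous_fst)).mul
          ((ev s).continuous.comp ((J l).continuous.comp continuous_snd))
      · rw [← UniformSpace.Completion.coe_mul, hJ, hJ, hJ]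
        rfl
  have hχ : ∀ l s b, χ l s b = ev s (J l b) := fun l s b => rfl
  refine _root_.exists_analyticAt_comp ev (fun x => x.toMap.continuous)
    (fun l => UniformSpace.Completion (CkAlgebra 𝔄 R (ε l))) J χ hχ (fun l s b => ?_)
    (fun x y hxy => toMap_injective 𝔄 R ∅ (ContinuousMap.ext hxy)) (fun y c c' hcc hy => ?_)
    (exists_partition 𝔄 R) hf x₀ hx₀
  · rw [hχ]
    refine UniformSpace.Completion.induction_on b (isClosed_le ?_ continuous_norm) fun f => ?_
    · exact ((ev s).continuous.comp (J l).continuous).norm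
    · rw [hJ, UniformSpace.Completion.norm_coe]
      exact (f.toMap.norm_coe_le_norm s).trans (CkAlgebra.norm_toMap_le_normFun f)
  -- Replace `y` by a `C^k` function at distance `δ`. Its supremum norm is at most `c + C₀ δ`, its
  -- algebra norms tend to that, and the error costs at most `C δ` uniformly in `l`; so `δ` is
  -- chosen first and `l` afterwards.
  · obtain ⟨f, hf, -, hfn⟩ := R.exists_seq_tendsto 𝔄 hI y.2.1
    have hlim : Tendsto (fun m => c + (C₀ * R.normOn 𝔄 (f m - y.toMap) +
        C * R.normOn 𝔄 (f m - y.toMap))) atTop (𝓝 (c + (C₀ * 0 + C * 0))) :=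
      ((hfn.const_mul _).add (hfn.const_mul _)).const_add _
    simp only [mul_zero, add_zero] at hlim
    obtain ⟨m, hm⟩ := (hlim.eventually (gt_mem_nhds hcc)).exists
    have hfm : R.Mem 𝔄 (f m) := R.mem_of_contMDiff 𝔄 (hf m)
    set δ := R.normOn 𝔄 (f m - y.toMap)
    have hfc : ‖f m‖ ≤ c + C₀ * δ := by
      refine (ContinuousMap.norm_le_of_nonempty _).2 fun s => ?_
      have h1 := hC₀ _ (hfm.sub 𝔄 y.2.1) s
      rw [ContinuousMap.sub_apply] at h1
      have h2 := norm_le_norm_add_norm_sub (y.toMap s) (f m s)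
      have h3 := hy s
      rw [hev] at h3
      rw [norm_sub_rev] at h2
      change ‖f m s - y.toMap s‖ ≤ C₀ * δ at h1
      have h4 := norm_sub_rev (f m s) (y.toMap s)
      linarith
    have hlt : ‖f m‖ < c' - C * δ := by linarith
    filter_upwards [(CkAlgebra.tendsto_norm 𝔄 R (f m) (hf m) hεlim).eventually
      (gt_mem_nhds hlt)] with l hl
    set a := CkAlgebra.ofMap 𝔄 R (ε l) (f m) (hf m) with ha
    have h1 : (J l).symm y = a - (J l).symm (CkAlgebra.incl 𝔄 R (ε l) a - y) := by
      rw [map_sub, ← hJ, ContinuousLinearEquiv.symm_apply_apply]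
      abel
    have h2 : ‖CkAlgebra.incl 𝔄 R (ε l) a - y‖ = δ := rfl
    rw [h1]
    refine (norm_sub_le _ _).trans_lt ?_
    have h3 := hJn l (CkAlgebra.incl 𝔄 R (ε l) a - y)
    rw [h2] at h3
    rw [UniformSpace.Completion.norm_coe]
    linarith

end MapSpace

end ScalarMaps

/-! ### Differentiable maps into closed subspaces -/

section ClosedSubspace

open Filter

/-- As `T` is bounded below, its range is closed and it is an isomorphism onto the range; the
derivative of `T ∘ g` takes values in the range and can be pulled back. -/
theorem contDiffOn_one_of_comp {X W V : Type*} [NormedAddCommGroup X] [NormedSpace ℂ X]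
    [NormedAddCommGroup W] [NormedSpace ℂ W] [CompleteSpace W] [NormedAddCommGroup V]
    [NormedSpace ℂ V] [CompleteSpace V] (T : W →L[ℂ] V) {C : ℝ≥0} (hT : ∀ x, ‖x‖ ≤ C * ‖T x‖) {Q : Set X}
    (hQ : IsOpen Q) {g : X → W} (hg : ContDiffOn ℂ 1 (T ∘ g) Q) : ContDiffOn ℂ 1 g Q := by
  have hanti : AntilipschitzWith C T := AddMonoidHomClass.antilipschitz_of_bound T hT
  have hclo : IsClosed (range T) := hanti.isClosed_range T.uniformContinuous
  have hd : ∀ x ∈ Q, HasFDerivAt (T ∘ g) (fderiv ℂ (T ∘ g) x) x := fun x hx =>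
    ((hg.differentiableOn (by simp)).differentiableAt (hQ.mem_nhds hx)).hasFDerivAt
  have hmem : ∀ x ∈ Q, ∀ v, fderiv ℂ (T ∘ g) x v ∈ range T := by
    intro x hx v
    -- Difference quotients of `T ∘ g` lie in the closed range, and so do their limits.
    have h1 := ((hd x hx).hasLineDerivAt v).tendsto_slope_zero
    refine hclo.mem_of_tendsto h1 (Eventually.of_forall fun t => ?_)
    exact ⟨t⁻¹ • (g (x + (0 + t) • v) - g (x + (0 : ℂ) • v)), by simp⟩
  let e := T.equivRange hanti.injective hclo
  have he : ∀ y, T (e.symm y) = y := fun y => by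
    have h := e.apply_symm_apply y
    have h2 := congrFun (T.coe_equivRange hanti.injective hclo) (e.symm y)
    exact (congrArg Subtype.val h2).symm.trans (congrArg Subtype.val h)
  have hex : ∀ x, ∃ D : X →L[ℂ] W, x ∈ Q → T.comp D = fderiv ℂ (T ∘ g) x := by
    intro x
    by_cases hx : x ∈ Q
    · exact ⟨e.symm.toContinuousLinearMap.comp ((fderiv ℂ (T ∘ g) x).codRestrict T.range
        (hmem x hx)), fun _ => by
        ext v
        exact he _⟩
    · exact ⟨0, fun h => absurd h hx⟩
  choose D hD using hex
  have hgD : ∀ x ∈ Q, HasFDerivAt g (D x) x := by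
    intro x hx
    refine HasFDerivAt.of_isLittleO (Asymptotics.IsBigO.trans_isLittleO ?_ (hd x hx).isLittleO)
    refine Asymptotics.IsBigO.of_bound C (Eventually.of_forall fun y => ?_)
    refine (hT _).trans_eq ?_
    rw [← hD x hx]
    simp
  rw [show (1 : WithTop ℕ∞) = 0 + 1 by simp, contDiffOn_succ_iff_fderiv_of_isOpen hQ]
  refine ⟨fun x hx => (hgD x hx).differentiableAt.differentiableWithinAt, by simp, ?_⟩
  rw [contDiffOn_zero]
  have hcont : ContinuousOn (fderiv ℂ (T ∘ g)) Q := hg.continuousOn_fderiv_of_isOpen hQ le_rfl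
  intro x hx
  refine tendsto_iff_norm_sub_tendsto_zero.2 ?_
  have h0 := (tendsto_iff_norm_sub_tendsto_zero.1 (hcont x hx)).const_mul (C : ℝ)
  rw [mul_zero] at h0
  refine squeeze_zero' (Eventually.of_forall fun _ => norm_nonneg _) ?_ h0
  filter_upwards [self_mem_nhdsWithin] with y hy
  rw [(hgD y hy).fderiv, (hgD x hx).fderiv]
  refine ContinuousLinearMap.opNorm_le_bound _ (by positivity) fun v => (hT _).trans ?_
  rw [mul_assoc]
  refine mul_le_mul_of_nonneg_left ?_ C.2
  refine le_trans (le_of_eq ?_) ((fderiv ℂ (T ∘ g) y - fderiv ℂ (T ∘ g) x).le_opNorm v)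
  rw [← hD x hx, ← hD y hy]
  simp

end ClosedSubspace

/-! ### Composition with linear maps -/

section LinearComposition

open Filter

variable {d : ℕ} {F G : Type*} [NormedAddCommGroup F] [NormedSpace ℂ F] [CompleteSpace F]
  [NormedAddCommGroup G] [NormedSpace ℂ G] [CompleteSpace G]

lemma MeasureTheory.LocallyIntegrableOn.clm_comp {V : Set (EuclideanSpace ℝ (Fin d))}
    {u : EuclideanSpace ℝ (Fin d) → F} (hu : LocallyIntegrableOn u V) (L : F →L[ℂ] G) :
    LocallyIntegrableOn (L ∘ u) V := fun y hy => by
  obtain ⟨s, hs, hi⟩ := hu y hy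
  exact ⟨s, hs, L.integrable_comp hi⟩

lemma IsWeakDeriv.clm_comp {V : Set (EuclideanSpace ℝ (Fin d))} {j : ℕ} {J : Fin j → Fin d}
    {u g : EuclideanSpace ℝ (Fin d) → F} (h : IsWeakDeriv V J u g) (L : F →L[ℂ] G) :
    IsWeakDeriv V J (L ∘ u) (L ∘ g) := by
  refine ⟨h.1.clm_comp L, h.2.1.clm_comp L, fun φ hφ hc hV => ?_⟩
  have hc' : HasCompactSupport (partialDeriv J φ) :=
    hc.of_isClosed_subset (isClosed_tsupport _) (tsupport_partialDeriv_subset J φ)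
  have hV' := (tsupport_partialDeriv_subset J φ).trans hV
  have hd := continuous_partialDeriv J hφ
  have hsmul : ∀ (a : ℝ) (v : F), L (a • v) = a • L v := fun a v =>
    (L.restrictScalars ℝ).map_smul a v
  simp only [Function.comp_apply, ← hsmul]
  rw [L.integral_comp_comm (integrable_test_smul hd hc' hV' h.1),
    L.integral_comp_comm (integrable_test_smul hφ.continuous hc hV h.2.1), h.2.2 φ hφ hc hV, hsmul]

lemma sobolevNormOn_clm_comp_le {V : Set (EuclideanSpace ℝ (Fin d))} (hV : IsOpen V) {k : ℕ}
    {p : ℝ≥0} {u : EuclideanSpace ℝ (Fin d) → F} (hu : MemSobolevOn V k p u) (L : F →L[ℂ] G) :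
    MemSobolevOn V k p (L ∘ u) ∧ sobolevNormOn V k p (L ∘ u) ≤ ‖L‖ * sobolevNormOn V k p u := by
  have hmem : MemSobolevOn V k p (L ∘ u) := fun j hj J => by
    obtain ⟨g, hg, hgp⟩ := hu j hj J
    exact ⟨L ∘ g, hg.clm_comp L, L.comp_memLp' hgp⟩
  refine ⟨hmem, ?_⟩
  unfold sobolevNormOn
  rw [Finset.mul_sum]
  refine Finset.sum_le_sum fun j hj => ?_
  rw [Finset.mul_sum]
  refine Finset.sum_le_sum fun J _ => ?_
  have hj : j ≤ k := Nat.lt_succ_iff.1 (Finset.mem_range.1 hj)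
  have h1 := (hmem.isWeakDeriv hj J).ae_eq hV ((hu.isWeakDeriv hj J).clm_comp L)
  rw [eLpNorm_congr_ae h1]
  have h2 : eLpNorm (L ∘ weakDeriv V J u) p (volume.restrict V) ≤
      ENNReal.ofReal ‖L‖ * eLpNorm (weakDeriv V J u) p (volume.restrict V) :=
    eLpNorm_le_mul_eLpNorm_of_ae_le_mul (Eventually.of_forall fun y => L.le_opNorm _) _
  have h3 := ENNReal.toReal_mono (ENNReal.mul_ne_top ENNReal.ofReal_ne_top
    (MemSobolevOn.memLp hV hu hj J).2.ne) h2
  rwa [ENNReal.toReal_mul, ENNReal.toReal_ofReal (norm_nonneg L)] at h3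

variable {H : Type*} [TopologicalSpace H] {I : ModelWithCorners ℝ (EuclideanSpace ℝ (Fin d)) H}
  {S : Type*} [TopologicalSpace S] [ChartedSpace H S] [IsManifold I ∞ S] [CompactSpace S]
  (𝔄 : FiniteAtlas I S) (R : Regularity d)

lemma FiniteAtlas.ckNorm_clm_comp_le {k : ℕ} {x : S → F} (hx : ContMDiff I 𝓘(ℝ, F) k x)
    (L : F →L[ℂ] G) : 𝔄.ckNorm k (L ∘ x) ≤ ‖L‖ * 𝔄.ckNorm k x := by
  unfold FiniteAtlas.ckNorm
  rw [Finset.mul_sum]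
  refine Finset.sum_le_sum fun i _ => ?_
  rw [Finset.mul_sum]
  refine Finset.sum_le_sum fun j hj => ?_
  have hj : j ≤ k := Nat.lt_succ_iff.1 (Finset.mem_range.1 hj)
  have h0 : 0 ≤ ⨆ s : 𝔄.dom i, ‖iteratedFDerivWithin ℝ j (𝔄.read i x)
      ((𝔄.chart i).extend I).target ((𝔄.chart i).extend I s)‖ :=
    Real.iSup_nonneg fun _ => norm_nonneg _
  refine Real.iSup_le (fun s => ?_) (by positivity)
  have h1 := (L.restrictScalars ℝ).iteratedFDerivWithin_comp_left
    (((𝔄.contDiffOn_read hx i) _ (𝔄.extend_mem_target i s))) (uniqueDiffOn_chartTarget _)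
    (𝔄.extend_mem_target i s) (i := j) (by exact_mod_cast hj)
  have h2 : 𝔄.read i (L ∘ x) = L.restrictScalars ℝ ∘ 𝔄.read i x := rfl
  rw [h2, h1]
  refine (ContinuousLinearMap.norm_compContinuousMultilinearMap_le _ _).trans ?_
  rw [ContinuousLinearMap.norm_restrictScalars]
  exact mul_le_mul_of_nonneg_left (le_ciSup (𝔄.bddAbove_ck hj hx i) s) (norm_nonneg L)

lemma Regularity.normOn_clm_comp_le {x : C(S, F)} (hx : R.Mem 𝔄 x) (L : F →L[ℂ] G) :
    R.Mem 𝔄 ((L : C(F, G)).comp x) ∧ R.normOn 𝔄 ((L : C(F, G)).comp x) ≤ ‖L‖ * R.normOn 𝔄 x := by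
  cases R with
  | C k =>
    refine ⟨?_, 𝔄.ckNorm_clm_comp_le hx L⟩
    exact ((L.restrictScalars ℝ).contDiff.contMDiff (n := k)).comp
      (show ContMDiff I 𝓘(ℝ, F) k x from hx)
  | W k p hk hp hdP =>
    have h := fun i => sobolevNormOn_clm_comp_le (𝔄.isOpen_coordDom i) (hx i) L
    refine ⟨fun i => (h i).1, ?_⟩
    change ∑ i, sobolevNormOn (𝔄.coordDom i) k p (L ∘ 𝔄.read i x) ≤
      ‖L‖ * ∑ i, sobolevNormOn (𝔄.coordDom i) k p (𝔄.read i x)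
    rw [Finset.mul_sum]
    exact Finset.sum_le_sum fun i _ => (h i).2

namespace MapSpace

variable {𝔄 R} in
/-- Composition with a continuous linear map, forgetting that the maps vanish on `A`. -/
def postcomp (A : Set S) (L : F →L[ℂ] G) : MapSpace 𝔄 R A F →L[ℂ] MapSpace 𝔄 R ∅ G :=
  LinearMap.mkContinuous
    { toFun := fun x => ⟨(L : C(F, G)).comp x.toMap, (R.normOn_clm_comp_le 𝔄 x.2.1 L).1,
        fun _ h => h.elim⟩
      map_add' := fun x y => Subtype.ext (ContinuousMap.ext fun s =>
        L.map_add (x.toMap s) (y.toMap s))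
      map_smul' := fun c x => Subtype.ext (ContinuousMap.ext fun s => L.map_smul c (x.toMap s)) }
    ‖L‖ fun x => (R.normOn_clm_comp_le 𝔄 x.2.1 L).2

end MapSpace

end LinearComposition

/-! ### Retractions of spaces of maps -/

section Retractions

open Filter

variable {d n : ℕ} {H : Type*} [TopologicalSpace H]
  {I : ModelWithCorners ℝ (EuclideanSpace ℝ (Fin d)) H}
  {S : Type*} [TopologicalSpace S] [ChartedSpace H S] [IsManifold I ∞ S] [CompactSpace S]
  [T2Space S] (𝔄 : FiniteAtlas I S) (R : Regularity d) (A : Set S)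
  (hI : range I = univ ∨ ∃ l : EuclideanSpace ℝ (Fin d) →L[ℝ] ℝ, l ≠ 0 ∧ range I = {v | 0 ≤ l v})

namespace MapSpace

/-! ### Null-homotopic maps into a given set. -/

section Into

variable {F : Type*} [NormedAddCommGroup F] [NormedSpace ℂ F] {𝔄 R A}

lemma mem_of_mem_into {N : Set F} {x : MapSpace 𝔄 R A F} (hx : x ∈ into 𝔄 R A N) (s : S) :
    x.toMap s ∈ N := by
  obtain ⟨h⟩ := hx
  have h1 := (h.prop 0).1 s
  rwa [ContinuousMap.Homotopy.curry_apply, ContinuousMap.HomotopyWith.coe_toHomotopy,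
    h.apply_zero] at h1

lemma into_mono {N N' : Set F} (h : N ⊆ N') : into 𝔄 R A N ⊆ into 𝔄 R A N' := by
  rintro x ⟨hx⟩
  exact ⟨⟨hx.toHomotopy, fun t => ⟨fun s => h ((hx.prop' t).1 s), (hx.prop' t).2⟩⟩⟩

/-- Homotopies can be composed with maps that preserve the base point. -/
lemma mem_into_of_comp {Ω N : Set F} {ρ : F → F} (hρc : ContinuousOn ρ Ω) (hρ : MapsTo ρ Ω N)
    (hρ0 : ρ 0 = 0) {x y : MapSpace 𝔄 R A F} (hx : x ∈ into 𝔄 R A Ω)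
    (hy : ∀ s, y.toMap s = ρ (x.toMap s)) : y ∈ into 𝔄 R A N := by
  obtain ⟨h⟩ := hx
  have hΩ : ∀ q, h q ∈ Ω := fun q => (h.prop q.1).1 q.2
  refine ⟨⟨⟨⟨fun q => ρ (h q), hρc.comp_continuous h.continuous hΩ⟩, fun s => ?_, fun s => ?_⟩,
    fun t => ⟨fun s => hρ (hΩ (t, s)), fun s hs => ?_⟩⟩⟩
  · change ρ (h (0, s)) = y.toMap s
    rw [h.apply_zero, hy]
  · change ρ (h (1, s)) = ContinuousMap.const S 0 s
    rw [h.apply_one]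
    exact hρ0
  · change ρ (h (t, s)) = 0
    have h1 : h (t, s) = 0 := (h.prop t).2 s hs
    rw [h1, hρ0]

include hI in
-- The norm dominates the supremum norm, so a nearby map can be joined to `x₀` by straight segments
-- inside `Ω`; they are constant on `A`, where both maps vanish.
lemma isOpen_into [CompleteSpace F] {Ω : Set F} (hΩ : IsOpen Ω) : IsOpen (into 𝔄 R A Ω) := by
  rw [isOpen_iff_mem_nhds]
  intro x₀ hx₀
  have hK : IsCompact (range x₀.toMap) := isCompact_range x₀.toMap.continuous
  obtain ⟨δ, hδ, hsub⟩ := hK.exists_thickening_subset_open hΩ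
    (range_subset_iff.2 (mem_of_mem_into hx₀))
  have hnear : ∀ᶠ x in 𝓝 x₀, dist (toMapL 𝔄 R hI A x) (toMapL 𝔄 R hI A x₀) < δ :=
    (toMapL 𝔄 R hI A).continuous.continuousAt.eventually (Metric.ball_mem_nhds _ hδ)
  filter_upwards [hnear] with x hx
  obtain ⟨h⟩ := hx₀
  refine ⟨ContinuousMap.HomotopyWith.trans ⟨ContinuousMap.Homotopy.affine x.toMap x₀.toMap,
    fun t => ⟨fun s => hsub ?_, fun s hs => ?_⟩⟩ h⟩
  · refine Metric.mem_thickening_iff.2 ⟨x₀.toMap s, mem_range_self s, ?_⟩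
    change dist (AffineMap.lineMap (x.toMap s) (x₀.toMap s) (t : ℝ)) (x₀.toMap s) < δ
    rw [dist_lineMap_right]
    have h1 := ContinuousMap.dist_apply_le_dist (f := x.toMap) (g := x₀.toMap) s
    have h2 : ‖1 - (t : ℝ)‖ ≤ 1 := by
      rw [Real.norm_of_nonneg (by linarith [t.2.2])]
      linarith [t.2.1]
    calc ‖1 - (t : ℝ)‖ * dist (x.toMap s) (x₀.toMap s)
        ≤ 1 * dist (x.toMap s) (x₀.toMap s) := by gcongr
      _ ≤ dist x.toMap x₀.toMap := by rw [one_mul]; exact h1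
      _ < δ := hx
  · change AffineMap.lineMap (x.toMap s) (x₀.toMap s) (t : ℝ) = (0 : F)
    have h1 : x.toMap s = 0 := x.2.2 s hs
    have h2 : x₀.toMap s = 0 := x₀.2.2 s hs
    rw [h1, h2, AffineMap.lineMap_same_apply]

end Into

/-- The coordinates of a map into `ℂⁿ`. -/
def coords : MapSpace 𝔄 R A (EuclideanSpace ℂ (Fin n)) →L[ℂ] (Fin n → MapSpace 𝔄 R ∅ ℂ) :=
  ContinuousLinearMap.pi fun j => postcomp A (EuclideanSpace.proj j)

@[simp]
lemma toMap_coords (x : MapSpace 𝔄 R A (EuclideanSpace ℂ (Fin n))) (j : Fin n) (s : S) :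
    (coords 𝔄 R A x j).toMap s = x.toMap s j := rfl

/-- The map into `ℂⁿ` with the given coordinates. -/
def ofCoords : (Fin n → MapSpace 𝔄 R ∅ ℂ) →L[ℂ] MapSpace 𝔄 R ∅ (EuclideanSpace ℂ (Fin n)) :=
  ∑ j, (postcomp ∅ ((ContinuousLinearMap.id ℂ ℂ).smulRight (EuclideanSpace.single j 1))).comp
    (ContinuousLinearMap.proj j)

lemma toMap_ofCoords (y : Fin n → MapSpace 𝔄 R ∅ ℂ) (s : S) :
    (ofCoords 𝔄 R y).toMap s = WithLp.toLp 2 fun j => (y j).toMap s := by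
  let ev : MapSpace 𝔄 R ∅ (EuclideanSpace ℂ (Fin n)) →+ EuclideanSpace ℂ (Fin n) :=
    { toFun := fun x => x.toMap s
      map_zero' := rfl
      map_add' := fun _ _ => rfl }
  change ev (ofCoords 𝔄 R y) = _
  rw [ofCoords, sum_apply, map_sum]
  ext i
  simp only [WithLp.ofLp_sum, Finset.sum_apply]
  rw [Finset.sum_eq_single i]
  · change ((y i).toMap s • EuclideanSpace.single i (1 : ℂ) : EuclideanSpace ℂ (Fin n)) i = _
    simp
  · intro j _ hj
    change ((y j).toMap s • EuclideanSpace.single j (1 : ℂ) : EuclideanSpace ℂ (Fin n)) i = _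
    simp [hj.symm]
  · simp

/-- `ofCoords` recovers `x` from its coordinates, and the norm does not see the condition on `A`.
Thus `coords` is bounded below, as `contDiffOn_one_of_comp` requires. -/
lemma norm_le_norm_coords (x : MapSpace 𝔄 R A (EuclideanSpace ℂ (Fin n))) :
    ‖x‖ ≤ ‖ofCoords 𝔄 R (n := n)‖ * ‖coords 𝔄 R A x‖ := by
  have h : (ofCoords 𝔄 R (coords 𝔄 R A x)).toMap = x.toMap :=
    ContinuousMap.ext fun s => by rw [toMap_ofCoords]; rfl
  have h2 : ‖x‖ = ‖ofCoords 𝔄 R (coords 𝔄 R A x)‖ := by rw [norm_def, norm_def, h]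
  rw [h2]
  exact (ofCoords 𝔄 R).le_opNorm _

include hI in
/-- Composition with a holomorphic map that preserves the base point. -/
theorem exists_comp_contDiffOn {Ω : Set (EuclideanSpace ℂ (Fin n))} (hΩ : IsOpen Ω)
    {ρ : EuclideanSpace ℂ (Fin n) → EuclideanSpace ℂ (Fin n)} (hρ : DifferentiableOn ℂ ρ Ω)
    (hρ0 : ρ 0 = 0) :
    ∃ r : MapSpace 𝔄 R A (EuclideanSpace ℂ (Fin n)) → MapSpace 𝔄 R A (EuclideanSpace ℂ (Fin n)),
      (∀ x ∈ into 𝔄 R A Ω, ∀ s, (r x).toMap s = ρ (x.toMap s)) ∧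
        ContDiffOn ℂ 1 r (into 𝔄 R A Ω) := by
  have hc : CompleteSpace (MapSpace 𝔄 R A (EuclideanSpace ℂ (Fin n))) :=
    completeSpace 𝔄 R hI A
  have hc' : CompleteSpace (MapSpace 𝔄 R ∅ ℂ) := completeSpace 𝔄 R hI ∅
  have han : ∀ j, AnalyticOnNhd ℂ (fun z => ρ z j) Ω := fun j =>
    analyticOnNhd_of_differentiableOn hΩ
      ((EuclideanSpace.proj (𝕜 := ℂ) j).differentiable.comp_differentiableOn hρ)
  have hloc : ∀ x₀ ∈ into 𝔄 R A Ω, ∃ G : (Fin n → MapSpace 𝔄 R ∅ ℂ) → Fin n → MapSpace 𝔄 R ∅ ℂ,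
      AnalyticAt ℂ G (coords 𝔄 R A x₀) ∧ ∀ᶠ y in 𝓝 (coords 𝔄 R A x₀), ∀ j s,
        (G y j).toMap s = ρ (WithLp.toLp 2 fun j => (y j).toMap s) j := by
    intro x₀ hx₀
    choose G hG hGe using fun j => exists_analyticAt_comp 𝔄 R hI (han j) (coords 𝔄 R A x₀)
      fun s => mem_of_mem_into hx₀ s
    exact ⟨fun y j => G j y, analyticAt_pi_iff.2 hG, eventually_all.2 hGe⟩
  have hex : ∀ x, ∃ y : MapSpace 𝔄 R A (EuclideanSpace ℂ (Fin n)), x ∈ into 𝔄 R A Ω →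
      ∀ s, y.toMap s = ρ (x.toMap s) := by
    intro x
    by_cases hx : x ∈ into 𝔄 R A Ω
    · obtain ⟨G, -, hG⟩ := hloc x hx
      have h1 : ∀ s, (ofCoords 𝔄 R (G (coords 𝔄 R A x))).toMap s = ρ (x.toMap s) := fun s => by
        rw [toMap_ofCoords]
        ext j
        exact hG.self_of_nhds j s
      -- The composition vanishes on `A` again because `ρ` fixes `0`.
      refine ⟨⟨(ofCoords 𝔄 R (G (coords 𝔄 R A x))).toMap, (ofCoords 𝔄 R _).2.1, fun s hs => ?_⟩,
        fun _ => h1⟩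
      have h2 : x.toMap s = 0 := x.2.2 s hs
      rw [h1, h2, hρ0]
    · exact ⟨0, fun h => absurd h hx⟩
  choose r hr using hex
  -- `r` is prescribed by its values, so in coordinates it agrees near each point with the local
  -- analytic formula `G`.
  refine ⟨r, hr, contDiffOn_one_of_comp (coords 𝔄 R A)
    (C := ‖ofCoords 𝔄 R (n := n)‖₊) (norm_le_norm_coords 𝔄 R A) (isOpen_into hI hΩ) ?_⟩
  intro x₀ hx₀
  obtain ⟨G, hGa, hG⟩ := hloc x₀ hx₀
  have h1 : ContDiffAt ℂ 1 (G ∘ coords 𝔄 R A) x₀ :=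
    hGa.contDiffAt.comp x₀ (coords 𝔄 R A).contDiff.contDiffAt
  refine (h1.congr_of_eventuallyEq ?_).contDiffWithinAt
  filter_upwards [(coords 𝔄 R A).continuous.continuousAt.eventually hG,
    (isOpen_into hI hΩ).mem_nhds hx₀] with x hx hxΩ
  funext j
  refine toMap_injective 𝔄 R ∅ (ContinuousMap.ext fun s => ?_)
  rw [Function.comp_apply, Function.comp_apply, hx j s, toMap_coords, hr x hxΩ s]
  rfl

end MapSpace

end Retractions

theorem proposition2p1 {d n : ℕ}
    -- `S` is a compact smooth `d`-manifold, possibly with boundary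
    {H : Type*} [TopologicalSpace H] (I : ModelWithCorners ℝ (EuclideanSpace ℝ (Fin d)) H)
    (hI : range I = univ ∨
      ∃ l : EuclideanSpace ℝ (Fin d) →L[ℝ] ℝ, l ≠ 0 ∧ range I = {v | 0 ≤ l v})
    {S : Type*} [TopologicalSpace S] [CompactSpace S] [T2Space S] [ChartedSpace H S]
    [IsManifold I ∞ S]
    (A : Set S) (hA : IsClosed A) (𝔄 : FiniteAtlas I S) (R : Regularity d)
    (Ω N : Set (EuclideanSpace ℂ (Fin n))) (hΩ : IsOpen Ω) (hN : IsComplexSubmanifold Ω N)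
    (h0 : (0 : EuclideanSpace ℂ (Fin n)) ∈ N)
    (ρ : EuclideanSpace ℂ (Fin n) → EuclideanSpace ℂ (Fin n))
    (hρ : IsHolomorphicRetraction Ω N ρ) :
    CompleteSpace (MapSpace 𝔄 R A (EuclideanSpace ℂ (Fin n))) ∧
    IsOpen (MapSpace.into 𝔄 R A Ω) ∧
    IsDirectComplexSubmanifold (MapSpace.into 𝔄 R A Ω) (MapSpace.into 𝔄 R A N) ∧
    ∃ r : MapSpace 𝔄 R A (EuclideanSpace ℂ (Fin n)) → MapSpace 𝔄 R A (EuclideanSpace ℂ (Fin n)),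
      (∀ x ∈ MapSpace.into 𝔄 R A Ω, ∀ s, (r x).toMap s = ρ (x.toMap s)) ∧
      IsHolomorphicRetraction (MapSpace.into 𝔄 R A Ω) (MapSpace.into 𝔄 R A N) r := by
  have hc := MapSpace.completeSpace 𝔄 R hI A (F := EuclideanSpace ℂ (Fin n))
  have hopen : IsOpen (MapSpace.into 𝔄 R A Ω) := MapSpace.isOpen_into hI hΩ
  have hNΩ := MapSpace.into_mono (𝔄 := 𝔄) (R := R) (A := A) hN.1
  obtain ⟨hρd, hρm, hρf⟩ := hρ
  have hρ0 : ρ 0 = 0 := hρf 0 h0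
  obtain ⟨r, hr, hrd⟩ := MapSpace.exists_comp_contDiffOn 𝔄 R A hI hΩ hρd hρ0
  have hmaps : MapsTo r (MapSpace.into 𝔄 R A Ω) (MapSpace.into 𝔄 R A N) := fun x hx =>
    MapSpace.mem_into_of_comp hρd.continuousOn hρm hρ0 hx (hr x hx)
  have hfix : ∀ x ∈ MapSpace.into 𝔄 R A N, r x = x := fun x hx =>
    MapSpace.toMap_injective 𝔄 R A (ContinuousMap.ext fun s => by
      rw [hr x (hNΩ hx) s, hρf _ (MapSpace.mem_of_mem_into hx s)])
  obtain ⟨C, hC, hNC⟩ := hN.2.1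
  -- The closed condition is that all values lie in `C`, where `N = Ω ∩ C`.
  have hcl : ∃ C', IsClosed C' ∧ MapSpace.into 𝔄 R A N = MapSpace.into 𝔄 R A Ω ∩ C' := by
    refine ⟨{x | ∀ s, x.toMap s ∈ C}, ?_, ?_⟩
    · rw [ofPred_forall]
      exact isClosed_iInter fun s => hC.preimage
        ((continuous_eval_const s).comp (MapSpace.toMapL 𝔄 R hI A).continuous)
    · refine Subset.antisymm (fun x hx => ⟨hNΩ hx, fun s => ?_⟩) fun x hx => ?_
      · exact (hNC ▸ MapSpace.mem_of_mem_into hx s : x.toMap s ∈ Ω ∩ C).2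
      -- Values in `N` alone do not give a null-homotopy inside `N`; it is obtained by applying `ρ`
      -- to the one in `Ω`, using `ρ ∘ x = x`.
      · refine MapSpace.mem_into_of_comp hρd.continuousOn hρm hρ0 hx.1 fun s => ?_
        exact (hρf _ (hNC ▸ ⟨MapSpace.mem_of_mem_into hx.1 s, hx.2 s⟩)).symm
  exact ⟨hc, hopen, isDirectComplexSubmanifold_of_retraction hopen hNΩ hcl hrd hmaps hfix,
    r, hr, hrd.differentiableOn (by simp), hmaps, hfix⟩

end
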